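/- Let $\mathbb H$ be the quaternions, $q=t+xi+yj+zk$, and let $\Omega\subset\mathbb H^n$ be open. A function $f:\Omega\to\mathbb R$ is called quaternionic plurisubharmonic (psh) if it is upper semicontinuous and its restriction to every right quaternionic line $\{a+vq : q\in\mathbb H\}$ ($a,v\in\mathbb H^n$, $v\ne0$) is subharmonic on the part of the line lying in $\Omega$; here a function on an open subset of $\mathbb R^4$ is subharmonic if it is upper semicontinuous and its value at each point $x$ is at most its mean over the sphere of centre $x$ and radius $r$, for all sufficiently small $r>0$. For a quaternionic hyperhermitian $n\times n$ matrix $A$ ($a_{ij}=\overline{a_{ji}}$) the Moore determinant $\det A$ is $P(A)$, where $P$ is the unique real polynomial on the space of such matrices with $P(\mathrm{Id})=1$ and $P(A)^4=\det({}^{\mathbb R}A)$, and ${}^{\mathbb R}A$ is the $4n\times4n$ matrix of the real symmetric bilinear form $\operatorname{Re}\sum_{i,j}\bar x_i a_{ij} y_j$ on $\mathbb H^n=\mathbb R^{4n}$. Put $$\frac{\partial g}{\partial\bar q}=\frac{\partial g}{\partial t}+i\frac{\partial g}{\partial x}+j\frac{\partial g}{\partial y}+k\frac{\partial g}{\partial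 z},\qquad \frac{\partial g}{\partial q}=\frac{\partial g}{\partial t}-\frac{\partial g}{\partial x}i-\frac{\partial g}{\partial y}j-\frac{\partial g}{\partial z}k .$$ For a real function $f$ of class $C^2$, $\det\big(\frac{\partial^2 f}{\partial q_i\partial\bar q_j}\big)$ denotes the Moore determinant of the hyperhermitian matrix of these derivatives in which the row index belongs to the conjugated variable, i.e. whose entry in row $i$ and column $j$ is $\frac{\partial^2 f}{\partial\bar q_i\partial q_j}$. For a continuous psh function $f$ on $\Omega$, $\det\big(\frac{\partial^2 f}{\partial q_i\partial\bar q_j}\big)$ denotes the non-negative Borel measure on $\Omega$, finite on compact subsets, such that for every open $U\subset\Omega$ and every sequence $(g_k)$ of psh functions of class $C^2$ on $U$ that converges to $f$ uniformly on compact subsets of $U$, $$\int_U\phi\,\det\Big(\frac{\partial^2 g_k}{\partial q_i\partial\bar q_j}\Big)\,dq\longrightarrow\int_U\phi\,d\det\Big(\frac{\partial^2 f}{\partial q_i\partial\bar q_j}\Big)$$ for all continuous $\phi$ with compact support in $U$. Theorem. Let $(f_N)$ be a sequence of continuous quaternionic plurisubharmonic functions on $\Omega$ that converges to a function $f$ uniformly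 on compact subsets of $\Omega$. Then $f$ is continuous and quaternionic plurisubharmonic. Moreover, the measures $\det\big(\frac{\partial^2 f_N}{\partial q_i\partial\bar q_j}\big)$ and $\det\big(\frac{\partial^2 f}{\partial q_i\partial\bar q_j}\big)$ exist and are unique, and the former converge weakly to the latter: for every continuous $\phi$ with compact support in $\Omega$, $$\int_\Omega\phi\,d\det\Big(\frac{\partial^2 f_N}{\partial q_i\partial\bar q_j}\Big)\longrightarrow\int_\Omega\phi\,d\det\Big(\frac{\partial^2 f}{\partial q_i\partial\bar q_j}\Big)\quad\text{as }N\to\infty .$$ -/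

import Mathlib

open MeasureTheory Filter Topology Matrix
open scoped Quaternion

namespace QuatPsh

/-! ### The Moore determinant -/

/-- The basis `1, i, j, k` of `ℍ` over `ℝ`. -/
noncomputable def quatUnit : Fin 4 → ℍ := ![1, ⟨0, 1, 0, 0⟩, ⟨0, 0, 1, 0⟩, ⟨0, 0, 0, 1⟩]

lemma quatUnit_re (a : Fin 4) : (quatUnit a).re = if a = 0 then 1 else 0 := by
  fin_cases a <;> simp [quatUnit]
lemma quatUnit_imI (a : Fin 4) : (quatUnit a).imI = if a = 1 then 1 else 0 := by
  fin_cases a <;> simp [quatUnit]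
lemma quatUnit_imJ (a : Fin 4) : (quatUnit a).imJ = if a = 2 then 1 else 0 := by
  fin_cases a <;> simp [quatUnit]
lemma quatUnit_imK (a : Fin 4) : (quatUnit a).imK = if a = 3 then 1 else 0 := by
  fin_cases a <;> simp [quatUnit]

/-- The real `4n × 4n` matrix of the real bilinear form `(x, y) ↦ Re (∑ i j, conj (x i) * A i j * y j)`
on `ℍⁿ = ℝ⁴ⁿ`. -/
noncomputable def realForm {n : ℕ} (A : Matrix (Fin n) (Fin n) ℍ) :
    Matrix (Fin n × Fin 4) (Fin n × Fin 4) ℝ :=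
  Matrix.of fun p q => (star (quatUnit p.2) * A p.1 q.1 * quatUnit q.2).re

/-- The four real coordinates of a quaternion. -/
def quatCoord (q : ℍ) : Fin 4 → ℝ := ![q.re, q.imI, q.imJ, q.imK]

/-- The `4n²` real coordinates of a quaternionic `n × n` matrix. -/
def coords {n : ℕ} (A : Matrix (Fin n) (Fin n) ℍ) : Fin n × Fin n × Fin 4 → ℝ :=
  fun p => quatCoord (A p.1 p.2.1) p.2.2

/-- `P` is a real polynomial in the entries with `P(1) = 1` and `P(A)⁴ = det (realForm A)` for every
hyperhermitian matrix `A`. These two properties determine the values of `P` on hyperhermitian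
matrices. -/
structure IsMoorePolynomial {n : ℕ} (P : MvPolynomial (Fin n × Fin n × Fin 4) ℝ) : Prop where
  eval_one : MvPolynomial.eval (coords (1 : Matrix (Fin n) (Fin n) ℍ)) P = 1
  pow_four : ∀ A : Matrix (Fin n) (Fin n) ℍ, A.IsHermitian →
    MvPolynomial.eval (coords A) P ^ 4 = (realForm A).det

lemma realForm_isHermitian {n : ℕ} {A : Matrix (Fin n) (Fin n) ℍ} (hA : A.IsHermitian) :
    (realForm A).IsHermitian := by
  ext p q
  have h : A p.1 q.1 = star (A q.1 p.1) := (hA.apply p.1 q.1).symm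
  simp only [realForm, conjTranspose_apply, of_apply, star_trivial]
  rw [h, ← Quaternion.re_star]
  simp [mul_assoc]

lemma sum_re_quatUnit (q : ℍ) : ∑ a, (star (quatUnit a) * q).re • quatUnit a = q := by
  rw [Fin.sum_univ_four]
  ext <;> simp [quatUnit_re, quatUnit_imI, quatUnit_imJ, quatUnit_imK]

/-- The identification `ℝ⁴ⁿ = ℍⁿ`. -/
noncomputable def toQuat (n : ℕ) : (Fin n × Fin 4 → ℝ) →ₗ[ℝ] (Fin n → ℍ) where
  toFun x i := ∑ a, x (i, a) • quatUnit a
  map_add' x y := by ext1 i; simp [add_smul, Finset.sum_add_distrib]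
  map_smul' c x := by ext1 i; simp [mul_smul, Finset.smul_sum]

lemma toQuat_injective (n : ℕ) : Function.Injective (toQuat n) := by
  rw [injective_iff_map_eq_zero]
  intro x hx
  ext ⟨i, a⟩
  have h := congrFun hx i
  simp only [toQuat, LinearMap.coe_mk, AddHom.coe_mk, Pi.zero_apply, Fin.sum_univ_four] at h
  have h0 := congrArg (fun q : ℍ => q.re) h
  have h1 := congrArg (fun q : ℍ => q.imI) h
  have h2 := congrArg (fun q : ℍ => q.imJ) h
  have h3 := congrArg (fun q : ℍ => q.imK) h
  simp [quatUnit_re, quatUnit_imI, quatUnit_imJ, quatUnit_imK] at h0 h1 h2 h3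
  fin_cases a <;> simp_all

/-- The real part as an additive map. -/
def reHom : ℍ →+ ℝ where
  toFun q := q.re
  map_zero' := rfl
  map_add' _ _ := rfl

lemma toQuat_mulVec {n : ℕ} (A : Matrix (Fin n) (Fin n) ℍ) (x : Fin n × Fin 4 → ℝ) :
    toQuat n (realForm A *ᵥ x) = A *ᵥ toQuat n x := by
  ext1 i
  simp only [toQuat, LinearMap.coe_mk, AddHom.coe_mk, mulVec, dotProduct, realForm, of_apply]
  rw [← sum_re_quatUnit (∑ j, A i j * ∑ a, x (j, a) • quatUnit a)]
  refine Finset.sum_congr rfl fun a _ => ?_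
  congr 1
  rw [Fintype.sum_prod_type, Finset.mul_sum]
  have : ∀ f : Fin n → ℍ, (∑ j, f j).re = ∑ j, (f j).re := fun f => map_sum reHom f Finset.univ
  have h4 : ∀ f : Fin 4 → ℍ, (∑ j, f j).re = ∑ j, (f j).re := fun f => map_sum reHom f Finset.univ
  rw [this]
  refine Finset.sum_congr rfl fun j _ => ?_
  rw [Finset.mul_sum, Finset.mul_sum, h4]
  refine Finset.sum_congr rfl fun b _ => ?_
  simp [mul_assoc, mul_comm]

/-- The right quaternionic subspace `{y | A y = μ y}` of `ℍⁿ`. -/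
noncomputable def quatEigenspace {n : ℕ} (A : Matrix (Fin n) (Fin n) ℍ) (μ : ℝ) :
    Submodule ℍᵐᵒᵖ (Fin n → ℍ) where
  carrier := {y | A *ᵥ y = μ • y}
  zero_mem' := by simp
  add_mem' {x y} hx hy := by simp_all [mulVec_add]
  smul_mem' c x hx := by
    simp only [Set.mem_ofPred_eq] at *
    rw [mulVec_smul, hx, smul_comm]

lemma four_dvd_finrank {n : ℕ} (A : Matrix (Fin n) (Fin n) ℍ) (μ : ℝ) :
    4 ∣ Module.finrank ℝ (Module.End.eigenspace (toEuclideanLin (𝕜 := ℝ) (realForm A)) μ) := by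
  have h4 : Module.finrank ℝ ℍᵐᵒᵖ = 4 := by
    rw [← (MulOpposite.opLinearEquiv ℝ (M := ℍ)).finrank_eq, Quaternion.finrank_eq_four]
  have hd : 4 ∣ Module.finrank ℝ (quatEigenspace A μ) := by
    rw [← Module.finrank_mul_finrank ℝ ℍᵐᵒᵖ, h4]
    exact dvd_mul_right _ _
  have hs : Function.Surjective (toQuat n) := by
    refine (LinearMap.injective_iff_surjective_of_finrank_eq_finrank ?_).1 (toQuat_injective n)
    simp [Module.finrank_pi_fintype, Quaternion.finrank_eq_four]
  let E : EuclideanSpace ℝ (Fin n × Fin 4) ≃ₗ[ℝ] (Fin n → ℍ) :=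
    (WithLp.linearEquiv 2 ℝ _).trans (LinearEquiv.ofBijective (toQuat n) ⟨toQuat_injective n, hs⟩)
  have hE : ∀ x, E x = toQuat n x.ofLp := fun _ => rfl
  convert hd using 1
  refine LinearEquiv.finrank_eq (E.ofSubmodules _ ((quatEigenspace A μ).restrictScalars ℝ) ?_)
  ext y
  obtain ⟨x, rfl⟩ := E.surjective y
  rw [Submodule.mem_map_equiv, E.symm_apply_apply, Module.End.mem_eigenspace_iff,
    ← E.injective.eq_iff, map_smul, hE, hE, toLpLin_apply, toQuat_mulVec]
  rfl

lemma four_dvd_card {n : ℕ} {A : Matrix (Fin n) (Fin n) ℍ} (hA : (realForm A).IsHermitian)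
    (μ : ℝ) : 4 ∣ Finset.card {i | hA.eigenvalues i = μ} := by
  have h := LinearMap.IsSymmetric.card_filter_eigenvalues_eq
    (isSymmetric_toEuclideanLin_iff.mpr hA) finrank_euclideanSpace μ
  have h' := four_dvd_finrank A μ
  rw [← h] at h'
  convert h' using 1
  refine Finset.card_equiv (Fintype.equivOfCardEq (Fintype.card_fin _)).symm ?_
  intro i
  rw [Finset.mem_filter_univ, Finset.mem_filter_univ]
  rfl

lemma exists_quarter (M : Multiset ℝ) (h : ∀ μ, 4 ∣ M.count μ) : ∃ M' : Multiset ℝ, M = 4 • M' := by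
  refine ⟨∑ μ ∈ M.toFinset, (M.count μ / 4) • {μ}, ?_⟩
  conv_lhs => rw [← Multiset.toFinset_sum_count_nsmul_eq M]
  rw [Finset.smul_sum]
  refine Finset.sum_congr rfl fun μ _ => ?_
  rw [smul_smul, Nat.mul_div_cancel' (h μ)]

lemma exists_eigenvalues {n : ℕ} {A : Matrix (Fin n) (Fin n) ℍ} (hA : A.IsHermitian) :
    ∃ l : Fin n → ℝ, (realForm A).det = (∏ i, l i) ^ 4 ∧
      ∀ k : ℕ, ((realForm A) ^ k).trace = 4 * ∑ i, l i ^ k := by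
  classical
  have hS := realForm_isHermitian hA
  obtain ⟨M', hM'⟩ := exists_quarter (Finset.univ.val.map hS.eigenvalues) (by
    intro μ
    rw [Multiset.count_map]
    simpa [Finset.card, Finset.filter, eq_comm] using four_dvd_card hS μ)
  have hc : M'.card = n := by
    have := congrArg Multiset.card hM'
    simp at this
    omega
  obtain ⟨l, rfl⟩ : ∃ l : Fin n → ℝ, M' = Finset.univ.val.map l := by
    subst hc
    obtain ⟨L, rfl⟩ := Quot.exists_rep M'
    refine ⟨L.get, ?_⟩
    have h := Fin.univ_val_map L.get
    rw [List.ofFn_get] at h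
    exact h.symm
  refine ⟨l, ?_, fun k => ?_⟩
  · rw [hS.det_eq_prod_eigenvalues]
    have := congrArg Multiset.prod hM'
    rw [Multiset.prod_nsmul] at this
    exact this
  · have h1 : ((realForm A) ^ k).trace = ∑ i, hS.eigenvalues i ^ k := by
      conv_lhs => rw [hS.spectral_theorem]
      rw [← map_pow, Unitary.conjStarAlgAut_apply, trace_mul_comm, ← mul_assoc]
      simp [diagonal_pow, trace]
    have := congrArg (fun M => (M.map (· ^ k)).sum) hM'
    simp only [Multiset.map_nsmul, Multiset.map_map, Multiset.sum_nsmul, nsmul_eq_mul] at this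
    rw [h1]
    exact this

/-- The matrix `realForm` with the coordinates of `A` as formal variables. -/
noncomputable def genForm (n : ℕ) :
    Matrix (Fin n × Fin 4) (Fin n × Fin 4) (MvPolynomial (Fin n × Fin n × Fin 4) ℝ) :=
  Matrix.of fun p q => ∑ c, MvPolynomial.C (star (quatUnit p.2) * quatUnit c * quatUnit q.2).re *
    MvPolynomial.X (p.1, q.1, c)

lemma genForm_map {n : ℕ} (A : Matrix (Fin n) (Fin n) ℍ) :
    (MvPolynomial.eval (coords A)).mapMatrix (genForm n) = realForm A := by
  ext ⟨i, a⟩ ⟨j, b⟩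
  simp only [genForm, realForm, coords, quatCoord, Fin.sum_univ_four, RingHom.mapMatrix_apply,
    map_apply, of_apply, map_add, map_mul, MvPolynomial.eval_C, MvPolynomial.eval_X]
  fin_cases a <;> fin_cases b <;> simp [quatUnit_re, quatUnit_imI, quatUnit_imJ, quatUnit_imK]

lemma exists_esymm (n k : ℕ) : ∃ P : MvPolynomial (Fin n × Fin n × Fin 4) ℝ,
    ∀ (A : Matrix (Fin n) (Fin n) ℍ) (l : Fin n → ℝ),
      (∀ k : ℕ, ((realForm A) ^ k).trace = 4 * ∑ i, l i ^ k) →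
      MvPolynomial.eval (coords A) P = MvPolynomial.eval l (MvPolynomial.esymm (Fin n) ℝ k) := by
  induction k using Nat.strong_induction_on with
  | _ k ih =>
    rcases Nat.eq_zero_or_pos k with rfl | hk
    · exact ⟨1, fun A l _ => by simp⟩
    choose! E hE using ih
    refine ⟨MvPolynomial.C ((k : ℝ)⁻¹) * ((-1) ^ (k + 1) *
      ∑ a ∈ Finset.HasAntidiagonal.antidiagonal k with a.1 < k,
        (-1) ^ a.1 * E a.1 * (MvPolynomial.C (4⁻¹ : ℝ) * ((genForm n) ^ a.2).trace)), ?_⟩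
    intro A l hl
    have hk' : (k : ℝ) ≠ 0 := by positivity
    have hN := congrArg (MvPolynomial.eval l) (MvPolynomial.mul_esymm_eq_sum (Fin n) ℝ k)
    have ht : ∀ m, MvPolynomial.eval (coords A) ((genForm n) ^ m).trace = 4 * ∑ i, l i ^ m := by
      intro m
      rw [← hl, ← genForm_map A, ← map_pow]
      simp [trace]
    rw [← mul_right_inj' hk']
    simp only [map_mul, map_natCast] at hN
    rw [hN]
    simp only [map_mul, map_sum, map_pow, map_neg, map_one, MvPolynomial.eval_C, ht,
      MvPolynomial.psum, MvPolynomial.eval_X]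
    rw [mul_inv_cancel_left₀ hk']
    congr 1
    refine Finset.sum_congr rfl fun a ha => ?_
    rw [hE a.1 (Finset.mem_filter.1 ha).2 A l hl]
    ring

theorem exists_isMoorePolynomial (n : ℕ) :
    ∃ P : MvPolynomial (Fin n × Fin n × Fin 4) ℝ, IsMoorePolynomial P := by
  obtain ⟨P, hP⟩ := exists_esymm n n
  have hes : ∀ l : Fin n → ℝ, MvPolynomial.eval l (MvPolynomial.esymm (Fin n) ℝ n) = ∏ i, l i := by
    intro l
    have : Finset.powersetCard n (Finset.univ : Finset (Fin n)) = {Finset.univ} := by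
      simpa using Finset.powersetCard_self (Finset.univ : Finset (Fin n))
    simp [MvPolynomial.esymm, this]
  refine ⟨P, ?_, fun A hA => ?_⟩
  · rw [hP 1 (fun _ => 1), hes]
    · simp
    · intro k
      have : realForm (1 : Matrix (Fin n) (Fin n) ℍ) = 1 := by
        ext ⟨i, a⟩ ⟨j, b⟩
        simp only [realForm, of_apply, one_apply, Prod.mk.injEq]
        by_cases h : i = j
        · subst h
          fin_cases a <;> fin_cases b <;> simp [quatUnit_re, quatUnit_imI, quatUnit_imJ, quatUnit_imK]
        · simp [h]
      simp [this, mul_comm]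
  · obtain ⟨l, hd, ht⟩ := exists_eigenvalues hA
    rw [hP A l ht, hes, hd]

/-- The Moore determinant of a hyperhermitian matrix `A`: the value at `A` of the polynomial `P` with
`P(1) = 1` and `P(A)⁴ = det (realForm A)`. (Only its values on hyperhermitian matrices matter.) -/
noncomputable def mooreDet {n : ℕ} (A : Matrix (Fin n) (Fin n) ℍ) : ℝ :=
  MvPolynomial.eval (coords A) (exists_isMoorePolynomial n).choose

/-! ### Quaternionic plurisubharmonic functions -/

noncomputable instance instMeasurableSpaceQuaternion : MeasurableSpace ℍ := borel ℍ

instance instBorelSpaceQuaternion : BorelSpace ℍ := ⟨rfl⟩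

/-- `g` is subharmonic on `V`: it is upper semicontinuous on `V`, and at every point `x` of `V` its
value is at most its mean over the sphere of centre `x` and radius `r`, for all sufficiently small
`r > 0`. The mean is taken for the normalized surface measure. As `g` is bounded above on small
spheres, integrability only excludes that the mean is `-∞`. -/
def IsSubharmonicOn {E : Type*} [NormedAddCommGroup E] [InnerProductSpace ℝ E]
    [FiniteDimensional ℝ E] [MeasurableSpace E] [BorelSpace E] (g : E → ℝ) (V : Set E) : Prop :=
  UpperSemicontinuousOn g V ∧ ∀ x ∈ V, ∀ᶠ r : ℝ in 𝓝[>] 0,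
    Integrable (fun u : Metric.sphere (0 : E) 1 => g (x + r • (u : E)))
      (volume : Measure E).toSphere ∧
    g x ≤ ⨍ u : Metric.sphere (0 : E) 1, g (x + r • (u : E)) ∂(volume : Measure E).toSphere

/-- `f` is quaternionic plurisubharmonic on `Ω`: it is upper semicontinuous on `Ω` and its restriction
to every right quaternionic line `{a + v q | q ∈ ℍ}`, where `v ≠ 0`, is subharmonic. -/
def IsQuatPshOn {n : ℕ} (f : (Fin n → ℍ) → ℝ) (Ω : Set (Fin n → ℍ)) : Prop :=
  UpperSemicontinuousOn f Ω ∧ ∀ a v : Fin n → ℍ, v ≠ 0 →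
    IsSubharmonicOn (fun q : ℍ => f (fun i => a i + v i * q)) {q | (fun i => a i + v i * q) ∈ Ω}

/-! ### The quaternionic Hessian and the Monge-Ampère measure -/

/-- `∂g/∂q̄ᵢ = ∂g/∂tᵢ + i ∂g/∂xᵢ + j ∂g/∂yᵢ + k ∂g/∂zᵢ`. -/
noncomputable def dqbar {n : ℕ} (i : Fin n) (g : (Fin n → ℍ) → ℍ) (x : Fin n → ℍ) : ℍ :=
  ∑ a, quatUnit a * fderiv ℝ g x (Pi.single i (quatUnit a))

/-- `∂g/∂qᵢ = ∂g/∂tᵢ - ∂g/∂xᵢ i - ∂g/∂yᵢ j - ∂g/∂zᵢ k`. -/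
noncomputable def dq {n : ℕ} (i : Fin n) (g : (Fin n → ℍ) → ℍ) (x : Fin n → ℍ) : ℍ :=
  ∑ a, fderiv ℝ g x (Pi.single i (quatUnit a)) * star (quatUnit a)

/-- The quaternionic Hessian of a real function of class `C²`: the hyperhermitian matrix with entry
`∂²f/∂q̄ᵢ∂qⱼ` in row `i` and column `j`. The row index belongs to the conjugated variable: this is the
matrix whose form `∑ conj (v i) * H i j * v j` is the Laplacian of `f` along the right quaternionic
line in the direction `v`. (`dqbar i` and `dq j` commute.) -/
noncomputable def quatHessian {n : ℕ} (f : (Fin n → ℍ) → ℝ) (x : Fin n → ℍ) :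
    Matrix (Fin n) (Fin n) ℍ :=
  Matrix.of fun i j => dqbar i (dq j (fun y => (f y : ℍ))) x

/-- `μ` is the Monge-Ampère measure `det (∂²f/∂qᵢ∂q̄ⱼ)` of the continuous plurisubharmonic function `f`
on the open set `Ω`. It is a Borel measure on `Ω`, finite on compact subsets of `Ω` (it is carried as
a measure on `ℍⁿ` that vanishes outside `Ω`), and it is the weak limit of the measures
`det (∂²gₖ/∂qᵢ∂q̄ⱼ) dx` for every sequence of plurisubharmonic functions `gₖ` of class `C²` that
converges to `f` uniformly on compact subsets; this is required on `Ω` itself and on every open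
subset `U` of `Ω`, as convolutions of `f` are defined on smaller sets only. -/
structure IsMongeAmpereMeasure {n : ℕ} (Ω : Set (Fin n → ℍ)) (f : (Fin n → ℍ) → ℝ)
    (μ : Measure (Fin n → ℍ)) : Prop where
  compl_eq_zero : μ Ωᶜ = 0
  lt_top_of_isCompact : ∀ K ⊆ Ω, IsCompact K → μ K < ⊤
  tendsto : ∀ U ⊆ Ω, IsOpen U → ∀ g : ℕ → (Fin n → ℍ) → ℝ,
    (∀ k, ContDiffOn ℝ 2 (g k) U) → (∀ k, IsQuatPshOn (g k) U) →
    (∀ K ⊆ U, IsCompact K → TendstoUniformlyOn g f atTop K) →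
    ∀ φ : (Fin n → ℍ) → ℝ, Continuous φ → HasCompactSupport φ → tsupport φ ⊆ U →
      Tendsto (fun k => ∫ x in U, φ x * mooreDet (quatHessian (g k) x)) atTop (𝓝 (∫ x, φ x ∂μ))

end QuatPsh

namespace QuatPsh

/-! ### The Moore determinant as a function of a real bilinear form -/

/-! The Moore determinant, read as a function `mooreForm` of the real Hessian, is affine along every
rank-one line `S + t ξ ⊗ ξ`. Indeed its fourth power is the determinant of a real matrix perturbed
by `t` times a matrix of rank at most four, a polynomial in `t` of degree at most four
(`mooreForm_affine`). It is also nonnegative on the cone `pshCone`, which contains the Hessians of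
smooth plurisubharmonic functions (`IsQuatPshOn.hess_mem_pshCone`).

These facts alone drive the analysis (`IsNullLagrangian`). Affinity in rank-one directions makes the
cofactors of `Q` at a Hessian divergence free, so the linearization is formally self-adjoint. Along
the segment from `h` to `g`, the derivative of `∫ φ Q(hess w)` therefore equals `∫ (g - h) DQ(hess
w)(hess φ)`. It is bounded by `sup |g - h|` times the masses of the rank-one increments of `Q`.
Those increments are again null Lagrangians, nonnegative on the cone and unaffected by one more
direction, so induction bounds all masses (`IsNullLagrangian.exists_mass_bound`). Hence the pairing
with `φ` is uniformly continuous in the sup norm on bounded families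
(`IsNullLagrangian.exists_delta`, `exists_delta_maPairing`).

For merely continuous functions, the submean inequality on small spheres is upgraded to every sphere
bounding a ball inside the domain (`le_average_sphere_of_local_submean`). In that form it survives
uniform limits and convolution, so smooth plurisubharmonic approximations exist. Their pairings are
Cauchy, the limit is a positive functional represented by a measure, and choosing for each `N` a
smooth function close to the `N`-th one in both senses gives the weak convergence. -/

/-- The rank-one bilinear form `ξ ⊗ ξ`. -/
def outer {ι : Type*} (ξ : ι → ℝ) : ι → ι → ℝ := fun p q => ξ p * ξ q

/-- The hyperhermitian matrix of the symmetric part of a real bilinear form on `ℍⁿ`. -/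
noncomputable def ofForm (n : ℕ) :
    (Fin n × Fin 4 → Fin n × Fin 4 → ℝ) →ₗ[ℝ] (Fin n → Fin n → ℍ) where
  toFun S i j := ∑ a, ∑ b, ((S (i, a) (j, b) + S (j, b) (i, a)) / 2) •
    (quatUnit a * star (quatUnit b))
  map_add' S T := by
    ext1 i; ext1 j
    simp only [Pi.add_apply, ← Finset.sum_add_distrib, ← add_smul]
    refine Finset.sum_congr rfl fun a _ => Finset.sum_congr rfl fun b _ => ?_
    congr 1; ring
  map_smul' c S := by
    ext1 i; ext1 j
    simp only [Pi.smul_apply, Finset.smul_sum, smul_smul, RingHom.id_apply, smul_eq_mul]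
    refine Finset.sum_congr rfl fun a _ => Finset.sum_congr rfl fun b _ => ?_
    congr 1; ring

lemma ofForm_isHermitian {n : ℕ} (S : Fin n × Fin 4 → Fin n × Fin 4 → ℝ) :
    (Matrix.of (ofForm n S)).IsHermitian := by
  ext1 i j
  simp only [conjTranspose_apply, of_apply, ofForm, LinearMap.coe_mk, AddHom.coe_mk, star_sum]
  rw [Finset.sum_comm]
  refine Finset.sum_congr rfl fun a _ => Finset.sum_congr rfl fun b _ => ?_
  rw [Quaternion.star_smul, star_mul, star_star, add_comm]

/-- The matrix of right multiplication by the `k`-th unit quaternion. -/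
noncomputable def rightMul (n : ℕ) (k : Fin 4) : Matrix (Fin n × Fin 4) (Fin n × Fin 4) ℝ :=
  Matrix.of fun p q => if p.1 = q.1 then (star (quatUnit p.2) * quatUnit q.2 * quatUnit k).re else 0

/-- Both sides are the Euclidean inner product: `Re (p e_k)` is, up to sign, the `k`-th coordinate
of `p`. -/
lemma re_star_mul (p q : ℍ) :
    (star p * q).re = ∑ k, (p * quatUnit k).re * (q * quatUnit k).re := by
  simp [Fin.sum_univ_four, quatUnit_re, quatUnit_imI, quatUnit_imJ, quatUnit_imK]

lemma re_sum {α : Type*} (s : Finset α) (f : α → ℍ) : (∑ j ∈ s, f j).re = ∑ j ∈ s, (f j).re :=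
  map_sum reHom f s

/-- Passing to the hyperhermitian part amounts to summing the symmetrized form over right
multiplication by `1, i, j, k`. This reduces rank and sign questions to the real form `S`. -/
lemma realForm_ofForm {n : ℕ} (S : Fin n × Fin 4 → Fin n × Fin 4 → ℝ) :
    realForm (Matrix.of (ofForm n S)) =
      ∑ k, (rightMul n k)ᵀ * Matrix.of (fun p q => (S p q + S q p) / 2) * rightMul n k := by
  ext ⟨i, a⟩ ⟨j, b⟩
  have key : ∀ c d : Fin 4, (star (quatUnit a) * (quatUnit c * star (quatUnit d)) * quatUnit b).re =
      ∑ k, (star (quatUnit c) * quatUnit a * quatUnit k).re *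
        (star (quatUnit d) * quatUnit b * quatUnit k).re := by
    intro c d
    rw [← re_star_mul]
    simp [mul_assoc]
  simp only [realForm, of_apply, ofForm, LinearMap.coe_mk, AddHom.coe_mk, Matrix.sum_apply,
    Matrix.mul_apply, rightMul, transpose_apply, Fintype.sum_prod_type, Finset.mul_sum,
    Finset.sum_mul, re_sum, ite_mul, zero_mul, mul_ite, mul_zero, Finset.sum_ite_irrel,
    Finset.sum_const_zero, Finset.sum_ite_eq', Finset.mem_univ, if_true,
    mul_smul_comm, smul_mul_assoc, Quaternion.re_smul, key, smul_eq_mul]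
  rw [Finset.sum_comm]
  conv_rhs => rw [Finset.sum_comm]; enter [2, d]; rw [Finset.sum_comm]
  refine Finset.sum_congr rfl fun d _ => Finset.sum_congr rfl fun c _ =>
    Finset.sum_congr rfl fun k _ => ?_
  ring

lemma realForm_add_smul {n : ℕ} (A B : Matrix (Fin n) (Fin n) ℍ) (t : ℝ) :
    realForm (A + t • B) = realForm A + t • realForm B := by
  ext p q
  simp [realForm, mul_add, add_mul]

lemma realForm_one {n : ℕ} : realForm (1 : Matrix (Fin n) (Fin n) ℍ) = 1 := by
  ext ⟨i, a⟩ ⟨j, b⟩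
  simp only [realForm, of_apply, one_apply, Prod.mk.injEq]
  by_cases h : i = j
  · subst h
    fin_cases a <;> fin_cases b <;> simp [quatUnit_re, quatUnit_imI, quatUnit_imJ, quatUnit_imK]
  · simp [h]

lemma coords_add_smul {n : ℕ} (A B : Matrix (Fin n) (Fin n) ℍ) (t : ℝ) :
    coords (A + t • B) = coords A + t • coords B := by
  ext ⟨i, j, c⟩
  fin_cases c <;> simp [coords, quatCoord]

lemma mooreDet_pow_four {n : ℕ} {A : Matrix (Fin n) (Fin n) ℍ} (hA : A.IsHermitian) :
    mooreDet A ^ 4 = (realForm A).det :=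
  (exists_isMoorePolynomial n).choose_spec.pow_four A hA

lemma mooreDet_one {n : ℕ} : mooreDet (1 : Matrix (Fin n) (Fin n) ℍ) = 1 :=
  (exists_isMoorePolynomial n).choose_spec.eval_one

lemma exists_poly_mooreDet {n : ℕ} (A B : Matrix (Fin n) (Fin n) ℍ) :
    ∃ p : Polynomial ℝ, ∀ t : ℝ, p.eval t = mooreDet (A + t • B) := by
  refine ⟨MvPolynomial.aeval (fun c => Polynomial.C (coords A c) +
    Polynomial.X * Polynomial.C (coords B c)) (exists_isMoorePolynomial n).choose, fun t => ?_⟩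
  rw [mooreDet, coords_add_smul, ← Polynomial.coe_evalRingHom, MvPolynomial.aeval_def,
    MvPolynomial.hom_eval₂, MvPolynomial.eval, MvPolynomial.coe_eval₂Hom]
  congr 1
  · ext; simp
  · ext c; simp [mul_comm t]

/-- A perturbation of rank at most four changes the determinant by a polynomial of degree at most
four: it is a Schur complement in a block matrix whose variable occurs in four columns only. -/
lemma exists_poly_det {N : Type*} [Fintype N] [DecidableEq N] (R : Matrix N N ℝ)
    (W : Matrix N (Fin 4) ℝ) :
    ∃ d : Polynomial ℝ, d.natDegree ≤ 4 ∧ ∀ t : ℝ, d.eval t = (R + t • (W * Wᵀ)).det := by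
  refine ⟨(fromBlocks (R.map Polynomial.C) (-(Polynomial.X : Polynomial ℝ) • W.map Polynomial.C)
    (Wᵀ.map Polynomial.C) 1).det, ?_, fun t => ?_⟩
  · rw [det_apply]
    refine Polynomial.natDegree_sum_le_of_forall_le _ _ fun σ _ => ?_
    refine (Polynomial.natDegree_smul_le _ _).trans ((Polynomial.natDegree_prod_le _ _).trans ?_)
    calc _ ≤ ∑ i : N ⊕ Fin 4, Sum.elim (fun _ => 0) (fun _ => 1) i := by
          refine Finset.sum_le_sum fun i _ => ?_
          rcases i with i | i <;> rcases σ _ with j | j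
          · simp
          · simp
          · simp only [fromBlocks_apply₁₂, Matrix.smul_apply, map_apply, smul_eq_mul, Sum.elim_inr]
            compute_degree
          · by_cases h : j = i <;> simp [h]
      _ ≤ 4 := by simp
  · rw [← Polynomial.coe_evalRingHom, RingHom.map_det, RingHom.mapMatrix_apply, fromBlocks_map]
    have h1 : (1 : Matrix (Fin 4) (Fin 4) (Polynomial ℝ)).map (Polynomial.evalRingHom t) = 1 :=
      Matrix.map_one _ (map_zero _) (map_one _)
    rw [h1, det_fromBlocks_one₂₂]
    congr 1
    ext p q
    simp only [Matrix.sub_apply, Matrix.mul_apply, map_apply, Matrix.smul_apply, transpose_apply,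
      Polynomial.coe_evalRingHom, smul_eq_mul, Polynomial.eval_mul, Polynomial.eval_neg,
      Polynomial.eval_X, Polynomial.eval_C, Matrix.add_apply, Finset.mul_sum, neg_mul,
      Finset.sum_neg_distrib, sub_neg_eq_add, mul_assoc]

lemma realForm_ofForm_outer {n : ℕ} (ξ : Fin n × Fin 4 → ℝ) :
    ∃ W : Matrix (Fin n × Fin 4) (Fin 4) ℝ,
      realForm (Matrix.of (ofForm n (outer ξ))) = W * Wᵀ := by
  refine ⟨Matrix.of fun p k => ((rightMul n k)ᵀ *ᵥ ξ) p, ?_⟩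
  rw [realForm_ofForm]
  ext p q
  simp only [Matrix.sum_apply, Matrix.mul_apply, of_apply, transpose_apply, mulVec, dotProduct,
    outer, Finset.sum_mul_sum]
  refine Finset.sum_congr rfl fun k _ => ?_
  simp only [Finset.sum_mul]
  rw [Finset.sum_comm]
  refine Finset.sum_congr rfl fun a _ => Finset.sum_congr rfl fun b _ => ?_
  ring

/-- The Moore determinant of the hyperhermitian matrix of a real bilinear form. -/
noncomputable def mooreForm (n : ℕ) (S : Fin n × Fin 4 → Fin n × Fin 4 → ℝ) : ℝ :=
  mooreDet (Matrix.of (ofForm n S))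

lemma of_ofForm_add_smul {n : ℕ} (S T : Fin n × Fin 4 → Fin n × Fin 4 → ℝ) (t : ℝ) :
    Matrix.of (ofForm n (S + t • T)) = Matrix.of (ofForm n S) + t • Matrix.of (ofForm n T) := by
  rw [map_add, map_smul]; rfl

/-- The restriction to the line is a polynomial `p` with `p ^ 4` of degree at most four, so `p` has
degree at most one. This is where the fourth power in the definition is decisive. -/
lemma mooreForm_affine {n : ℕ} (S : Fin n × Fin 4 → Fin n × Fin 4 → ℝ) (ξ : Fin n × Fin 4 → ℝ)
    (t : ℝ) : mooreForm n (S + t • outer ξ) =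
      mooreForm n S + t * (mooreForm n (S + outer ξ) - mooreForm n S) := by
  obtain ⟨p, hp⟩ := exists_poly_mooreDet (Matrix.of (ofForm n S)) (Matrix.of (ofForm n (outer ξ)))
  obtain ⟨W, hW⟩ := realForm_ofForm_outer ξ
  obtain ⟨d, hd, hd'⟩ := exists_poly_det (realForm (Matrix.of (ofForm n S))) W
  have hpd : p ^ 4 = d := by
    refine Polynomial.funext fun t => ?_
    rw [Polynomial.eval_pow, hp, hd', ← hW, ← realForm_add_smul, ← of_ofForm_add_smul,
      mooreDet_pow_four (ofForm_isHermitian _)]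
  have hdeg : p.natDegree ≤ 1 := by
    rw [← hpd, Polynomial.natDegree_pow] at hd
    omega
  obtain ⟨a, b, rfl⟩ := Polynomial.exists_eq_X_add_C_of_natDegree_le_one hdeg
  have h : ∀ t : ℝ, mooreForm n (S + t • outer ξ) = a * t + b := by
    intro t
    rw [mooreForm, of_ofForm_add_smul, ← hp]
    simp
  have h0 := h 0
  have h1 := h 1
  simp only [zero_smul, add_zero, one_smul] at h0 h1
  rw [h, h0, h1]
  ring

lemma continuous_mooreDet_line {n : ℕ} (A B : Matrix (Fin n) (Fin n) ℍ) :
    Continuous fun t : ℝ => mooreDet (A + t • B) := by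
  obtain ⟨p, hp⟩ := exists_poly_mooreDet A B
  simp_rw [← hp]
  exact p.continuous

/-- The fourth power leaves the sign open. It is settled by continuity: on the segment from `1` to
`A` all real forms are positive definite, so the Moore determinant has no zero there, and it equals
`1` at the start. -/
lemma mooreDet_pos {n : ℕ} {A : Matrix (Fin n) (Fin n) ℍ} (hA : A.IsHermitian)
    (h : (realForm A).PosDef) : 0 < mooreDet A := by
  have hc := continuous_mooreDet_line 1 (A - 1)
  have hr : ∀ t : ℝ, (1 : Matrix (Fin n) (Fin n) ℍ) + t • (A - 1) = (1 - t) • 1 + t • A := by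
    intro t; rw [smul_sub, sub_smul, one_smul]; abel
  have hne : ∀ t ∈ Set.Icc (0 : ℝ) 1, mooreDet (1 + t • (A - 1)) ≠ 0 := by
    intro t ht h0
    have hH : (1 + t • (A - 1) : Matrix (Fin n) (Fin n) ℍ).IsHermitian := by
      refine isHermitian_one.add ?_
      ext1 i j
      rw [conjTranspose_apply, Matrix.smul_apply, Quaternion.star_smul, Matrix.smul_apply,
        (hA.sub isHermitian_one).apply]
    have h4 := mooreDet_pow_four hH
    rw [h0, hr, realForm_add_smul] at h4
    have h5 : realForm ((1 - t) • (1 : Matrix (Fin n) (Fin n) ℍ)) = (1 - t) • 1 := by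
      have := realForm_add_smul 0 (1 : Matrix (Fin n) (Fin n) ℍ) (1 - t)
      rw [zero_add, realForm_one] at this
      rw [this]
      ext p q; simp [realForm]
    rw [h5] at h4
    have hpd : ((1 - t) • (1 : Matrix (Fin n × Fin 4) (Fin n × Fin 4) ℝ) + t • realForm A).PosDef := by
      rcases ht.1.eq_or_lt with rfl | h0t
      · simpa using PosDef.one
      · exact PosDef.posSemidef_add (PosSemidef.one.smul (by linarith [ht.2])) (h.smul h0t)
    have := hpd.det_pos
    norm_num at h4
    linarith
  by_contra! hle
  have h1 : mooreDet (1 + (1 : ℝ) • (A - 1)) ≤ 0 := by simpa using hle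
  have h0 : (0 : ℝ) ≤ mooreDet (1 + (0 : ℝ) • (A - 1)) := by simp [mooreDet_one]
  obtain ⟨t, ht, ht'⟩ := intermediate_value_Icc' zero_le_one hc.continuousOn ⟨h1, h0⟩
  exact hne t ht ht'

lemma mooreDet_nonneg {n : ℕ} {A : Matrix (Fin n) (Fin n) ℍ} (hA : A.IsHermitian)
    (h : (realForm A).PosSemidef) : 0 ≤ mooreDet A := by
  have hc := continuous_mooreDet_line A 1
  have ht : Tendsto (fun t : ℝ => mooreDet (A + t • 1)) (𝓝[>] 0) (𝓝 (mooreDet A)) := by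
    have := hc.tendsto 0
    simp only [zero_smul, add_zero] at this
    exact this.mono_left nhdsWithin_le_nhds
  refine ge_of_tendsto ht ?_
  filter_upwards [self_mem_nhdsWithin] with t ht
  refine (mooreDet_pos (hA.add ?_) ?_).le
  · ext1 i j
    rw [conjTranspose_apply, Matrix.smul_apply, Quaternion.star_smul, Matrix.smul_apply,
        isHermitian_one.apply]
  · rw [realForm_add_smul, realForm_one]
    exact PosDef.posSemidef_add h (PosDef.one.smul ht)

/-- The value at `x` is the trace of `S` over the vectors `x, xi, xj, xk` spanning the right
quaternionic line of `x`, which links positivity of the matrix to subharmonicity on lines. -/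
lemma realForm_ofForm_quadratic {n : ℕ} (S : Fin n × Fin 4 → Fin n × Fin 4 → ℝ)
    (x : Fin n × Fin 4 → ℝ) :
    x ⬝ᵥ (realForm (Matrix.of (ofForm n S)) *ᵥ x) =
      ∑ k, ∑ p, ∑ q, S p q * (rightMul n k *ᵥ x) p * (rightMul n k *ᵥ x) q := by
  rw [realForm_ofForm, sum_mulVec, dotProduct_sum]
  refine Finset.sum_congr rfl fun k _ => ?_
  rw [← mulVec_mulVec, ← mulVec_mulVec, dotProduct_mulVec, vecMul_transpose]
  set y := rightMul n k *ᵥ x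
  simp only [dotProduct, mulVec, of_apply, Finset.mul_sum]
  have h : ∑ p, ∑ q, S p q * y p * y q = ∑ p, ∑ q, S q p * y p * y q := by
    rw [Finset.sum_comm]
    refine Finset.sum_congr rfl fun a _ => Finset.sum_congr rfl fun b _ => ?_
    ring
  have h2 : ∑ p, ∑ q, y p * ((S p q + S q p) / 2 * y q) =
      (∑ p, ∑ q, S p q * y p * y q + ∑ p, ∑ q, S q p * y p * y q) / 2 := by
    simp only [← Finset.sum_add_distrib, Finset.sum_div]
    refine Finset.sum_congr rfl fun a _ => Finset.sum_congr rfl fun b _ => ?_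
    ring
  rw [h2, ← h]
  ring

/-- The real bilinear forms on `ℍⁿ` whose trace on every right quaternionic line is nonnegative. -/
noncomputable def pshCone (n : ℕ) : ConvexCone ℝ (Fin n × Fin 4 → Fin n × Fin 4 → ℝ) where
  carrier := {S | ∀ x : Fin n × Fin 4 → ℝ,
    0 ≤ ∑ k, ∑ p, ∑ q, S p q * (rightMul n k *ᵥ x) p * (rightMul n k *ᵥ x) q}
  smul_mem' c hc S hS x := by
    have := mul_nonneg hc.le (hS x)
    simpa only [Finset.mul_sum, Pi.smul_apply, smul_eq_mul, mul_assoc] using this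
  add_mem' S hS T hT x := by
    have := add_nonneg (hS x) (hT x)
    simpa only [← Finset.sum_add_distrib, Pi.add_apply, ← add_mul] using this

lemma outer_mem_pshCone {n : ℕ} (ξ : Fin n × Fin 4 → ℝ) : outer ξ ∈ pshCone n := by
  intro x
  refine Finset.sum_nonneg fun k _ => ?_
  set y := rightMul n k *ᵥ x
  have : ∑ p, ∑ q, outer ξ p q * y p * y q = (∑ p, ξ p * y p) * (∑ q, ξ q * y q) := by
    rw [Finset.sum_mul_sum]
    refine Finset.sum_congr rfl fun a _ => Finset.sum_congr rfl fun b _ => ?_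
    simp only [outer]; ring
  rw [this]
  exact mul_self_nonneg _

lemma mooreForm_nonneg {n : ℕ} {S : Fin n × Fin 4 → Fin n × Fin 4 → ℝ} (hS : S ∈ pshCone n) :
    0 ≤ mooreForm n S := by
  refine mooreDet_nonneg (ofForm_isHermitian S) ?_
  refine PosSemidef.of_dotProduct_mulVec_nonneg (realForm_isHermitian (ofForm_isHermitian S)) ?_
  intro x
  rw [star_trivial, realForm_ofForm_quadratic]
  exact hS x

lemma contDiff_mooreForm (n : ℕ) : ContDiff ℝ ⊤ (mooreForm n) := by
  have hco : ∀ c, ContDiff ℝ ⊤ fun S => coords (Matrix.of (ofForm n S)) c := by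
    intro c
    let l : (Fin n × Fin 4 → Fin n × Fin 4 → ℝ) →ₗ[ℝ] ℝ :=
      { toFun := fun S => coords (Matrix.of (ofForm n S)) c
        map_add' := fun S T => by
          have := of_ofForm_add_smul S T 1
          rw [one_smul, one_smul] at this
          rw [this]
          simpa using congrFun (coords_add_smul (Matrix.of (ofForm n S)) (Matrix.of (ofForm n T)) 1) c
        map_smul' := fun t S => by
          have := of_ofForm_add_smul 0 S t
          rw [zero_add] at this
          rw [this, coords_add_smul]
          obtain ⟨i, j, c⟩ := c
          fin_cases c <;> simp [coords, quatCoord] }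
    exact l.toContinuousLinearMap.contDiff
  unfold mooreForm mooreDet
  induction (exists_isMoorePolynomial n).choose using MvPolynomial.induction_on with
  | C a => simpa using contDiff_const
  | add p q hp hq => simpa using hp.add hq
  | mul_X p c hp => simpa using hp.mul (hco c)

/-! ### Null Lagrangians in the second derivatives -/

section Hessian

open scoped ContDiff

variable {E : Type*} [NormedAddCommGroup E] [NormedSpace ℝ E] {ι : Type*}

/-- The derivative of `u` in the direction `v`. -/
noncomputable def dirDeriv (v : E) (u : E → ℝ) (x : E) : ℝ := fderiv ℝ u x v

/-- The matrix of second derivatives of `u` along the vectors `b p`. -/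
noncomputable def hess (b : ι → E) (u : E → ℝ) (x : E) : ι → ι → ℝ :=
  fun p q => dirDeriv (b p) (dirDeriv (b q) u) x

lemma two_le_infty : (2 : WithTop ℕ∞) ≤ ∞ :=
  WithTop.coe_le_coe.2 (le_top : (2 : ℕ∞) ≤ ⊤)

lemma contDiff_two {u : E → ℝ} (hu : ContDiff ℝ ∞ u) : ContDiff ℝ 2 u := hu.of_le two_le_infty

lemma contDiff_dirDeriv {u : E → ℝ} (hu : ContDiff ℝ ∞ u) (v : E) :
    ContDiff ℝ ∞ (dirDeriv v u) :=
  (hu.fderiv_right (m := ∞) le_rfl).clm_apply contDiff_const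

lemma dirDeriv_comm {u : E → ℝ} {x : E} (hu : ContDiffAt ℝ 2 u x) (v w : E) :
    dirDeriv v (dirDeriv w u) x = dirDeriv w (dirDeriv v u) x := by
  have hd : DifferentiableAt ℝ (fderiv ℝ u) x :=
    (hu.fderiv_right (m := 1) le_rfl).differentiableAt one_ne_zero
  have h : ∀ v w, dirDeriv v (dirDeriv w u) x = fderiv ℝ (fderiv ℝ u) x v w := by
    intro v w
    change fderiv ℝ (fun y => fderiv ℝ u y w) x v = _
    rw [fderiv_clm_apply hd (differentiableAt_const w)]
    simp
  rw [h, h]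
  exact (hu.isSymmSndFDerivAt (by simp)).eq v w

lemma dirDeriv_add {u w : E → ℝ} {x : E} (hu : DifferentiableAt ℝ u x)
    (hw : DifferentiableAt ℝ w x) (v : E) :
    dirDeriv v (fun y => u y + w y) x = dirDeriv v u x + dirDeriv v w x := by
  simp [dirDeriv, fderiv_fun_add hu hw]

lemma dirDeriv_mul {u w : E → ℝ} {x : E} (hu : DifferentiableAt ℝ u x)
    (hw : DifferentiableAt ℝ w x) (v : E) :
    dirDeriv v (fun y => u y * w y) x = u x * dirDeriv v w x + dirDeriv v u x * w x := by
  simp [dirDeriv, fderiv_fun_mul hu hw, mul_comm]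

lemma dirDeriv_const_mul {u : E → ℝ} {x : E} (hu : DifferentiableAt ℝ u x) (c : ℝ) (v : E) :
    dirDeriv v (fun y => c * u y) x = c * dirDeriv v u x := by
  simp [dirDeriv, fderiv_const_mul hu]

lemma hess_symm (b : ι → E) {u : E → ℝ} {x : E} (hu : ContDiffAt ℝ 2 u x) (p q : ι) :
    hess b u x p q = hess b u x q p := dirDeriv_comm hu _ _

lemma contDiff_hess [Fintype ι] (b : ι → E) {u : E → ℝ} (hu : ContDiff ℝ ∞ u) :
    ContDiff ℝ ∞ (hess b u) :=
  contDiff_pi.2 fun p => contDiff_pi.2 fun q => contDiff_dirDeriv (contDiff_dirDeriv hu (b q)) (b p)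

lemma hess_add (b : ι → E) {u w : E → ℝ} (hu : ContDiff ℝ ∞ u) (hw : ContDiff ℝ ∞ w) (x : E) :
    hess b (fun y => u y + w y) x = hess b u x + hess b w x := by
  ext p q
  have h : dirDeriv (b q) (fun y => u y + w y) =
      fun y => dirDeriv (b q) u y + dirDeriv (b q) w y := by
    ext y
    exact dirDeriv_add (hu.differentiable (by simp) y) (hw.differentiable (by simp) y) _
  simp only [hess, h, Pi.add_apply]
  exact dirDeriv_add ((contDiff_dirDeriv hu _).differentiable (by simp) x)
    ((contDiff_dirDeriv hw _).differentiable (by simp) x) _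

lemma hess_const_mul (b : ι → E) {u : E → ℝ} (hu : ContDiff ℝ ∞ u) (c : ℝ) (x : E) :
    hess b (fun y => c * u y) x = c • hess b u x := by
  ext p q
  have h : dirDeriv (b q) (fun y => c * u y) = fun y => c * dirDeriv (b q) u y := by
    ext y
    exact dirDeriv_const_mul (hu.differentiable (by simp) y) c _
  simp only [hess, h, Pi.smul_apply, smul_eq_mul]
  exact dirDeriv_const_mul ((contDiff_dirDeriv hu _).differentiable (by simp) x) c _

/-- The symmetric product of two vectors. -/
noncomputable def symProd (a b : ι → ℝ) : ι → ι → ℝ := fun p q => (a p * b q + a q * b p) / 2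

variable [Fintype ι]

/-- `Q` is smooth, affine along every rank-one line, and nonnegative on the cone `C`. -/
structure IsNullLagrangian (C : ConvexCone ℝ (ι → ι → ℝ)) (Q : (ι → ι → ℝ) → ℝ) : Prop where
  contDiff : ContDiff ℝ ∞ Q
  affine : ∀ S ξ (t : ℝ), Q (S + t • outer ξ) = Q S + t * (Q (S + outer ξ) - Q S)
  nonneg : ∀ S ∈ C, 0 ≤ Q S

variable {C : ConvexCone ℝ (ι → ι → ℝ)} {Q : (ι → ι → ℝ) → ℝ}

lemma IsNullLagrangian.fderiv_outer (hQ : IsNullLagrangian C Q) (S : ι → ι → ℝ) (ξ : ι → ℝ) :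
    fderiv ℝ Q S (outer ξ) = Q (S + outer ξ) - Q S := by
  have h1 : HasDerivAt (fun t : ℝ => Q (S + t • outer ξ)) (fderiv ℝ Q S (outer ξ)) 0 := by
    have hd : HasFDerivAt Q (fderiv ℝ Q S) (S + (0 : ℝ) • outer ξ) := by
      simpa using (hQ.contDiff.differentiable (by simp) S).hasFDerivAt
    have hl : HasDerivAt (fun t : ℝ => S + t • outer ξ) (outer ξ) 0 := by
      simpa using ((hasDerivAt_id (0 : ℝ)).smul_const (outer ξ)).const_add S
    exact hd.comp_hasDerivAt 0 hl
  have h2 : HasDerivAt (fun t : ℝ => Q (S + t • outer ξ)) (Q (S + outer ξ) - Q S) 0 := by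
    simp_rw [hQ.affine S ξ]
    simpa using ((hasDerivAt_id (0 : ℝ)).mul_const (Q (S + outer ξ) - Q S)).const_add (Q S)
  exact h1.unique h2

/-- Being affine along a rank-one line, `Q` has a constant slope there, so its second derivative in
that direction vanishes. -/
lemma IsNullLagrangian.fderiv_fderiv_outer (hQ : IsNullLagrangian C Q) (S : ι → ι → ℝ)
    (ξ : ι → ℝ) : fderiv ℝ (fderiv ℝ Q) S (outer ξ) (outer ξ) = 0 := by
  have hD : ContDiff ℝ ∞ (fderiv ℝ Q) := hQ.contDiff.fderiv_right (m := ∞) le_rfl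
  have h1 : HasDerivAt (fun t : ℝ => fderiv ℝ Q (S + t • outer ξ) (outer ξ))
      (fderiv ℝ (fderiv ℝ Q) S (outer ξ) (outer ξ)) 0 := by
    have hd : HasFDerivAt (fderiv ℝ Q) (fderiv ℝ (fderiv ℝ Q) S) (S + (0 : ℝ) • outer ξ) := by
      simpa using (hD.differentiable (by simp) S).hasFDerivAt
    have hl : HasDerivAt (fun t : ℝ => S + t • outer ξ) (outer ξ) 0 := by
      simpa using ((hasDerivAt_id (0 : ℝ)).smul_const (outer ξ)).const_add S
    exact (ContinuousLinearMap.apply ℝ ℝ (outer ξ)).hasFDerivAt.comp_hasDerivAt 0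
      (hd.comp_hasDerivAt 0 hl)
  have h2 : (fun t : ℝ => fderiv ℝ Q (S + t • outer ξ) (outer ξ)) =
      fun _ => Q (S + outer ξ) - Q S := by
    ext t
    have h3 : S + t • outer ξ + outer ξ = S + (t + 1) • outer ξ := by
      rw [add_smul, one_smul, add_assoc]
    rw [hQ.fderiv_outer, h3, hQ.affine S ξ t, hQ.affine S ξ (t + 1)]
    ring
  rw [h2] at h1
  exact h1.unique (hasDerivAt_const _ _)

omit [Fintype ι] in
lemma symProd_add_left (a b c : ι → ℝ) : symProd (a + b) c = symProd a c + symProd b c := by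
  ext p q; simp only [symProd, Pi.add_apply]; ring

omit [Fintype ι] in
lemma symProd_smul_left (t : ℝ) (a b : ι → ℝ) : symProd (t • a) b = t • symProd a b := by
  ext p q; simp only [symProd, Pi.smul_apply, smul_eq_mul]; ring

omit [Fintype ι] in
lemma symProd_add_smul_self (a b : ι → ℝ) (t : ℝ) : symProd (a + t • b) (a + t • b) =
    symProd a a + (2 * t) • symProd a b + (t * t) • symProd b b := by
  ext p q; simp only [symProd, Pi.add_apply, Pi.smul_apply, smul_eq_mul]; ring

omit [Fintype ι] in
-- The quartic form `ξ ↦ G (ξ ⊗ ξ, ξ ⊗ ξ)` vanishes, hence so does its full polarization, which is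
-- the sum over the three ways of pairing `a, b, c, d`.
lemma bilin_polarization (G : (ι → ι → ℝ) →L[ℝ] (ι → ι → ℝ) →L[ℝ] ℝ)
    (hs : ∀ X Y, G X Y = G Y X) (h0 : ∀ ξ, G (outer ξ) (outer ξ) = 0) (a b c d : ι → ℝ) :
    G (symProd a b) (symProd c d) + G (symProd b c) (symProd a d) +
      G (symProd a c) (symProd b d) = 0 := by
  have hself : ∀ ξ : ι → ℝ, outer ξ = symProd ξ ξ := by
    intro ξ; ext p q; simp only [outer, symProd]; ring
  have hA : ∀ x d, G (symProd x x) (symProd x d) = 0 := by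
    intro x d
    have h := fun u : ℝ => h0 (x + u • d)
    simp only [hself, symProd_add_smul_self, map_add, map_smul, _root_.add_apply,
      _root_.smul_apply, smul_eq_mul] at h
    have e1 := h 1
    have e2 := h (-1)
    have e3 := h 2
    have e4 := h (-2)
    have s1 := hs (symProd x d) (symProd x x)
    -- The values at `±1` and `±2` isolate the coefficient of `u`: the even terms cancel in the
    -- differences, and the weight `8` removes the cubic term.
    linear_combination (8 * (e1 - e2) - (e3 - e4)) / 48 - s1 / 2
  have hB : ∀ x c d, G (symProd x x) (symProd c d) + 2 * G (symProd x c) (symProd x d) = 0 := by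
    intro x c d
    have h := fun t : ℝ => hA (x + t • c) d
    simp only [symProd_add_smul_self] at h
    simp only [symProd_add_left, symProd_smul_left, map_add, map_smul, _root_.add_apply,
      _root_.smul_apply, smul_eq_mul] at h
    have e1 := h 1
    have e2 := h (-1)
    have e3 := hA c d
    linear_combination (e1 - e2) / 2 - e3
  have e1 := hB (a + (1 : ℝ) • b) c d
  have e2 := hB a c d
  have e3 := hB b c d
  simp only [symProd_add_smul_self] at e1
  simp only [symProd_add_left, symProd_smul_left, map_add, map_smul, _root_.add_apply,
    _root_.smul_apply, smul_eq_mul] at e1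
  linear_combination (e1 - e2 - e3) / 2

variable [DecidableEq ι]

/-- The symmetric product of two coordinate vectors. -/
noncomputable def symUnit (p q : ι) : ι → ι → ℝ := symProd (Pi.single p 1) (Pi.single q 1)

omit [Fintype ι] in
lemma symUnit_comm (p q : ι) : symUnit p q = symUnit q p := by
  ext r s; simp only [symUnit, symProd]; ring

lemma eq_sum_symUnit {S : ι → ι → ℝ} (hS : ∀ p q, S p q = S q p) :
    S = ∑ p, ∑ q, S p q • symUnit p q := by
  ext r s
  simp only [Finset.sum_apply, Pi.smul_apply, symUnit, symProd, smul_eq_mul, Pi.single_apply]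
  have : ∀ p q, S p q * (((if r = p then 1 else 0) * (if s = q then 1 else 0) +
      (if s = p then 1 else 0) * (if r = q then 1 else 0)) / 2) =
      (if r = p then (if s = q then S p q / 2 else 0) else 0) +
      (if s = p then (if r = q then S p q / 2 else 0) else 0) := by
    intro p q
    split_ifs <;> simp <;> ring
  simp only [this, Finset.sum_add_distrib, Finset.sum_ite_irrel, Finset.sum_const_zero,
    Finset.sum_ite_eq, Finset.mem_univ, if_true]
  rw [hS s r]; ring

omit [DecidableEq ι] in
-- As `w` is totally symmetric, permuting the indices of `c` does not change the contraction. Three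
-- copies of it therefore add up to a contraction with zero.
lemma sum_symm_mul_eq_zero {w c : ι → ι → ι → ℝ} (hw1 : ∀ p r s, w p r s = w r p s)
    (hw2 : ∀ p r s, w p r s = w p s r) (hc : ∀ p r s, c p r s + c r p s + c s r p = 0) :
    ∑ p, ∑ r, ∑ s, w p r s * c p r s = 0 := by
  have e1 : ∑ p, ∑ r, ∑ s, w p r s * c p r s = ∑ p, ∑ r, ∑ s, w p r s * c r p s := by
    rw [Finset.sum_comm]
    refine Finset.sum_congr rfl fun p _ => Finset.sum_congr rfl fun r _ =>
      Finset.sum_congr rfl fun s _ => ?_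
    rw [hw1]
  have e2 : ∑ p, ∑ r, ∑ s, w p r s * c p r s = ∑ p, ∑ r, ∑ s, w p r s * c s r p := by
    calc _ = ∑ p, ∑ s, ∑ r, w p r s * c p r s :=
          Finset.sum_congr rfl fun p _ => Finset.sum_comm
      _ = ∑ s, ∑ p, ∑ r, w p r s * c p r s := Finset.sum_comm
      _ = ∑ s, ∑ r, ∑ p, w p r s * c p r s :=
          Finset.sum_congr rfl fun s _ => Finset.sum_comm
      _ = _ := by
          refine Finset.sum_congr rfl fun s _ => Finset.sum_congr rfl fun r _ =>
            Finset.sum_congr rfl fun p _ => ?_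
          rw [hw1 p r s, hw2 r p s, hw1 r s p]
  have e3 : ∑ p, ∑ r, ∑ s, w p r s * c p r s + ∑ p, ∑ r, ∑ s, w p r s * c r p s +
      ∑ p, ∑ r, ∑ s, w p r s * c s r p = 0 := by
    simp only [← Finset.sum_add_distrib, ← mul_add, hc, mul_zero, Finset.sum_const_zero]
  linarith

/-- The coefficients of the linearization of `Q` at the Hessian of `w`. -/
noncomputable def cofactor (b : ι → E) (Q : (ι → ι → ℝ) → ℝ) (w : E → ℝ) (p q : ι) (x : E) : ℝ :=
  fderiv ℝ Q (hess b w x) (symUnit p q)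

lemma IsNullLagrangian.contDiff_cofactor (hQ : IsNullLagrangian C Q) (b : ι → E) {w : E → ℝ}
    (hw : ContDiff ℝ ∞ w) (p q : ι) : ContDiff ℝ ∞ (cofactor b Q w p q) :=
  ((hQ.contDiff.fderiv_right (m := ∞) le_rfl).comp (contDiff_hess b hw)).clm_apply contDiff_const

omit [DecidableEq ι] in
lemma fderiv_hess_apply (b : ι → E) {w : E → ℝ} (hw : ContDiff ℝ ∞ w) (x v : E) :
    fderiv ℝ (hess b w) x v = fun p q => dirDeriv v (dirDeriv (b p) (dirDeriv (b q) w)) x := by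
  ext p q
  have hd := (contDiff_hess b hw).differentiable (by simp) x
  have h1 := hasFDerivAt_pi'.1 (hasFDerivAt_pi'.1 hd.hasFDerivAt p) q
  exact (congrArg (fun l : E →L[ℝ] ℝ => l v) h1.fderiv).symm

/-- A Piola identity: the divergence contracts the totally symmetric third derivatives of `w` with
the second derivative of `Q`, whose cyclic sums vanish by `bilin_polarization`. -/
lemma IsNullLagrangian.sum_dirDeriv_cofactor (hQ : IsNullLagrangian C Q) (b : ι → E) {w : E → ℝ}
    (hw : ContDiff ℝ ∞ w) (q : ι) (x : E) :
    ∑ p, dirDeriv (b p) (cofactor b Q w p q) x = 0 := by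
  have hD : ContDiff ℝ ∞ (fderiv ℝ Q) := hQ.contDiff.fderiv_right (m := ∞) le_rfl
  set G := fderiv ℝ (fderiv ℝ Q) (hess b w x) with hG
  have hG1 : ∀ p, dirDeriv (b p) (cofactor b Q w p q) x =
      ∑ r, ∑ s, dirDeriv (b p) (dirDeriv (b r) (dirDeriv (b s) w)) x *
        G (symUnit r s) (symUnit p q) := by
    intro p
    have hc : HasFDerivAt (fun y => fderiv ℝ Q (hess b w y))
        (G.comp (fderiv ℝ (hess b w) x)) x :=
      (hD.differentiable (by simp) _).hasFDerivAt.comp x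
        ((contDiff_hess b hw).differentiable (by simp) x).hasFDerivAt
    have hc2 := hc.clm_apply (hasFDerivAt_const (symUnit p q) x)
    have : dirDeriv (b p) (cofactor b Q w p q) x =
        G (fderiv ℝ (hess b w) x (b p)) (symUnit p q) := by
      unfold dirDeriv cofactor
      rw [hc2.fderiv]
      simp
    rw [this, fderiv_hess_apply b hw]
    conv_lhs => rw [eq_sum_symUnit (S := fun r s =>
      dirDeriv (b p) (dirDeriv (b r) (dirDeriv (b s) w)) x) (fun r s => by
        congr 1; ext y
        exact dirDeriv_comm (contDiff_two hw).contDiffAt _ _)]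
    simp only [map_sum, map_smul, _root_.sum_apply, _root_.smul_apply, smul_eq_mul]
  simp only [hG1]
  refine sum_symm_mul_eq_zero (w := fun p r s =>
    dirDeriv (b p) (dirDeriv (b r) (dirDeriv (b s) w)) x)
    (c := fun p r s => G (symUnit r s) (symUnit p q)) ?_ ?_ ?_
  · intro p r s
    exact dirDeriv_comm (contDiff_two (contDiff_dirDeriv hw (b s))).contDiffAt _ _
  · intro p r s
    congr 1; ext y
    exact dirDeriv_comm (contDiff_two hw).contDiffAt _ _
  · intro p r s
    have hsymm : ∀ X Y, G X Y = G Y X :=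
      (hQ.contDiff.contDiffAt.isSymmSndFDerivAt (by simpa using two_le_infty)).eq
    have := bilin_polarization G hsymm (hQ.fderiv_fderiv_outer _) (Pi.single r 1) (Pi.single s 1)
      (Pi.single p 1) (Pi.single q 1)
    change G (symUnit r s) (symUnit p q) + G (symUnit s p) (symUnit r q) +
      G (symUnit r p) (symUnit s q) = 0 at this
    rw [symUnit_comm p s]
    exact this

lemma fderiv_hess_eq_sum (b : ι → E) (w : E → ℝ) {u : E → ℝ} (hu : ContDiff ℝ ∞ u) (x : E) :
    fderiv ℝ Q (hess b w x) (hess b u x) =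
      ∑ p, ∑ q, dirDeriv (b p) (dirDeriv (b q) u) x * cofactor b Q w p q x := by
  conv_lhs => rw [eq_sum_symUnit (hess_symm b
    (contDiff_two hu).contDiffAt (x := x))]
  simp only [map_sum, map_smul, smul_eq_mul]
  rfl

end Hessian

/-! ### Integration by parts and self-adjointness of the linearization -/

section IntegrationByParts

open scoped ContDiff

variable {E : Type*} [NormedAddCommGroup E] [NormedSpace ℝ E] [FiniteDimensional ℝ E]
  [MeasurableSpace E] [BorelSpace E] {μ : Measure E} [μ.IsAddHaarMeasure]
  {ι : Type*} [Fintype ι] {C : ConvexCone ℝ (ι → ι → ℝ)} {Q : (ι → ι → ℝ) → ℝ}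

omit [NormedSpace ℝ E] [FiniteDimensional ℝ E] [μ.IsAddHaarMeasure] in
lemma integrable_mul_of_hasCompactSupport [IsFiniteMeasureOnCompacts μ] {f g : E → ℝ}
    (hf : Continuous f) (hg : Continuous g) (hc : HasCompactSupport f ∨ HasCompactSupport g) :
    Integrable (fun x => f x * g x) μ := by
  refine (hf.mul hg).integrable_of_hasCompactSupport ?_
  rcases hc with hc | hc
  · exact hc.mul_right
  · exact hc.mul_left

omit [FiniteDimensional ℝ E] [MeasurableSpace E] [BorelSpace E] in
lemma hasCompactSupport_dirDeriv {f : E → ℝ} (hf : HasCompactSupport f) (v : E) :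
    HasCompactSupport (dirDeriv v f) := hf.fderiv_apply ℝ v

lemma integral_mul_dirDeriv {f g : E → ℝ} (hf : ContDiff ℝ ∞ f) (hg : ContDiff ℝ ∞ g)
    (hc : HasCompactSupport f ∨ HasCompactSupport g) (v : E) :
    ∫ x, f x * dirDeriv v g x ∂μ = -∫ x, dirDeriv v f x * g x ∂μ := by
  refine integral_mul_fderiv_eq_neg_fderiv_mul_of_integrable ?_ ?_ ?_
    (fun x _ => hf.differentiable (by simp) x) (fun x _ => hg.differentiable (by simp) x)
  · exact integrable_mul_of_hasCompactSupport (contDiff_dirDeriv hf v).continuous hg.continuous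
      (hc.imp_left fun h => hasCompactSupport_dirDeriv h v)
  · exact integrable_mul_of_hasCompactSupport hf.continuous (contDiff_dirDeriv hg v).continuous
      (hc.imp_right fun h => hasCompactSupport_dirDeriv h v)
  · exact integrable_mul_of_hasCompactSupport hf.continuous hg.continuous hc

variable [DecidableEq ι]

/-- After one integration by parts the terms in which the derivative falls on a cofactor cancel, the
cofactors being divergence free. What remains is symmetric in `φ` and `u`, because the cofactor
matrix is. Compact support of either function suffices, so the two can be exchanged. -/
lemma IsNullLagrangian.integral_mul_fderiv_hess (hQ : IsNullLagrangian C Q) (b : ι → E)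
    {φ u w : E → ℝ} (hφ : ContDiff ℝ ∞ φ) (hu : ContDiff ℝ ∞ u) (hw : ContDiff ℝ ∞ w)
    (hc : HasCompactSupport φ ∨ HasCompactSupport u) :
    ∫ x, φ x * fderiv ℝ Q (hess b w x) (hess b u x) ∂μ =
      -∑ p, ∑ q, ∫ x, (dirDeriv (b p) φ x * cofactor b Q w p q x) * dirDeriv (b q) u x ∂μ := by
  have hβ := fun p q => hQ.contDiff_cofactor b hw p q
  have hu1 := fun q => contDiff_dirDeriv hu (b q)
  have hcq : ∀ q, HasCompactSupport φ ∨ HasCompactSupport (dirDeriv (b q) u) := fun q =>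
    hc.imp_right fun h => hasCompactSupport_dirDeriv h _
  have hi1 : ∀ p q, Integrable (fun x => (φ x * cofactor b Q w p q x) *
      dirDeriv (b p) (dirDeriv (b q) u) x) μ := fun p q =>
    integrable_mul_of_hasCompactSupport (hφ.mul (hβ p q)).continuous
      (contDiff_dirDeriv (hu1 q) _).continuous
      ((hcq q).imp (fun h => h.mul_right) fun h => hasCompactSupport_dirDeriv h _)
  have hi2 : ∀ p q, Integrable (fun x => (dirDeriv (b p) φ x * cofactor b Q w p q x) *
      dirDeriv (b q) u x) μ := fun p q =>
    integrable_mul_of_hasCompactSupport ((contDiff_dirDeriv hφ _).mul (hβ p q)).continuous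
      (hu1 q).continuous ((hcq q).imp_left fun h => (hasCompactSupport_dirDeriv h _).mul_right)
  have hi3 : ∀ p q, Integrable (fun x => (φ x * dirDeriv (b p) (cofactor b Q w p q) x) *
      dirDeriv (b q) u x) μ := fun p q =>
    integrable_mul_of_hasCompactSupport (hφ.mul (contDiff_dirDeriv (hβ p q) _)).continuous
      (hu1 q).continuous ((hcq q).imp_left fun h => h.mul_right)
  have h1 : ∀ p q, ∫ x, (φ x * cofactor b Q w p q x) * dirDeriv (b p) (dirDeriv (b q) u) x ∂μ =
      -∫ x, (φ x * dirDeriv (b p) (cofactor b Q w p q) x) * dirDeriv (b q) u x ∂μ -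
      ∫ x, (dirDeriv (b p) φ x * cofactor b Q w p q x) * dirDeriv (b q) u x ∂μ := by
    intro p q
    rw [integral_mul_dirDeriv (hφ.mul (hβ p q)) (hu1 q)
      ((hcq q).imp_left fun h => h.mul_right), ← neg_add', ← integral_add (hi3 p q) (hi2 p q)]
    congr 1
    refine integral_congr_ae (Eventually.of_forall fun x => ?_)
    simp only
    rw [dirDeriv_mul (hφ.differentiable (by simp) x) ((hβ p q).differentiable (by simp) x)]
    ring
  have h2 : ∑ p, ∑ q, ∫ x, (φ x * dirDeriv (b p) (cofactor b Q w p q) x) *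
      dirDeriv (b q) u x ∂μ = 0 := by
    simp only [← integral_finsetSum _ fun q _ => hi3 _ q]
    rw [← integral_finsetSum _ fun p _ => integrable_finsetSum _ fun q _ => hi3 p q]
    refine integral_eq_zero_of_ae (Eventually.of_forall fun x => ?_)
    simp only [Pi.zero_apply]
    rw [Finset.sum_comm]
    refine Finset.sum_eq_zero fun q _ => ?_
    rw [← Finset.sum_mul, ← Finset.mul_sum, hQ.sum_dirDeriv_cofactor b hw q x]
    simp
  have h3 : ∫ x, φ x * fderiv ℝ Q (hess b w x) (hess b u x) ∂μ =
      ∑ p, ∑ q, ∫ x, (φ x * cofactor b Q w p q x) * dirDeriv (b p) (dirDeriv (b q) u) x ∂μ := by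
    simp only [← integral_finsetSum _ fun q _ => hi1 _ q]
    rw [← integral_finsetSum _ fun p _ => integrable_finsetSum _ fun q _ => hi1 p q]
    refine integral_congr_ae (Eventually.of_forall fun x => ?_)
    simp only [fderiv_hess_eq_sum b w hu, Finset.mul_sum]
    refine Finset.sum_congr rfl fun p _ => Finset.sum_congr rfl fun q _ => ?_
    ring
  rw [h3]
  simp only [h1, Finset.sum_sub_distrib, Finset.sum_neg_distrib, h2]
  ring

/-- The linearization of a null Lagrangian at a smooth function is formally self-adjoint. -/
theorem IsNullLagrangian.integral_mul_fderiv_hess_comm (hQ : IsNullLagrangian C Q) (b : ι → E)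
    {φ u w : E → ℝ} (hφ : ContDiff ℝ ∞ φ) (hu : ContDiff ℝ ∞ u) (hw : ContDiff ℝ ∞ w)
    (hc : HasCompactSupport φ) :
    ∫ x, φ x * fderiv ℝ Q (hess b w x) (hess b u x) ∂μ =
      ∫ x, u x * fderiv ℝ Q (hess b w x) (hess b φ x) ∂μ := by
  rw [hQ.integral_mul_fderiv_hess b hφ hu hw (Or.inl hc),
    hQ.integral_mul_fderiv_hess b hu hφ hw (Or.inr hc), Finset.sum_comm]
  congr 1
  refine Finset.sum_congr rfl fun p _ => Finset.sum_congr rfl fun q _ =>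
    integral_congr_ae (Eventually.of_forall fun x => ?_)
  simp only [cofactor, symUnit_comm p q]
  ring

end IntegrationByParts

/-! ### Domination of the linearization by rank-one increments -/

section Bounds

open scoped ContDiff

variable {ι : Type*} [Fintype ι] [DecidableEq ι] {C : ConvexCone ℝ (ι → ι → ℝ)}
  {Q : (ι → ι → ℝ) → ℝ}

/-- The vectors `e p + e q` and `e p - e q`, whose squares span the symmetric forms. -/
def polVec (r : ι × ι × Bool) : ι → ℝ :=
  if r.2.2 then Pi.single r.1 1 + Pi.single r.2.1 1 else Pi.single r.1 1 - Pi.single r.2.1 1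

/-- The increment of `Q` in a rank-one direction. -/
def increment (Q : (ι → ι → ℝ) → ℝ) (ξ : ι → ℝ) (S : ι → ι → ℝ) : ℝ := Q (S + outer ξ) - Q S

omit [DecidableEq ι] in
-- The ray `S + t ξ ⊗ ξ`, `t > 0`, stays in the cone, and an affine function that is nonnegative on
-- a ray cannot have negative slope.
lemma IsNullLagrangian.increment_nonneg (hQ : IsNullLagrangian C Q) (hC : ∀ ξ, outer ξ ∈ C)
    (ξ : ι → ℝ) {S : ι → ι → ℝ} (hS : S ∈ C) : 0 ≤ increment Q ξ S := by
  by_contra! h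
  have h0 := hQ.nonneg S hS
  -- With a negative slope, `Q` would take the value `-1` at this parameter.
  have ht : 0 < (Q S + 1) / (-increment Q ξ S) := div_pos (by linarith) (by linarith)
  have h1 := hQ.nonneg _ (C.add_mem hS (C.smul_mem ht (hC ξ)))
  rw [hQ.affine] at h1
  change 0 ≤ Q S + _ * increment Q ξ S at h1
  have : (Q S + 1) / (-increment Q ξ S) * increment Q ξ S = -(Q S + 1) := by
    rw [div_mul_eq_mul_div, div_neg, mul_div_assoc, div_self h.ne, mul_one]
  linarith

omit [DecidableEq ι] in
-- Closure under increments lets the mass bound be proved by induction; the increments play the role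
-- of the mixed Monge-Ampère operators.
lemma IsNullLagrangian.increment (hQ : IsNullLagrangian C Q) (hC : ∀ ξ, outer ξ ∈ C)
    (ξ : ι → ℝ) : IsNullLagrangian C (increment Q ξ) where
  contDiff := (hQ.contDiff.comp (contDiff_id.add contDiff_const)).sub hQ.contDiff
  affine S η t := by
    have h1 : ∀ X : ι → ι → ℝ, S + X + outer ξ = S + outer ξ + X := fun X => add_right_comm _ _ _
    simp only [QuatPsh.increment, h1]
    rw [hQ.affine (S + outer ξ), hQ.affine S]
    ring
  nonneg S hS := hQ.increment_nonneg hC ξ hS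

omit [Fintype ι] in
lemma outer_polVec_sub (p q : ι) :
    (4 : ℝ) • symUnit p q = outer (polVec (p, q, true)) - outer (polVec (p, q, false)) := by
  ext r s
  simp only [symUnit, symProd, outer, polVec, if_true, Bool.false_eq_true, if_false, Pi.smul_apply,
    Pi.sub_apply, Pi.add_apply, smul_eq_mul]
  ring

/-- Each symmetric unit form is a quarter of a difference of two squares, on which the derivative is
an increment. Both increments are nonnegative on the cone, so their difference is at most their sum
in absolute value. -/
lemma IsNullLagrangian.abs_fderiv_le (hQ : IsNullLagrangian C Q) (hC : ∀ ξ, outer ξ ∈ C)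
    {S X : ι → ι → ℝ} (hS : S ∈ C) (hX : ∀ p q, X p q = X q p) {c : ℝ} (hc : ∀ p q, |X p q| ≤ c) :
    |fderiv ℝ Q S X| ≤ c / 4 * ∑ r, QuatPsh.increment Q (polVec r) S := by
  have h1 : ∀ p q, fderiv ℝ Q S (symUnit p q) = (QuatPsh.increment Q (polVec (p, q, true)) S -
      QuatPsh.increment Q (polVec (p, q, false)) S) / 4 := by
    intro p q
    have := congrArg (fderiv ℝ Q S) (outer_polVec_sub p q)
    rw [map_smul, map_sub, hQ.fderiv_outer, hQ.fderiv_outer, smul_eq_mul] at this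
    simp only [QuatPsh.increment]
    linarith
  rw [eq_sum_symUnit hX]
  simp only [map_sum, map_smul, smul_eq_mul, h1]
  rw [Fintype.sum_prod_type, Finset.mul_sum]
  refine (Finset.abs_sum_le_sum_abs _ _).trans (Finset.sum_le_sum fun p _ => ?_)
  rw [Fintype.sum_prod_type, Finset.mul_sum]
  refine (Finset.abs_sum_le_sum_abs _ _).trans (Finset.sum_le_sum fun q _ => ?_)
  rw [Fintype.sum_bool, abs_mul]
  have i1 := hQ.increment_nonneg hC (polVec (p, q, true)) hS
  have i2 := hQ.increment_nonneg hC (polVec (p, q, false)) hS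
  have h2 : |(QuatPsh.increment Q (polVec (p, q, true)) S -
      QuatPsh.increment Q (polVec (p, q, false)) S) / 4| ≤
      (QuatPsh.increment Q (polVec (p, q, true)) S +
      QuatPsh.increment Q (polVec (p, q, false)) S) / 4 := by
    rw [abs_le]; constructor <;> linarith
  calc _ ≤ c * ((QuatPsh.increment Q (polVec (p, q, true)) S +
      QuatPsh.increment Q (polVec (p, q, false)) S) / 4) :=
        mul_le_mul (hc p q) h2 (abs_nonneg _) ((abs_nonneg _).trans (hc p q))
    _ = _ := by ring

end Bounds

/-! ### Mass bounds and uniform continuity in the sup norm -/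

section Estimates

open scoped ContDiff Manifold

variable {E : Type*} [NormedAddCommGroup E] [NormedSpace ℝ E] [FiniteDimensional ℝ E]

lemma exists_smooth_cutoff {K W : Set E} (hK : IsCompact K) (hW : IsOpen W) (hKW : K ⊆ W) :
    ∃ χ : E → ℝ, ContDiff ℝ ∞ χ ∧ (∀ᶠ x in 𝓝ˢ K, χ x = 1) ∧ (∀ x, χ x ∈ Set.Icc (0 : ℝ) 1) ∧
      HasCompactSupport χ ∧ tsupport χ ⊆ W := by
  obtain ⟨L, hL, hKL, hLW⟩ := exists_compact_between hK hW hKW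
  obtain ⟨f, h1, h2, h3⟩ := exists_contMDiffMap_one_nhds_of_subset_interior (n := ⊤) 𝓘(ℝ, E)
    hK.isClosed hKL
  have hs : tsupport f ⊆ L := closure_minimal
    (fun x hx => by by_contra h; exact hx (h2 x h)) hL.isClosed
  exact ⟨f, f.contMDiff.contDiff, h1, h3, hL.of_isClosed_subset (isClosed_tsupport _) hs,
    hs.trans hLW⟩

variable [MeasurableSpace E] [BorelSpace E] {μ : Measure E} [μ.IsAddHaarMeasure]
  {ι : Type*} [Fintype ι] [DecidableEq ι]
  {C : ConvexCone ℝ (ι → ι → ℝ)} {Q : (ι → ι → ℝ) → ℝ}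

omit [MeasurableSpace E] [BorelSpace E] [FiniteDimensional ℝ E] [Fintype ι] [DecidableEq ι] in
lemma hess_eq_zero_of_notMem_tsupport (b : ι → E) {φ : E → ℝ} {x : E} (hx : x ∉ tsupport φ) :
    hess b φ x = 0 := by
  ext p q
  have h1 : ∀ v, tsupport (dirDeriv v φ) ⊆ tsupport φ := fun v => tsupport_fderiv_apply_subset ℝ v
  have h2 : x ∉ tsupport (dirDeriv (b p) (dirDeriv (b q) φ)) := fun h =>
    hx (h1 _ ((tsupport_fderiv_apply_subset ℝ (b p)) h))
  exact image_eq_zero_of_notMem_tsupport (f := dirDeriv (b p) (dirDeriv (b q) φ)) h2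

omit [MeasurableSpace E] [BorelSpace E] [FiniteDimensional ℝ E] [DecidableEq ι] in
lemma exists_bound_hess (b : ι → E) {φ : E → ℝ} (hφ : ContDiff ℝ ∞ φ) (hc : HasCompactSupport φ) :
    ∃ c : ℝ, 0 ≤ c ∧ ∀ x p q, |hess b φ x p q| ≤ c := by
  have hs : HasCompactSupport (hess b φ) :=
    hc.mono' fun x hx => by
      by_contra h
      exact hx (hess_eq_zero_of_notMem_tsupport b h)
  obtain ⟨c, h⟩ := hs.exists_bound_of_continuous (contDiff_hess b hφ).continuous
  exact ⟨c, (norm_nonneg _).trans (h 0), fun x p q =>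
    ((norm_le_pi_norm _ q).trans (norm_le_pi_norm (hess b φ x) p)).trans (h x)⟩

omit [MeasurableSpace E] [BorelSpace E] [FiniteDimensional ℝ E] [DecidableEq ι] in
lemma IsNullLagrangian.continuous_comp_hess (hQ : IsNullLagrangian C Q) (b : ι → E) {w : E → ℝ}
    (hw : ContDiff ℝ ∞ w) : Continuous fun x => Q (hess b w x) :=
  hQ.contDiff.continuous.comp (contDiff_hess b hw).continuous

omit [DecidableEq ι] [FiniteDimensional ℝ E] in
-- Differentiation under the integral sign. The differentiated integrand is jointly continuous,
-- hence bounded for `t` near `t₀` on the compact support of `φ`.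
lemma IsNullLagrangian.hasDerivAt_integral (hQ : IsNullLagrangian C Q) (b : ι → E)
    {φ h v : E → ℝ} (hφ : ContDiff ℝ ∞ φ) (hh : ContDiff ℝ ∞ h) (hv : ContDiff ℝ ∞ v)
    (hc : HasCompactSupport φ) (t₀ : ℝ) :
    HasDerivAt (fun t : ℝ => ∫ x, φ x * Q (hess b h x + t • hess b v x) ∂μ)
      (∫ x, φ x * fderiv ℝ Q (hess b h x + t₀ • hess b v x) (hess b v x) ∂μ) t₀ := by
  have hH : Continuous fun p : ℝ × E => hess b h p.2 + p.1 • hess b v p.2 :=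
    ((contDiff_hess b hh).continuous.comp continuous_snd).add
      (continuous_fst.smul ((contDiff_hess b hv).continuous.comp continuous_snd))
  have hF : Continuous fun p : ℝ × E => φ p.2 * Q (hess b h p.2 + p.1 • hess b v p.2) :=
    (hφ.continuous.comp continuous_snd).mul (hQ.contDiff.continuous.comp hH)
  have hF' : Continuous fun p : ℝ × E =>
      φ p.2 * fderiv ℝ Q (hess b h p.2 + p.1 • hess b v p.2) (hess b v p.2) :=
    (hφ.continuous.comp continuous_snd).mul
      (((hQ.contDiff.fderiv_right (m := ∞) le_rfl).continuous.comp hH).clm_apply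
        ((contDiff_hess b hv).continuous.comp continuous_snd))
  obtain ⟨B, hB⟩ := ((isCompact_closedBall t₀ 1).prod hc).exists_bound_of_continuousOn
    hF'.continuousOn
  refine (hasDerivAt_integral_of_dominated_loc_of_deriv_le
    (F := fun t x => φ x * Q (hess b h x + t • hess b v x))
    (F' := fun t x => φ x * fderiv ℝ Q (hess b h x + t • hess b v x) (hess b v x))
    (bound := (tsupport φ).indicator fun _ => B)
    (Metric.closedBall_mem_nhds t₀ one_pos) ?_ ?_ ?_ ?_ ?_ ?_).2
  · exact Eventually.of_forall fun t =>
      (hF.comp (Continuous.prodMk_right t)).aestronglyMeasurable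
  · exact (hF.comp (Continuous.prodMk_right t₀)).integrable_of_hasCompactSupport hc.mul_right
  · exact (hF'.comp (Continuous.prodMk_right t₀)).aestronglyMeasurable
  · refine Eventually.of_forall fun x t ht => ?_
    by_cases hx : x ∈ tsupport φ
    · rw [Set.indicator_of_mem hx]
      exact hB (t, x) ⟨ht, hx⟩
    · rw [Set.indicator_of_notMem hx, image_eq_zero_of_notMem_tsupport hx]
      simp
  · exact (integrable_indicator_iff (isClosed_tsupport φ).measurableSet).2
      (integrableOn_const hc.measure_lt_top.ne)
  · refine Eventually.of_forall fun x t _ => ?_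
    have hl : HasDerivAt (fun t : ℝ => hess b h x + t • hess b v x) (hess b v x) t := by
      simpa using ((hasDerivAt_id t).smul_const (hess b v x)).const_add (hess b h x)
    exact (((hQ.contDiff.differentiable (by simp) _).hasFDerivAt).comp_hasDerivAt t hl).const_mul _

/-- The smooth functions on `E` that are bounded by `M` on `W` and whose Hessian lies in the cone
`C` at the points of `W`. -/
structure IsAdmissible (b : ι → E) (C : ConvexCone ℝ (ι → ι → ℝ)) (W : Set E) (M : ℝ)
    (w : E → ℝ) : Prop where
  contDiff : ContDiff ℝ ∞ w
  hess_mem : ∀ x ∈ W, hess b w x ∈ C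
  abs_le : ∀ x ∈ W, |w x| ≤ M

omit [MeasurableSpace E] [BorelSpace E] [FiniteDimensional ℝ E] [Fintype ι] [DecidableEq ι] in
lemma hess_segment (b : ι → E) {g h : E → ℝ} (hg : ContDiff ℝ ∞ g) (hh : ContDiff ℝ ∞ h) (t : ℝ)
    (x : E) : hess b (fun y => h y + t * (g y + (-1) * h y)) x =
      hess b h x + t • hess b (fun y => g y + (-1) * h y) x ∧
    hess b (fun y => g y + (-1) * h y) x = hess b g x - hess b h x := by
  have hv : ContDiff ℝ ∞ fun y => g y + (-1) * h y := hg.add (contDiff_const.mul hh)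
  constructor
  · rw [hess_add b hh (contDiff_const.mul hv), hess_const_mul b hv]
  · rw [hess_add b hg (contDiff_const.mul hh), hess_const_mul b hh, neg_one_smul, sub_eq_add_neg]

omit [MeasurableSpace E] [BorelSpace E] [FiniteDimensional ℝ E] [Fintype ι] [DecidableEq ι] in
lemma IsAdmissible.segment {b : ι → E} {W : Set E} {M : ℝ} {g h : E → ℝ}
    (hg : IsAdmissible b C W M g) (hh : IsAdmissible b C W M h) {t : ℝ}
    (ht : t ∈ Set.Icc (0 : ℝ) 1) :
    IsAdmissible b C W M (fun y => h y + t * (g y + (-1) * h y)) where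
  contDiff := hh.contDiff.add (contDiff_const.mul (hg.contDiff.add (contDiff_const.mul hh.contDiff)))
  hess_mem x hx := by
    rw [(hess_segment b hg.contDiff hh.contDiff t x).1,
      (hess_segment b hg.contDiff hh.contDiff t x).2]
    exact C.convex.add_smul_sub_mem (hh.hess_mem x hx) (hg.hess_mem x hx) ht
  abs_le x hx := by
    have h1 := _root_.abs_le.1 (hg.abs_le x hx)
    have h2 := _root_.abs_le.1 (hh.abs_le x hx)
    rw [_root_.abs_le]
    constructor <;> nlinarith [ht.1, ht.2]

/-- A Lipschitz estimate for a smooth test function. All functions on the segment from `h` to `g`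
are admissible, so mass bounds for the increments control the derivative of the integral along it.
-/
lemma IsNullLagrangian.abs_integral_sub_le (hQ : IsNullLagrangian C Q) (hC : ∀ ξ, outer ξ ∈ C)
    (b : ι → E) {φ : E → ℝ} (hφ : ContDiff ℝ ∞ φ) (hc : HasCompactSupport φ) {W : Set E}
    (hφW : tsupport φ ⊆ W) {M : ℝ} {B : ι × ι × Bool → ℝ}
    (hB : ∀ r w, IsAdmissible b C W M w →
      ∫ x in tsupport φ, QuatPsh.increment Q (polVec r) (hess b w x) ∂μ ≤ B r) :
    ∃ A : ℝ, 0 ≤ A ∧ ∀ g h δ, IsAdmissible b C W M g → IsAdmissible b C W M h →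
      (∀ x ∈ W, |g x - h x| ≤ δ) → 0 ≤ δ →
      |∫ x, φ x * Q (hess b g x) ∂μ - ∫ x, φ x * Q (hess b h x) ∂μ| ≤ A * δ := by
  obtain ⟨c, hc0, hcb⟩ := exists_bound_hess b hφ hc
  refine ⟨|c / 4 * ∑ r, B r|, abs_nonneg _, fun g h δ hg hh hδ hδ0 => ?_⟩
  set v : E → ℝ := fun y => g y + (-1) * h y with hv_def
  have hv : ContDiff ℝ ∞ v := hg.contDiff.add (contDiff_const.mul hh.contDiff)
  have hseg := fun t x => hess_segment b hg.contDiff hh.contDiff t x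
  have hderiv := fun t => hQ.hasDerivAt_integral (μ := μ) b hφ hh.contDiff hv hc t
  have key := norm_image_sub_le_of_norm_deriv_le_segment_01' (C := |c / 4 * ∑ r, B r| * δ)
    (fun t _ => (hderiv t).hasDerivWithinAt) ?_
  · have h1 : ∀ x, hess b h x + (1 : ℝ) • hess b v x = hess b g x := by
      intro x; rw [(hseg 0 x).2]; simp
    have h0 : ∀ x, hess b h x + (0 : ℝ) • hess b v x = hess b h x := by
      intro x; simp
    simpa only [h1, h0, Real.norm_eq_abs] using key
  · intro t ht
    have htI : t ∈ Set.Icc (0 : ℝ) 1 := ⟨ht.1, ht.2.le⟩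
    have hw := hg.segment hh htI
    set w : E → ℝ := fun y => h y + t * (g y + (-1) * h y) with hw_def
    -- Self-adjointness moves both derivatives from `v = g - h` to `φ`, so only the size of `v`
    -- enters.
    have e1 : ∫ x, φ x * fderiv ℝ Q (hess b h x + t • hess b v x) (hess b v x) ∂μ =
        ∫ x in tsupport φ, v x * fderiv ℝ Q (hess b w x) (hess b φ x) ∂μ := by
      rw [setIntegral_eq_integral_of_forall_compl_eq_zero (fun x hx => by
        rw [hess_eq_zero_of_notMem_tsupport b hx, map_zero, mul_zero]),
        ← hQ.integral_mul_fderiv_hess_comm b hφ hv hw.contDiff hc]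
      refine integral_congr_ae (Eventually.of_forall fun x => ?_)
      simp only
      rw [(hseg t x).1]
    rw [e1]
    have hinc : ∀ r, Continuous fun x => QuatPsh.increment Q (polVec r) (hess b w x) := fun r =>
      (hQ.increment hC (polVec r)).continuous_comp_hess b hw.contDiff
    have hint : ∀ r, IntegrableOn (fun x => QuatPsh.increment Q (polVec r) (hess b w x))
        (tsupport φ) μ := fun r => (hinc r).continuousOn.integrableOn_compact hc
    calc ‖∫ x in tsupport φ, v x * fderiv ℝ Q (hess b w x) (hess b φ x) ∂μ‖
        ≤ ∫ x in tsupport φ, δ * (c / 4 * ∑ r, QuatPsh.increment Q (polVec r) (hess b w x)) ∂μ := by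
          refine norm_integral_le_of_norm_le
            (((integrable_finsetSum _ fun r _ => hint r).const_mul _).const_mul _) ?_
          filter_upwards [ae_restrict_mem (isClosed_tsupport φ).measurableSet] with x hx
          rw [norm_mul]
          refine mul_le_mul ?_ ?_ (norm_nonneg _) hδ0
          · have := hδ x (hφW hx)
            rw [Real.norm_eq_abs, hv_def]
            simpa [← sub_eq_add_neg] using this
          · exact hQ.abs_fderiv_le hC (hw.hess_mem x (hφW hx))
              (hess_symm b (contDiff_two hφ).contDiffAt) (hcb x)
      _ = δ * (c / 4 * ∑ r, ∫ x in tsupport φ,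
            QuatPsh.increment Q (polVec r) (hess b w x) ∂μ) := by
          rw [integral_const_mul, integral_const_mul, integral_finsetSum _ fun r _ => hint r]
      _ ≤ δ * (c / 4 * ∑ r, B r) := by
          gcongr with r
          exact hB r w hw
      _ ≤ _ := by
          rw [mul_comm]
          exact mul_le_mul_of_nonneg_right (le_abs_self _) hδ0

/-- The Chern-Levine-Nirenberg estimate for a null Lagrangian. -/
theorem IsNullLagrangian.exists_mass_bound (hC : ∀ ξ, outer ξ ∈ C) (b : ι → E) {W : Set E}
    (hW : IsOpen W) (M : ℝ) (A : Finset (ι × ι × Bool)) :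
    ∀ Q, IsNullLagrangian C Q → (∀ r ∉ A, ∀ S, QuatPsh.increment Q (polVec r) S = 0) →
    ∀ K ⊆ W, IsCompact K → ∃ B : ℝ, ∀ w, IsAdmissible b C W M w →
      ∫ x in K, Q (hess b w x) ∂μ ≤ B := by
  induction A using Finset.strongInduction with
  | _ A ih =>
  intro Q hQ hA K hKW hK
  -- A point of `K` is needed to deduce `0 ≤ M` from admissibility, which makes the zero function
  -- admissible.
  rcases K.eq_empty_or_nonempty with rfl | ⟨x₀, hx₀⟩
  · exact ⟨0, by simp⟩
  obtain ⟨χ, hχ, hχ1, hχI, hχc, hχW⟩ := exists_smooth_cutoff hK hW hKW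
  have hB : ∀ r, ∃ B : ℝ, ∀ w, IsAdmissible b C W M w →
      ∫ x in tsupport χ, QuatPsh.increment Q (polVec r) (hess b w x) ∂μ ≤ B := by
    intro r
    by_cases hr : r ∈ A
    -- The increment in the direction `r` is constant along `r`, as `Q` is affine there, and it
    -- inherits every direction in which `Q` is constant. One direction fewer is left.
    · refine ih (A.erase r) (Finset.erase_ssubset hr) _ (hQ.increment hC _) ?_ _ hχW hχc
      intro s hs S
      rw [Finset.mem_erase, not_and] at hs
      by_cases hsr : s = r
      · subst hsr
        have h1 : S + outer (polVec s) + outer (polVec s) = S + (2 : ℝ) • outer (polVec s) := by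
          rw [two_smul, add_assoc]
        simp only [QuatPsh.increment]
        rw [h1, hQ.affine]
        ring
      · have h1 := hA s (hs hsr)
        have h2 := h1 S
        have h3 := h1 (S + outer (polVec r))
        simp only [QuatPsh.increment] at h2 h3 ⊢
        rw [add_right_comm]
        linarith
    · exact ⟨0, fun w _ => by simp [hA r hr]⟩
  choose B hB using hB
  obtain ⟨c, hc0, hc⟩ := hQ.abs_integral_sub_le hC b hχ hχc hχW hB
  -- Comparison with the zero function, at distance at most `M` from every admissible `w`.
  refine ⟨∫ x, χ x * Q (hess b (fun _ => (0 : ℝ)) x) ∂μ + c * M, fun w hw => ?_⟩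
  have hM : 0 ≤ M := (abs_nonneg _).trans (hw.abs_le x₀ (hKW hx₀))
  have hzero : IsAdmissible b C W M (fun _ => (0 : ℝ)) := by
    refine ⟨contDiff_const, fun x _ => ?_, fun x _ => by simpa using hM⟩
    have h1 : hess b (fun _ : E => (0 : ℝ)) x = outer 0 := by
      rw [hess_eq_zero_of_notMem_tsupport b (by simp)]
      ext; simp [outer]
    rw [h1]
    exact hC 0
  have h1 := hc w _ M hw hzero (fun x hx => by simpa using hw.abs_le x hx) hM
  have hcont := hQ.continuous_comp_hess b hw.contDiff
  have h2 : ∫ x in K, Q (hess b w x) ∂μ = ∫ x in K, χ x * Q (hess b w x) ∂μ := by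
    refine setIntegral_congr_fun hK.measurableSet fun x hx => ?_
    rw [hχ1.self_of_nhdsSet x hx, one_mul]
  have h3 : ∫ x in K, χ x * Q (hess b w x) ∂μ ≤ ∫ x, χ x * Q (hess b w x) ∂μ := by
    refine setIntegral_le_integral
      ((hχ.continuous.mul hcont).integrable_of_hasCompactSupport hχc.mul_right)
      (Eventually.of_forall fun x => ?_)
    change 0 ≤ χ x * Q (hess b w x)
    by_cases hx : x ∈ tsupport χ
    · exact mul_nonneg (hχI x).1 (hQ.nonneg _ (hw.hess_mem x (hχW hx)))
    · rw [image_eq_zero_of_notMem_tsupport hx, zero_mul]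
  have h4 := (abs_le.1 h1).2
  linarith

/-- The integrals of a null Lagrangian against a test function are uniformly continuous with respect
to the uniform norm on bounded families of admissible functions. -/
theorem IsNullLagrangian.exists_delta (hQ : IsNullLagrangian C Q) (hC : ∀ ξ, outer ξ ∈ C)
    (b : ι → E) {φ : E → ℝ} (hφ : Continuous φ) (hc : HasCompactSupport φ) {W : Set E}
    (hW : IsOpen W) (hφW : tsupport φ ⊆ W) (M : ℝ) {ε : ℝ} (hε : 0 < ε) :
    ∃ δ > 0, ∀ g h, IsAdmissible b C W M g → IsAdmissible b C W M h →
      (∀ x ∈ W, |g x - h x| ≤ δ) →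
      |∫ x, φ x * Q (hess b g x) ∂μ - ∫ x, φ x * Q (hess b h x) ∂μ| ≤ ε := by
  obtain ⟨B₀, hB₀⟩ := exists_mass_bound (μ := μ) hC b hW M Finset.univ Q hQ (by simp) _ hφW hc
  -- Replacing `φ` by a smooth function within `η` costs at most `η` times the mass on the support
  -- of `φ`, that is, at most `ε / 3`.
  set η : ℝ := ε / (3 * (|B₀| + 1)) with hη_def
  have hη : 0 < η := by positivity
  have hηB : η * |B₀| ≤ ε / 3 := by
    rw [hη_def, div_mul_eq_mul_div, div_le_div_iff₀ (by positivity) (by positivity)]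
    nlinarith [abs_nonneg B₀]
  obtain ⟨ψ, hψ, hψφ, hψs⟩ := hφ.exists_contDiff_approx ⊤ (ε := fun _ => η) continuous_const
    (fun _ => hη)
  have hψt : tsupport ψ ⊆ tsupport φ := closure_mono hψs
  have hψc : HasCompactSupport ψ := hc.mono hψs
  have hB : ∀ r, ∃ B : ℝ, ∀ w, IsAdmissible b C W M w →
      ∫ x in tsupport ψ, QuatPsh.increment Q (polVec r) (hess b w x) ∂μ ≤ B := fun r =>
    exists_mass_bound hC b hW M Finset.univ _ (hQ.increment hC _) (by simp) _ (hψt.trans hφW) hψc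
  choose B hB using hB
  obtain ⟨c, hc0, hcb⟩ := hQ.abs_integral_sub_le (μ := μ) hC b hψ hψc (hψt.trans hφW) hB
  have happ : ∀ w, IsAdmissible b C W M w →
      |∫ x, φ x * Q (hess b w x) ∂μ - ∫ x, ψ x * Q (hess b w x) ∂μ| ≤ ε / 3 := by
    intro w hw
    have hcont := hQ.continuous_comp_hess b hw.contDiff
    rw [← integral_sub (integrable_mul_of_hasCompactSupport hφ hcont (Or.inl hc))
      (integrable_mul_of_hasCompactSupport hψ.continuous hcont (Or.inl hψc)),
      ← setIntegral_eq_integral_of_forall_compl_eq_zero (s := tsupport φ) (fun x hx => by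
        rw [image_eq_zero_of_notMem_tsupport hx,
          image_eq_zero_of_notMem_tsupport (fun h => hx (hψt h))]; simp)]
    have hint : Integrable (fun x => η * Q (hess b w x)) (μ.restrict (tsupport φ)) :=
      Integrable.const_mul (hcont.continuousOn.integrableOn_compact hc) η
    calc ‖∫ x in tsupport φ, (φ x * Q (hess b w x) - ψ x * Q (hess b w x)) ∂μ‖
        ≤ ∫ x in tsupport φ, η * Q (hess b w x) ∂μ := by
          refine norm_integral_le_of_norm_le hint ?_
          filter_upwards [ae_restrict_mem (isClosed_tsupport φ).measurableSet] with x hx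
          have hQ0 := hQ.nonneg _ (hw.hess_mem x (hφW hx))
          rw [← sub_mul, norm_mul, Real.norm_of_nonneg hQ0]
          refine mul_le_mul_of_nonneg_right ?_ hQ0
          rw [← dist_eq_norm, dist_comm]
          exact (hψφ x).le
      _ = η * ∫ x in tsupport φ, Q (hess b w x) ∂μ := integral_const_mul _ _
      _ ≤ η * |B₀| := by
          gcongr
          exact (hB₀ w hw).trans (le_abs_self _)
      _ ≤ ε / 3 := hηB
  refine ⟨ε / (3 * (c + 1)), by positivity, fun g h hg hh hgh => ?_⟩
  have h1 := abs_le.1 (happ g hg)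
  have h2 := abs_le.1 (happ h hh)
  have h3 := abs_le.1 (hcb g h _ hg hh hgh (by positivity))
  have h4 : c * (ε / (3 * (c + 1))) ≤ ε / 3 := by
    rw [mul_div_assoc', div_le_div_iff₀ (by positivity) (by positivity)]
    nlinarith
  rw [abs_le]
  constructor <;> linarith [h1.1, h1.2, h2.1, h2.2, h3.1, h3.2]

end Estimates

/-! ### Spherical means -/

section Sphere

variable {E : Type*} [NormedAddCommGroup E] [InnerProductSpace ℝ E] [FiniteDimensional ℝ E]
  [MeasurableSpace E] [BorelSpace E]

/-- The action of a linear isometry on the unit sphere. -/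
def sphereHomeomorph (e : E ≃ₗᵢ[ℝ] E) : Metric.sphere (0 : E) 1 ≃ₜ Metric.sphere (0 : E) 1 where
  toFun u := ⟨e u, by simp⟩
  invFun u := ⟨e.symm u, by simp⟩
  left_inv u := by ext; simp
  right_inv u := by ext; simp
  continuous_toFun := by fun_prop
  continuous_invFun := by fun_prop

open scoped Pointwise in
-- The surface measure of a set is defined through the volume of the cone over it, and linear
-- isometries preserve volume and map cones to cones.
lemma measurePreserving_sphereHomeomorph (e : E ≃ₗᵢ[ℝ] E) :
    MeasurePreserving (sphereHomeomorph e) (volume : Measure E).toSphere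
      (volume : Measure E).toSphere := by
  refine ⟨(sphereHomeomorph e).continuous.measurable, ?_⟩
  ext s hs
  have hm := (sphereHomeomorph e).continuous.measurable
  rw [Measure.map_apply hm hs, Measure.toSphere_apply' _ hs, Measure.toSphere_apply' _ (hm hs),
    ← e.measurePreserving.measure_preimage_emb e.toHomeomorph.measurableEmbedding
      (Set.Ioo (0 : ℝ) 1 • (Subtype.val '' s))]
  congr 2
  ext x
  simp only [Set.mem_smul, Set.mem_image, Set.mem_preimage]
  constructor
  · rintro ⟨r, hr, _, ⟨u, hu, rfl⟩, rfl⟩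
    exact ⟨r, hr, _, ⟨_, hu, rfl⟩, by simp [sphereHomeomorph]⟩
  · rintro ⟨r, hr, _, ⟨u, hu, rfl⟩, hx⟩
    refine ⟨r, hr, _, ⟨(sphereHomeomorph e).symm u, by simpa using hu, rfl⟩, ?_⟩
    apply e.injective
    rw [← hx, map_smul]
    simp [sphereHomeomorph]

lemma average_sphere_comp (e : E ≃ₗᵢ[ℝ] E) (h : E → ℝ) :
    ⨍ u : Metric.sphere (0 : E) 1, h (e u) ∂(volume : Measure E).toSphere =
      ⨍ u : Metric.sphere (0 : E) 1, h u ∂(volume : Measure E).toSphere := by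
  rw [average_eq, average_eq]
  congr 1
  exact (measurePreserving_sphereHomeomorph e).integral_comp
    (sphereHomeomorph e).measurableEmbedding (fun u => h u)

lemma average_sphere_neg (h : E → ℝ) :
    ⨍ u : Metric.sphere (0 : E) 1, h (-u) ∂(volume : Measure E).toSphere =
      ⨍ u : Metric.sphere (0 : E) 1, h u ∂(volume : Measure E).toSphere :=
  average_sphere_comp (LinearIsometryEquiv.neg ℝ) h

omit [FiniteDimensional ℝ E] [MeasurableSpace E] [BorelSpace E] in
lemma continuous_sphere_slice {g : E → ℝ} {s : Set E} (hg : ContinuousOn g s) {x : E} {r : ℝ}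
    (h : Metric.sphere x |r| ⊆ s) :
    Continuous fun u : Metric.sphere (0 : E) 1 => g (x + r • (u : E)) := by
  refine hg.comp_continuous (by fun_prop) fun u => h ?_
  simp [norm_smul]

lemma integrable_average_of_continuous {g : Metric.sphere (0 : E) 1 → ℝ} (hg : Continuous g) :
    Integrable g (((volume : Measure E).toSphere Set.univ)⁻¹ • (volume : Measure E).toSphere) :=
  Integrable.to_average
    (hg.integrable_of_hasCompactSupport (HasCompactSupport.of_compactSpace g))

lemma integrable_of_continuous_sphere {g : Metric.sphere (0 : E) 1 → ℝ} (hg : Continuous g) :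
    Integrable g (volume : Measure E).toSphere :=
  hg.integrable_of_hasCompactSupport (HasCompactSupport.of_compactSpace g)

variable [Nontrivial E]

instance neZero_toSphere : NeZero (volume : Measure E).toSphere :=
  ⟨Measure.toSphere_ne_zero _⟩

lemma average_sphere_normSq (x : E) (r : ℝ) :
    ⨍ u : Metric.sphere (0 : E) 1, ‖x + r • (u : E)‖ ^ 2 ∂(volume : Measure E).toSphere =
      ‖x‖ ^ 2 + r ^ 2 := by
  have h0 : ⨍ u : Metric.sphere (0 : E) 1, inner ℝ x (u : E) ∂(volume : Measure E).toSphere = 0 := by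
    have := average_sphere_neg (fun u : E => inner ℝ x u)
    simp only [inner_neg_right] at this
    rw [average_eq, average_eq, integral_neg, smul_neg] at this
    rw [average_eq]
    linarith
  have h1 : ∀ u : Metric.sphere (0 : E) 1, ‖x + r • (u : E)‖ ^ 2 =
      (‖x‖ ^ 2 + r ^ 2) + 2 * r * inner ℝ x (u : E) := by
    intro u
    have hu : ‖(u : E)‖ = 1 := by simp
    rw [norm_add_sq_real, norm_smul, inner_smul_right, hu, Real.norm_eq_abs, mul_one, sq_abs]
    ring
  simp only [h1]
  rw [average, integral_add (integrable_const _)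
    ((integrable_average_of_continuous (by fun_prop)).const_mul _), integral_const_mul]
  change _ + 2 * r * ⨍ u : Metric.sphere (0 : E) 1, inner ℝ x (u : E)
    ∂(volume : Measure E).toSphere = _
  rw [h0, mul_zero, add_zero]
  exact average_const _ _

/-- The maximum principle on a ball for continuous functions with the local submean property. -/
lemma le_of_local_submean {H : E → ℝ} {R c : ℝ} (hR : 0 < R)
    (hH : ContinuousOn H (Metric.closedBall 0 R))
    (hs : ∀ q ∈ Metric.ball (0 : E) R, ∀ᶠ r : ℝ in 𝓝[>] 0,
      H q ≤ ⨍ u : Metric.sphere (0 : E) 1, H (q + r • (u : E)) ∂(volume : Measure E).toSphere)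
    (hc : ∀ z ∈ Metric.sphere (0 : E) R, H z ≤ c) : H 0 ≤ c := by
  refine le_of_forall_pos_le_add fun ε hε => ?_
  -- The penalty `η ‖x‖ ^ 2` vanishes at the centre and equals `ε` on the boundary. Its spherical
  -- means exceed its central value by `η r ^ 2`, so the penalized function has no interior maximum.
  set η := ε / R ^ 2 with hη_def
  have hη : 0 < η := by positivity
  set G : E → ℝ := fun x => H x + η * ‖x‖ ^ 2 with hG_def
  have hG : ContinuousOn G (Metric.closedBall 0 R) :=
    hH.add (by fun_prop)
  obtain ⟨z, hz, hmax⟩ := (isCompact_closedBall (0 : E) R).exists_isMaxOn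
    ⟨0, by simpa using hR.le⟩ hG
  have h0 : G 0 ≤ G z := hmax (by simpa using hR.le)
  have hG0 : G 0 = H 0 := by simp [hG_def]
  rcases (mem_closedBall_zero_iff.1 hz).lt_or_eq with hlt | heq
  · exfalso
    obtain ⟨r, hr, hr0, hrR⟩ := ((hs z (by simpa using hlt)).and
      (Ioo_mem_nhdsGT (sub_pos.2 hlt))).exists
    have hsub : Metric.sphere z |r| ⊆ Metric.closedBall 0 R := by
      intro y hy
      rw [abs_of_pos hr0, mem_sphere_iff_norm] at hy
      rw [mem_closedBall_zero_iff]
      have := norm_add_le (y - z) z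
      rw [sub_add_cancel] at this
      linarith
    have hi := integrable_average_of_continuous (continuous_sphere_slice hH hsub)
    have hiG := integrable_average_of_continuous (continuous_sphere_slice hG hsub)
    have h1 : ⨍ u : Metric.sphere (0 : E) 1, G (z + r • (u : E)) ∂(volume : Measure E).toSphere ≤
        G z := by
      have : ⨍ _u : Metric.sphere (0 : E) 1, G z ∂(volume : Measure E).toSphere = G z :=
        average_const _ _
      conv_rhs => rw [← this]
      refine integral_mono hiG (integrable_const _) fun u => hmax (hsub ?_)
      simp [norm_smul]
    have h2 : ⨍ u : Metric.sphere (0 : E) 1, G (z + r • (u : E)) ∂(volume : Measure E).toSphere =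
        ⨍ u : Metric.sphere (0 : E) 1, H (z + r • (u : E)) ∂(volume : Measure E).toSphere +
          η * (‖z‖ ^ 2 + r ^ 2) := by
      rw [← average_sphere_normSq z r]
      simp only [hG_def, average]
      rw [integral_add hi ((integrable_average_of_continuous (by fun_prop)).const_mul _),
        integral_const_mul]
    have h3 : G z = H z + η * ‖z‖ ^ 2 := rfl
    have : 0 < η * r ^ 2 := mul_pos hη (pow_pos hr0 2)
    linarith
  · have h1 := hc z (by simpa using heq)
    have h2 : G z = H z + ε := by
      simp only [hG_def, heq, hη_def]
      field_simp
    linarith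

end Sphere

/-! ### From small spheres to the boundary sphere, by averaging over rotations -/

/-- Left multiplication by a unit quaternion as a linear isometry. -/
noncomputable def leftMulIsometry (u : ℍ) (hu : ‖u‖ = 1) : ℍ ≃ₗᵢ[ℝ] ℍ :=
  LinearIsometry.toLinearIsometryEquiv
    ⟨LinearMap.mulLeft ℝ u, fun x => by simp [hu]⟩ rfl

/-- Right multiplication by a unit quaternion as a linear isometry. -/
noncomputable def rightMulIsometry (u : ℍ) (hu : ‖u‖ = 1) : ℍ ≃ₗᵢ[ℝ] ℍ :=
  LinearIsometry.toLinearIsometryEquiv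
    ⟨LinearMap.mulRight ℝ u, fun x => by simp [hu]⟩ rfl

lemma leftMulIsometry_apply (u : ℍ) (hu : ‖u‖ = 1) (x : ℍ) : leftMulIsometry u hu x = u * x := rfl

lemma rightMulIsometry_apply (u : ℍ) (hu : ‖u‖ = 1) (x : ℍ) : rightMulIsometry u hu x = x * u := rfl

/-- A continuous function on a ball with the local submean property has the submean property for
the boundary sphere. -/
theorem le_average_sphere_of_local_submean {g : ℍ → ℝ} {x₀ : ℍ} {R : ℝ} (hR : 0 < R)
    (hg : ContinuousOn g (Metric.closedBall x₀ R))
    (hs : ∀ q ∈ Metric.ball x₀ R, ∀ᶠ r : ℝ in 𝓝[>] 0,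
      g q ≤ ⨍ u : Metric.sphere (0 : ℍ) 1, g (q + r • (u : ℍ)) ∂(volume : Measure ℍ).toSphere) :
    g x₀ ≤ ⨍ u : Metric.sphere (0 : ℍ) 1, g (x₀ + R • (u : ℍ)) ∂(volume : Measure ℍ).toSphere := by
  set K := Metric.closedBall (0 : ℍ) R
  have : CompactSpace K := isCompact_iff_compactSpace.1 (isCompact_closedBall 0 R)
  have hmem : ∀ (u : Metric.sphere (0 : ℍ) 1) (q : K), x₀ + u * q ∈ Metric.closedBall x₀ R := by
    intro u q
    have hq : ‖(q : ℍ)‖ ≤ R := mem_closedBall_zero_iff.1 q.2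
    simpa using hq
  let Φ₀ : C(Metric.sphere (0 : ℍ) 1 × K, ℝ) :=
    ⟨fun p => g (x₀ + p.1 * p.2), hg.comp_continuous (by fun_prop) fun p => hmem p.1 p.2⟩
  let Φ : C(Metric.sphere (0 : ℍ) 1, C(K, ℝ)) := Φ₀.curry
  have hΦ : ∀ u q, Φ u q = g (x₀ + u * q) := fun u q => rfl
  -- The functions with the local submean property form a convex set containing all rotates of `g`,
  -- so the average of the rotates lies in its closure. Membership in the closure is all that is
  -- used: admissible radii may shrink in a limit.
  let 𝒞 : Set C(K, ℝ) := {h | ∃ H : ℍ → ℝ, (∀ q : K, H q = h q) ∧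
    ∀ q ∈ Metric.ball (0 : ℍ) R, ∀ᶠ r : ℝ in 𝓝[>] 0,
      H q ≤ ⨍ u : Metric.sphere (0 : ℍ) 1, H (q + r • (u : ℍ)) ∂(volume : Measure ℍ).toSphere}
  have hcont : ∀ (h : C(K, ℝ)) (H : ℍ → ℝ), (∀ q : K, H q = h q) → ContinuousOn H K := by
    intro h H hH
    rw [continuousOn_iff_continuous_domRestrict]
    convert h.continuous using 1
    ext q
    exact hH q
  have hconv : Convex ℝ 𝒞 := by
    rintro h₁ ⟨H₁, e₁, s₁⟩ h₂ ⟨H₂, e₂, s₂⟩ a b ha hb -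
    refine ⟨fun q => a * H₁ q + b * H₂ q, fun q => by simp [e₁, e₂], fun q hq => ?_⟩
    have hq' := mem_ball_zero_iff.1 hq
    filter_upwards [s₁ q hq, s₂ q hq, Ioo_mem_nhdsGT (sub_pos.2 hq')] with r h1 h2 hr
    have hsub : Metric.sphere q |r| ⊆ K := by
      intro y hy
      rw [abs_of_pos hr.1, mem_sphere_iff_norm] at hy
      rw [mem_closedBall_zero_iff]
      have := norm_add_le (y - q) q
      rw [sub_add_cancel] at this
      linarith [hr.2]
    have i1 := integrable_average_of_continuous
      (continuous_sphere_slice (hcont h₁ H₁ e₁) hsub)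
    have i2 := integrable_average_of_continuous
      (continuous_sphere_slice (hcont h₂ H₂ e₂) hsub)
    rw [average, integral_add (i1.const_mul a) (i2.const_mul b), integral_const_mul,
      integral_const_mul]
    exact add_le_add (mul_le_mul_of_nonneg_left h1 ha) (mul_le_mul_of_nonneg_left h2 hb)
  have hΦmem : ∀ u, Φ u ∈ 𝒞 := by
    intro u
    have hu : ‖(u : ℍ)‖ = 1 := by simp
    refine ⟨fun q => g (x₀ + u * q), fun q => rfl, fun q hq => ?_⟩
    have hq' : x₀ + u * q ∈ Metric.ball x₀ R := by simpa using hq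
    filter_upwards [hs _ hq'] with r hr
    refine hr.trans_eq ?_
    rw [← average_sphere_comp (leftMulIsometry u hu) (fun s => g (x₀ + u * q + r • s))]
    refine congrArg (fun F => average _ F) (funext fun s => ?_)
    rw [leftMulIsometry_apply, mul_add, mul_smul_comm, add_assoc]
  have hint : Integrable Φ (volume : Measure ℍ).toSphere :=
    Φ.continuous.integrable_of_hasCompactSupport (HasCompactSupport.of_compactSpace _)
  set G : C(K, ℝ) := ⨍ u, Φ u ∂(volume : Measure ℍ).toSphere with hG_def
  have hGmem : G ∈ closure 𝒞 := hconv.closure.average_mem isClosed_closure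
    (Eventually.of_forall fun u => subset_closure (hΦmem u)) hint
  have hGapp : ∀ q : K, G q = ⨍ u : Metric.sphere (0 : ℍ) 1, g (x₀ + u * q)
      ∂(volume : Measure ℍ).toSphere := by
    intro q
    have hi : Integrable Φ (((volume : Measure ℍ).toSphere Set.univ)⁻¹ •
        (volume : Measure ℍ).toSphere) :=
      Φ.continuous.integrable_of_hasCompactSupport (HasCompactSupport.of_compactSpace _)
    exact (ContinuousLinearMap.integral_comp_comm (ContinuousMap.evalCLM ℝ q) hi).symm
  have h0K : (0 : ℍ) ∈ K := by simpa [K] using hR.le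
  have hG0 : G ⟨0, h0K⟩ = g x₀ := by
    rw [hGapp]
    simp only [mul_zero, add_zero]
    exact average_const _ _
  -- For `‖q‖ = R`, the map `u ↦ u q / R` is a rotation of the unit sphere. Thus the averaged
  -- function is constant on the boundary, equal to the mean of `g`, and the maximum principle
  -- compares it with the centre.
  have hGR : ∀ q : K, ‖(q : ℍ)‖ = R → G q =
      ⨍ u : Metric.sphere (0 : ℍ) 1, g (x₀ + R • (u : ℍ)) ∂(volume : Measure ℍ).toSphere := by
    intro q hq
    have hq1 : ‖R⁻¹ • (q : ℍ)‖ = 1 := by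
      rw [norm_smul, hq, Real.norm_of_nonneg (by positivity), inv_mul_cancel₀ hR.ne']
    rw [hGapp, ← average_sphere_comp (rightMulIsometry _ hq1) (fun u => g (x₀ + R • u))]
    refine congrArg (fun F => average _ F) (funext fun u => ?_)
    rw [rightMulIsometry_apply, mul_smul_comm, smul_smul, mul_inv_cancel₀ hR.ne', one_smul]
  rw [← hG0]
  refine le_of_forall_pos_le_add fun ε hε => ?_
  obtain ⟨h, ⟨H, hH, hHs⟩, hdist⟩ := Metric.mem_closure_iff.1 hGmem (ε / 2) (by positivity)
  have hle : ∀ q : K, |G q - h q| ≤ ε / 2 := fun q =>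
    ((ContinuousMap.dist_apply_le_dist q).trans hdist.le)
  have h1 := le_of_local_submean hR (hcont h H hH) hHs
    (c := ⨍ u : Metric.sphere (0 : ℍ) 1, g (x₀ + R • (u : ℍ)) ∂(volume : Measure ℍ).toSphere + ε / 2)
    (fun z hz => by
      have hzK : z ∈ K := Metric.sphere_subset_closedBall hz
      have h2 := abs_le.1 (hle ⟨z, hzK⟩)
      rw [hGR ⟨z, hzK⟩ (by simpa using hz)] at h2
      have h3 := hH ⟨z, hzK⟩
      simp only at h3
      rw [h3]
      linarith [h2.1])
  have h2 := abs_le.1 (hle ⟨0, h0K⟩)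
  have h3 := hH ⟨0, h0K⟩
  simp only at h3
  rw [h3] at h1
  linarith [h2.2]

/-! ### Continuous plurisubharmonic functions and their limits -/

instance secondCountableTopology_quaternion : SecondCountableTopology ℍ :=
  secondCountable_of_proper

section Psh

variable {n : ℕ} {Ω : Set (Fin n → ℍ)} {f : (Fin n → ℍ) → ℝ}

/-- The parametrization `q ↦ a + v q` of a right quaternionic line. -/
noncomputable def lineMap (a v : Fin n → ℍ) (q : ℍ) : Fin n → ℍ := fun i => a i + v i * q

lemma continuous_lineMap (a v : Fin n → ℍ) : Continuous (lineMap a v) :=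
  continuous_pi fun _ => continuous_const.add (continuous_const.mul continuous_id)

lemma lineMap_sub (a v t : Fin n → ℍ) (q : ℍ) : lineMap a v q - t = lineMap (a - t) v q := by
  ext1 i; simp [lineMap, sub_add_eq_add_sub]

/-- The definition only controls radii below a threshold depending on the function and the point.
Freedom from that threshold is what makes limits and convolutions accessible. -/
lemma IsQuatPshOn.le_average (hf : IsQuatPshOn f Ω) (hc : ContinuousOn f Ω) {a v : Fin n → ℍ}
    (hv : v ≠ 0) {q₀ : ℍ} {R : ℝ} (hR : 0 < R)
    (hΩ : ∀ q ∈ Metric.closedBall q₀ R, lineMap a v q ∈ Ω) :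
    f (lineMap a v q₀) ≤ ⨍ u : Metric.sphere (0 : ℍ) 1, f (lineMap a v (q₀ + R • (u : ℍ)))
      ∂(volume : Measure ℍ).toSphere := by
  refine le_average_sphere_of_local_submean (g := fun q => f (lineMap a v q)) hR
    (hc.comp (continuous_lineMap a v).continuousOn hΩ) fun q hq => ?_
  filter_upwards [((hf.2 a v hv).2 q (hΩ q (Metric.ball_subset_closedBall hq)))] with r hr
  exact hr.2

lemma eventually_closedBall_subset (hΩ : IsOpen Ω) {a v : Fin n → ℍ} {q₀ : ℍ}
    (h : lineMap a v q₀ ∈ Ω) :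
    ∀ᶠ r : ℝ in 𝓝[>] 0, ∀ q ∈ Metric.closedBall q₀ r, lineMap a v q ∈ Ω := by
  have ho : IsOpen (lineMap a v ⁻¹' Ω) := hΩ.preimage (continuous_lineMap a v)
  obtain ⟨ε, hε, hs⟩ := Metric.isOpen_iff.1 ho q₀ h
  filter_upwards [Ioo_mem_nhdsGT hε] with r hr q hq
  exact hs (Metric.closedBall_subset_ball hr.2 hq)

lemma continuous_sphere_lineMap (hc : ContinuousOn f Ω) {a v : Fin n → ℍ} {q₀ : ℍ} {r : ℝ}
    (hr : 0 < r) (h : ∀ q ∈ Metric.closedBall q₀ r, lineMap a v q ∈ Ω) :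
    Continuous fun u : Metric.sphere (0 : ℍ) 1 => f (lineMap a v (q₀ + r • (u : ℍ))) := by
  refine continuous_sphere_slice (g := fun q => f (lineMap a v q))
    (hc.comp (continuous_lineMap a v).continuousOn h) ?_
  rw [abs_of_pos hr]
  exact Metric.sphere_subset_closedBall

lemma isQuatPshOn_of_submean (hΩ : IsOpen Ω) (hc : ContinuousOn f Ω)
    (h : ∀ a v : Fin n → ℍ, v ≠ 0 → ∀ q, lineMap a v q ∈ Ω → ∀ᶠ r : ℝ in 𝓝[>] 0,
      f (lineMap a v q) ≤ ⨍ u : Metric.sphere (0 : ℍ) 1, f (lineMap a v (q + r • (u : ℍ)))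
        ∂(volume : Measure ℍ).toSphere) : IsQuatPshOn f Ω := by
  refine ⟨hc.upperSemicontinuousOn, fun a v hv => ⟨?_, fun q hq => ?_⟩⟩
  · exact (hc.comp (continuous_lineMap a v).continuousOn fun q hq => hq).upperSemicontinuousOn
  · filter_upwards [h a v hv q hq, eventually_closedBall_subset hΩ hq, self_mem_nhdsWithin]
      with r h1 h2 h3
    exact ⟨integrable_of_continuous_sphere (continuous_sphere_lineMap hc h3 h2), h1⟩

lemma IsQuatPshOn.mono (hf : IsQuatPshOn f Ω) {U : Set (Fin n → ℍ)} (hU : U ⊆ Ω) :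
    IsQuatPshOn f U :=
  ⟨hf.1.mono hU, fun a v hv => ⟨(hf.2 a v hv).1.mono fun _ hq => hU hq,
    fun q hq => (hf.2 a v hv).2 q (hU hq)⟩⟩

/-- For a fixed small sphere, with its ball in `Ω`, the submean inequality holds for every `F N` and
passes to the uniform limit on the compact image of the ball. -/
lemma isQuatPshOn_of_tendsto (hΩ : IsOpen Ω) {F : ℕ → (Fin n → ℍ) → ℝ}
    (hcont : ∀ N, ContinuousOn (F N) Ω) (hpsh : ∀ N, IsQuatPshOn (F N) Ω)
    (hlim : ∀ K ⊆ Ω, IsCompact K → TendstoUniformlyOn F f atTop K) :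
    ContinuousOn f Ω ∧ IsQuatPshOn f Ω := by
  have hc : ContinuousOn f Ω := ((tendstoLocallyUniformlyOn_iff_forall_isCompact hΩ).2
    hlim).continuousOn (Eventually.of_forall hcont).frequently
  refine ⟨hc, isQuatPshOn_of_submean hΩ hc fun a v hv q hq => ?_⟩
  filter_upwards [eventually_closedBall_subset hΩ hq, self_mem_nhdsWithin] with r hr hr0
  refine le_of_forall_pos_le_add fun ε hε => ?_
  have hK : IsCompact (lineMap a v '' Metric.closedBall q r) :=
    (isCompact_closedBall q r).image (continuous_lineMap a v)
  have hKΩ : lineMap a v '' Metric.closedBall q r ⊆ Ω := by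
    rintro _ ⟨p, hp, rfl⟩; exact hr p hp
  obtain ⟨N, hN⟩ := (Metric.tendstoUniformlyOn_iff.1 (hlim _ hKΩ hK) (ε / 2) (by positivity)).exists
  have h1 := (hpsh N).le_average (hcont N) hv hr0 hr
  have h2 := abs_lt.1 (hN _ ⟨q, Metric.mem_closedBall_self (le_of_lt hr0), rfl⟩)
  have h3 : ⨍ u : Metric.sphere (0 : ℍ) 1, F N (lineMap a v (q + r • (u : ℍ)))
      ∂(volume : Measure ℍ).toSphere ≤
      ⨍ u : Metric.sphere (0 : ℍ) 1, f (lineMap a v (q + r • (u : ℍ)))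
        ∂(volume : Measure ℍ).toSphere + ε / 2 := by
    have e : ⨍ _u : Metric.sphere (0 : ℍ) 1, ε / 2 ∂(volume : Measure ℍ).toSphere = ε / 2 :=
      average_const _ _
    have i := integrable_average_of_continuous (continuous_sphere_lineMap hc hr0 hr)
    conv_rhs => rw [← e]
    rw [average, average, average, ← integral_add i (integrable_const _)]
    refine integral_mono (integrable_average_of_continuous
      (continuous_sphere_lineMap (hcont N) hr0 hr)) (i.add (integrable_const _)) fun u => ?_
    have := abs_lt.1 (hN (lineMap a v (q + r • (u : ℍ))) ⟨_, by
      simp [norm_smul, abs_of_pos (show 0 < r from hr0)], rfl⟩)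
    simp only
    linarith [this.1]
  linarith [h2.2]

end Psh

/-! ### Mollification -/

section Mollify

open scoped ContDiff Convolution

variable {E : Type*} [NormedAddCommGroup E] [NormedSpace ℝ E] [FiniteDimensional ℝ E]
  [MeasurableSpace E] [BorelSpace E] (μ : Measure E) [μ.IsAddHaarMeasure]

/-- The convolution with a smooth bump function. -/
noncomputable def mollify (ρ : ContDiffBump (0 : E)) (G : E → ℝ) : E → ℝ :=
  ρ.normed μ ⋆[ContinuousLinearMap.lsmul ℝ ℝ, μ] G

variable {μ} (ρ : ContDiffBump (0 : E)) {G : E → ℝ}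

omit [BorelSpace E] [μ.IsAddHaarMeasure] in
lemma mollify_apply (x : E) : mollify μ ρ G x = ∫ t, ρ.normed μ t * G (x - t) ∂μ := rfl

lemma contDiff_mollify (hG : Continuous G) : ContDiff ℝ ∞ (mollify μ ρ G) :=
  ρ.hasCompactSupport_normed.contDiff_convolution_left _ ρ.contDiff_normed hG.locallyIntegrable

lemma abs_mollify_sub_le (hG : Continuous G) {η : ℝ} {x : E}
    (h : ∀ y ∈ Metric.ball x ρ.rOut, dist (G y) (G x) ≤ η) : |mollify μ ρ G x - G x| ≤ η :=
  ρ.dist_normed_convolution_le hG.aestronglyMeasurable h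

lemma dirDeriv_mollify (hG : ContDiff ℝ 1 G) (hc : HasCompactSupport G) (v : E) :
    dirDeriv v (mollify μ ρ G) = mollify μ ρ (dirDeriv v G) := by
  ext x
  have h := hc.hasFDerivAt_convolution_right (ContinuousLinearMap.lsmul ℝ ℝ)
    (μ := μ) (f := ρ.normed μ) ρ.continuous_normed.locallyIntegrable hG x
  have hd : Continuous (fderiv ℝ G) := hG.continuous_fderiv one_ne_zero
  rw [dirDeriv, mollify, h.fderiv, mollify, convolution, convolution,
    ContinuousLinearMap.integral_apply]
  · rfl
  · have : Continuous fun t => ρ.normed μ t • fderiv ℝ G (x - t) :=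
      ρ.continuous_normed.smul (hd.comp (continuous_const.sub continuous_id))
    exact this.integrable_of_hasCompactSupport ρ.hasCompactSupport_normed.smul_right

lemma hess_mollify {ι : Type*} (b : ι → E) (hG : ContDiff ℝ 2 G) (hc : HasCompactSupport G)
    (p q : ι) : (fun x => hess b (mollify μ ρ G) x p q) = mollify μ ρ fun x => hess b G x p q := by
  have h1 : ContDiff ℝ 1 (dirDeriv (b q) G) :=
    (hG.fderiv_right (m := 1) le_rfl).clm_apply contDiff_const
  unfold hess
  rw [dirDeriv_mollify ρ (hG.of_le one_le_two) hc]
  exact dirDeriv_mollify ρ h1 (hasCompactSupport_dirDeriv hc _) _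

end Mollify

/-! ### Smooth plurisubharmonic approximation -/

section Approximation

open scoped ContDiff

variable {n : ℕ} {Ω : Set (Fin n → ℍ)} {f : (Fin n → ℍ) → ℝ}

lemma norm_lineMap_sub_le (a v : Fin n → ℍ) (p q : ℍ) :
    ‖lineMap a v p - lineMap a v q‖ ≤ ‖v‖ * ‖p - q‖ := by
  refine (pi_norm_le_iff_of_nonneg (by positivity)).2 fun i => ?_
  have : (lineMap a v p - lineMap a v q) i = v i * (p - q) := by simp [lineMap, mul_sub]
  rw [this, norm_mul]
  exact mul_le_mul_of_nonneg_right (norm_le_pi_norm v i) (norm_nonneg _)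

/-- The mollification is a weighted mean of translates of `f`. Each satisfies the submean inequality
on the same sphere, and Fubini exchanges the two averages. -/
lemma isQuatPshOn_mollify (hf : IsQuatPshOn f Ω) (hc : ContinuousOn f Ω)
    {G : (Fin n → ℍ) → ℝ} (hG : Continuous G) (ρ : ContDiffBump (0 : Fin n → ℍ))
    {W : Set (Fin n → ℍ)} (hW : IsOpen W)
    (hWG : ∀ x ∈ W, ∀ y ∈ Metric.closedBall x (2 * ρ.rOut), y ∈ Ω ∧ G y = f y) :
    IsQuatPshOn (mollify volume ρ G) W := by
  have hρ := ρ.rOut_pos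
  refine isQuatPshOn_of_submean hW (contDiff_mollify ρ hG).continuous.continuousOn
    fun a v hv q hq => ?_
  have hv' : 0 < ‖v‖ := norm_pos_iff.2 hv
  -- For such `r` the ball in the line has radius at most `ρ.rOut` in `ℍⁿ`; a translation by at most
  -- `ρ.rOut` keeps it within `2 * ρ.rOut`.
  filter_upwards [Ioo_mem_nhdsGT (div_pos hρ hv')] with r hr
  have hball : ∀ t ∈ Metric.closedBall (0 : Fin n → ℍ) ρ.rOut, ∀ p ∈ Metric.closedBall q r,
      lineMap (a - t) v p ∈ Metric.closedBall (lineMap a v q) (2 * ρ.rOut) := by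
    intro t ht p hp
    rw [mem_closedBall_iff_norm] at hp ⊢
    rw [mem_closedBall_zero_iff] at ht
    have h1 : lineMap (a - t) v p - lineMap a v q = (lineMap a v p - lineMap a v q) - t := by
      rw [← lineMap_sub]; abel
    have h2 : ‖v‖ * ‖p - q‖ ≤ ρ.rOut := by
      calc ‖v‖ * ‖p - q‖ ≤ ‖v‖ * (ρ.rOut / ‖v‖) := by gcongr; exact hp.trans hr.2.le
        _ = ρ.rOut := mul_div_cancel₀ _ hv'.ne'
    rw [h1]
    linarith [norm_sub_le (lineMap a v p - lineMap a v q) t, norm_lineMap_sub_le a v p q]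
  have hnρ : Continuous (ρ.normed volume) := ρ.continuous_normed
  set σ := ((volume : Measure ℍ).toSphere Set.univ)⁻¹ • (volume : Measure ℍ).toSphere
  let Φ : Metric.sphere (0 : ℍ) 1 → (Fin n → ℍ) → ℝ := fun u t =>
    ρ.normed volume t * G (lineMap a v (q + r • (u : ℍ)) - t)
  have hΦ : Continuous Φ.uncurry :=
    (hnρ.comp continuous_snd).mul (hG.comp
      (((continuous_lineMap a v).comp (by fun_prop)).sub continuous_snd))
  have hΦs : HasCompactSupport Φ.uncurry := by
    refine HasCompactSupport.intro (isCompact_univ.prod (ρ.hasCompactSupport_normed (μ := volume)))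
      fun p hp => ?_
    have : p.2 ∉ tsupport (ρ.normed volume) := fun h => hp ⟨Set.mem_univ _, h⟩
    simp [Function.uncurry, Φ, image_eq_zero_of_notMem_tsupport this]
  have hswap : ∫ u, ∫ t, Φ u t ∂volume ∂σ = ∫ t, ∫ u, Φ u t ∂σ ∂volume :=
    integral_integral_swap_of_hasCompactSupport hΦ hΦs
  have hlhs : ⨍ u : Metric.sphere (0 : ℍ) 1, mollify volume ρ G (lineMap a v (q + r • (u : ℍ)))
      ∂(volume : Measure ℍ).toSphere = ∫ u, ∫ t, Φ u t ∂volume ∂σ := rfl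
  rw [hlhs, hswap, mollify_apply]
  refine integral_mono ?_ ?_ fun t => ?_
  · exact (hnρ.mul (hG.comp (continuous_const.sub continuous_id))).integrable_of_hasCompactSupport
      ρ.hasCompactSupport_normed.mul_right
  · refine Continuous.integrable_of_hasCompactSupport ?_ ?_
    · have h : Continuous fun t => ∫ u in Set.univ, Φ u t ∂σ :=
        continuous_parametric_integral_of_continuous (f := fun t u => Φ u t)
          (hΦ.comp continuous_swap) isCompact_univ
      simpa using h
    · refine HasCompactSupport.intro (ρ.hasCompactSupport_normed (μ := volume)) fun t ht => ?_
      simp [Φ, image_eq_zero_of_notMem_tsupport ht]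
  · change ρ.normed volume t * G (lineMap a v q - t) ≤
      ∫ u, ρ.normed volume t * G (lineMap a v (q + r • (u : ℍ)) - t) ∂σ
    rw [integral_const_mul]
    by_cases ht : t ∈ tsupport (ρ.normed volume)
    · refine mul_le_mul_of_nonneg_left ?_ (ρ.nonneg_normed t)
      rw [ρ.tsupport_normed_eq] at ht
      simp only [lineMap_sub]
      have hmem := hball t ht
      have h1 := hf.le_average hc hv (a := a - t) (q₀ := q) hr.1
        fun p hp => (hWG _ hq _ (hmem p hp)).1
      rw [(hWG _ hq _ (hmem q (Metric.mem_closedBall_self hr.1.le))).2]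
      refine h1.trans_eq ?_
      refine integral_congr_ae (Eventually.of_forall fun u => ?_)
      exact ((hWG _ hq _ (hmem _ (by simp [norm_smul, abs_of_pos hr.1]))).2).symm
    · rw [image_eq_zero_of_notMem_tsupport ht]
      simp

lemma hess_congr {E ι : Type*} [NormedAddCommGroup E] [NormedSpace ℝ E] (b : ι → E) {u w : E → ℝ}
    {x : E} (h : u =ᶠ[𝓝 x] w) : hess b u x = hess b w x := by
  ext p q
  have : dirDeriv (b q) u =ᶠ[𝓝 x] dirDeriv (b q) w := by
    filter_upwards [h.eventuallyEq_nhds] with y hy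
    rw [dirDeriv, dirDeriv, hy.fderiv_eq]
  rw [hess, hess, dirDeriv, dirDeriv, this.fderiv_eq]

/-- Continuous plurisubharmonic functions are locally uniform limits of smooth ones; for functions
of class `C²` the second derivatives converge as well. -/
theorem exists_smooth_psh_approx {ι : Type*} [Fintype ι] (b : ι → Fin n → ℍ) (hΩ : IsOpen Ω)
    (hf : IsQuatPshOn f Ω) (hc : ContinuousOn f Ω) {W : Set (Fin n → ℍ)} (hW : IsOpen W)
    (hWc : IsCompact (closure W)) (hWΩ : closure W ⊆ Ω) {η : ℝ} (hη : 0 < η) :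
    ∃ g : (Fin n → ℍ) → ℝ, ContDiff ℝ ∞ g ∧ IsQuatPshOn g W ∧ (∀ x ∈ W, |g x - f x| ≤ η) ∧
      (ContDiffOn ℝ 2 f Ω → ∀ x ∈ W, ∀ p q, |hess b g x p q - hess b f x p q| ≤ η) := by
  obtain ⟨χ, hχ, hχ1, hχI, hχc, hχΩ⟩ := exists_smooth_cutoff hWc hΩ hWΩ
  set G : (Fin n → ℍ) → ℝ := fun x => χ x * f x with hG_def
  have hGs : tsupport G ⊆ tsupport χ := closure_mono (Function.support_mul_subset_left _ _)
  have hGc : HasCompactSupport G := hχc.mul_right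
  have hG : Continuous G := (hχ.continuous.continuousOn.mul hc).continuous_of_tsupport_subset hΩ
    (hGs.trans hχΩ)
  obtain ⟨V, hVo, hWV, hV1⟩ := eventually_nhdsSet_iff_exists.1 hχ1
  obtain ⟨δ₀, hδ₀, hδV⟩ := hWc.exists_cthickening_subset_open (hVo.inter hΩ)
    (Set.subset_inter hWV hWΩ)
  have hGf : ∀ y ∈ V, G y = f y := fun y hy => by simp [hG_def, hV1 y hy]
  obtain ⟨δ₁, hδ₁, hδ₁G⟩ := Metric.uniformContinuous_iff.1
    (hGc.uniformContinuous_of_continuous hG) η hη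
  have hG2 : ContDiffOn ℝ 2 f Ω → ContDiff ℝ 2 G := by
    intro h2
    refine contDiff_iff_contDiffAt.2 fun y => ?_
    by_cases hy : y ∈ tsupport G
    · exact (contDiff_two hχ).contDiffAt.mul (h2.contDiffAt (hΩ.mem_nhds (hχΩ (hGs hy))))
    · exact contDiffAt_const.congr_of_eventuallyEq (notMem_tsupport_iff_eventuallyEq.1 hy)
  have hδ₂ : ∃ δ₂ > 0, ContDiffOn ℝ 2 f Ω → ∀ ⦃y x : Fin n → ℍ⦄, dist y x < δ₂ →
      dist (hess b G y) (hess b G x) < η := by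
    by_cases h2 : ContDiffOn ℝ 2 f Ω
    · have hG2 := hG2 h2
      have hH : Continuous (hess b G) := continuous_pi fun p => continuous_pi fun q =>
        ((((hG2.fderiv_right (m := 1) le_rfl).clm_apply contDiff_const).fderiv_right
          (m := 0) le_rfl).clm_apply contDiff_const).continuous
      have hHc : HasCompactSupport (hess b G) := hGc.mono' fun x hx => by
        by_contra h
        exact hx (hess_eq_zero_of_notMem_tsupport b h)
      obtain ⟨δ, hδ, h⟩ := Metric.uniformContinuous_iff.1
        (hHc.uniformContinuous_of_continuous hH) η hη
      exact ⟨δ, hδ, fun _ => h⟩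
    · exact ⟨1, one_pos, fun h => absurd h h2⟩
  obtain ⟨δ₂, hδ₂, hδ₂G⟩ := hδ₂
  -- Half of `δ₀` accounts for the doubled radius in `isQuatPshOn_mollify`; `δ₁` controls the values
  -- and `δ₂` the second derivatives.
  set ε := min (δ₀ / 2) (min δ₁ δ₂) with hε_def
  have hε : 0 < ε := by positivity
  let ρ : ContDiffBump (0 : Fin n → ℍ) := ⟨ε / 2, ε, half_pos hε, half_lt_self hε⟩
  refine ⟨mollify volume ρ G, contDiff_mollify ρ hG, ?_, fun x hx => ?_, fun h2 x hx p q => ?_⟩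
  · refine isQuatPshOn_mollify hf hc hG ρ hW fun x hx y hy => ?_
    have hy2 : y ∈ Metric.cthickening δ₀ (closure W) := by
      refine Metric.mem_cthickening_of_dist_le y x δ₀ _ (subset_closure hx)
        ((Metric.mem_closedBall.1 hy).trans ?_)
      have : ρ.rOut ≤ δ₀ / 2 := min_le_left _ _
      linarith
    exact ⟨(hδV hy2).2, hGf y (hδV hy2).1⟩
  · rw [← hGf x (hWV (subset_closure hx))]
    exact abs_mollify_sub_le ρ hG fun y hy => (hδ₁G ((Metric.mem_ball.1 hy).trans_le
      ((min_le_right _ _).trans (min_le_left _ _)))).le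
  · have hxV : x ∈ V := hWV (subset_closure hx)
    have e : hess b f x = hess b G x := by
      refine hess_congr b ?_
      filter_upwards [hVo.mem_nhds hxV] with y hy
      exact (hGf y hy).symm
    have hG2 := hG2 h2
    have hcont : Continuous fun x => hess b G x p q :=
      ((((hG2.fderiv_right (m := 1) le_rfl).clm_apply contDiff_const).fderiv_right
          (m := 0) le_rfl).clm_apply contDiff_const).continuous
    rw [e, congrFun (hess_mollify (μ := volume) ρ b hG2 hGc p q) x]
    refine abs_mollify_sub_le ρ hcont fun y hy => ?_
    exact ((dist_le_pi_dist _ _ q).trans (dist_le_pi_dist (hess b G y) (hess b G x) p)).trans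
      (hδ₂G h2 ((Metric.mem_ball.1 hy).trans_le
      ((min_le_right _ _).trans (min_le_right _ _)))).le

end Approximation

/-! ### The quaternionic Hessian of a plurisubharmonic function -/

section PshHessian

open scoped ContDiff

variable {n : ℕ}

lemma isNullLagrangian_mooreForm (n : ℕ) : IsNullLagrangian (pshCone n) (mooreForm n) where
  contDiff := (contDiff_mooreForm n).of_le le_top
  affine := mooreForm_affine
  nonneg _ hS := mooreForm_nonneg hS

/-- The real coordinate vectors of `ℍⁿ`. -/
noncomputable def coordVec (n : ℕ) (p : Fin n × Fin 4) : Fin n → ℍ := Pi.single p.1 (quatUnit p.2)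

lemma dirDeriv_dirDeriv_eq {E : Type*} [NormedAddCommGroup E] [NormedSpace ℝ E] {u : E → ℝ} {x : E}
    (hu : ContDiffAt ℝ 2 u x) (v w : E) :
    dirDeriv v (dirDeriv w u) x = fderiv ℝ (fderiv ℝ u) x v w := by
  have hd : DifferentiableAt ℝ (fderiv ℝ u) x :=
    (hu.fderiv_right (m := 1) le_rfl).differentiableAt one_ne_zero
  change fderiv ℝ (fun y => fderiv ℝ u y w) x v = _
  rw [fderiv_clm_apply hd (differentiableAt_const w)]
  simp

/-- The inclusion of the reals in the quaternions. -/
noncomputable def realToQuat : ℝ →L[ℝ] ℍ := (Algebra.linearMap ℝ ℍ).toContinuousLinearMap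

lemma realToQuat_apply (r : ℝ) : realToQuat r = (r : ℍ) := rfl

lemma dq_coe {u : (Fin n → ℍ) → ℝ} {y : Fin n → ℍ} (hu : DifferentiableAt ℝ u y) (j : Fin n) :
    dq j (fun y => (u y : ℍ)) y =
      ∑ c, dirDeriv (coordVec n (j, c)) u y • star (quatUnit c) := by
  have h : fderiv ℝ (fun y => (u y : ℍ)) y = realToQuat.comp (fderiv ℝ u y) :=
    (realToQuat.hasFDerivAt.comp y hu.hasFDerivAt).fderiv
  unfold dq
  refine Finset.sum_congr rfl fun c _ => ?_
  rw [h, ContinuousLinearMap.comp_apply, realToQuat_apply, Quaternion.coe_mul_eq_smul]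
  rfl

lemma quatHessian_eq {u : (Fin n → ℍ) → ℝ} {x : Fin n → ℍ} (hu : ContDiffAt ℝ 2 u x) :
    quatHessian u x = Matrix.of (ofForm n (hess (coordVec n) u x)) := by
  ext1 i j
  have hev : dq j (fun y => (u y : ℍ)) =ᶠ[𝓝 x]
      fun y => ∑ c, dirDeriv (coordVec n (j, c)) u y • star (quatUnit c) := by
    filter_upwards [hu.eventually (by simp)] with y hy
    exact dq_coe (hy.differentiableAt two_ne_zero) j
  have hd : ∀ c, DifferentiableAt ℝ (dirDeriv (coordVec n (j, c)) u) x := fun c =>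
    ((hu.fderiv_right (m := 1) le_rfl).differentiableAt one_ne_zero).clm_apply
      (differentiableAt_const _)
  have hfd : ∀ v, fderiv ℝ (dq j (fun y => (u y : ℍ))) x v =
      ∑ c, dirDeriv v (dirDeriv (coordVec n (j, c)) u) x • star (quatUnit c) := by
    intro v
    rw [hev.fderiv_eq, fderiv_fun_sum fun c _ => (hd c).smul_const _, _root_.sum_apply]
    refine Finset.sum_congr rfl fun c _ => ?_
    rw [fderiv_smul_const (hd c)]
    rfl
  simp only [quatHessian, of_apply, dqbar, hfd, Finset.mul_sum, mul_smul_comm, ofForm,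
    LinearMap.coe_mk, AddHom.coe_mk]
  refine Finset.sum_congr rfl fun a _ => Finset.sum_congr rfl fun c _ => ?_
  rw [hess_symm (coordVec n) hu (j, c) (i, a), add_self_div_two]
  rfl

lemma mooreDet_quatHessian {u : (Fin n → ℍ) → ℝ} {x : Fin n → ℍ} (hu : ContDiffAt ℝ 2 u x) :
    mooreDet (quatHessian u x) = mooreForm n (hess (coordVec n) u x) := by
  rw [quatHessian_eq hu]; rfl

/-- The Taylor remainder along `t ↦ x + t h` has derivative at most `ε ‖h‖ ^ 2` on `[0, 1]`, by
differentiability of the first derivative at `x`. -/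
lemma abs_taylor_two_le {E : Type*} [NormedAddCommGroup E] [NormedSpace ℝ E] {u : E → ℝ}
    (hu : ContDiff ℝ 2 u) (x : E) {ε : ℝ} (hε : 0 < ε) :
    ∃ δ > 0, ∀ h, ‖h‖ < δ →
      |u (x + h) - u x - fderiv ℝ u x h - fderiv ℝ (fderiv ℝ u) x h h / 2| ≤ ε * ‖h‖ ^ 2 := by
  have hd : DifferentiableAt ℝ (fderiv ℝ u) x :=
    (hu.fderiv_right (m := 1) le_rfl).differentiable one_ne_zero x
  have hu1 := hu.differentiable two_ne_zero
  obtain ⟨δ, hδ, hb⟩ := Metric.eventually_nhds_iff_ball.1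
    ((hasFDerivAt_iff_isLittleO_nhds_zero.1 hd.hasFDerivAt).def hε)
  refine ⟨δ, hδ, fun h hh => ?_⟩
  set A := fderiv ℝ (fderiv ℝ u) x
  have hder : ∀ t : ℝ, HasDerivAt (fun t : ℝ => u (x + t • h) - t * fderiv ℝ u x h -
      t ^ 2 / 2 * A h h) (fderiv ℝ u (x + t • h) h - fderiv ℝ u x h - t * A h h) t := by
    intro t
    have hl : HasDerivAt (fun t : ℝ => x + t • h) h t := by
      simpa using ((hasDerivAt_id t).smul_const h).const_add x
    have h1 := (hu1 (x + t • h)).hasFDerivAt.comp_hasDerivAt t hl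
    have h2 := (hasDerivAt_id t).mul_const (fderiv ℝ u x h)
    have h3 := (((hasDerivAt_id t).pow 2).div_const 2).mul_const (A h h)
    refine ((h1.sub h2).sub h3).congr_deriv ?_
    simp
  have key := norm_image_sub_le_of_norm_deriv_le_segment_01' (C := ε * ‖h‖ ^ 2)
    (fun t _ => (hder t).hasDerivWithinAt) ?_
  · rw [Real.norm_eq_abs] at key
    convert key using 2
    simp
    ring
  · intro t ht
    have hth : ‖t • h‖ ≤ ‖h‖ := by
      rw [norm_smul, Real.norm_of_nonneg ht.1]
      exact mul_le_of_le_one_left (norm_nonneg _) ht.2.le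
    have h1 := hb (t • h) (by simpa using hth.trans_lt hh)
    have h2 : fderiv ℝ u (x + t • h) h - fderiv ℝ u x h - t * A h h =
        (fderiv ℝ u (x + t • h) - fderiv ℝ u x - A (t • h)) h := by simp
    rw [h2]
    calc _ ≤ ‖fderiv ℝ u (x + t • h) - fderiv ℝ u x - A (t • h)‖ * ‖h‖ :=
          ContinuousLinearMap.le_opNorm _ _
      _ ≤ (ε * ‖h‖) * ‖h‖ := by
          gcongr
          exact h1.trans (mul_le_mul_of_nonneg_left hth hε.le)
      _ = _ := by ring

lemma norm_quatUnit (k : Fin 4) : ‖quatUnit k‖ = 1 := by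
  have h : ‖quatUnit k‖ ^ 2 = 1 := by
    rw [sq, ← Quaternion.normSq_eq_norm_mul_self, Quaternion.normSq_def']
    fin_cases k <;> simp [quatUnit]
  exact (pow_eq_one_iff_of_nonneg (norm_nonneg _) two_ne_zero).1 h

/-- The trace of a bilinear form does not depend on the orthonormal basis, and `u, ui, uj, uk` is
one. -/
lemma sum_bilin_mul_quatUnit (B : ℍ →ₗ[ℝ] ℍ →ₗ[ℝ] ℝ) (u : ℍ) (hu : ‖u‖ = 1) :
    ∑ k, B (u * quatUnit k) (u * quatUnit k) = ∑ k, B (quatUnit k) (quatUnit k) := by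
  have hex : ∀ k, B (u * quatUnit k) (u * quatUnit k) = ∑ c, ∑ d,
      ((star (quatUnit c) * u * quatUnit k).re * (star (quatUnit d) * u * quatUnit k).re) *
        B (quatUnit c) (quatUnit d) := by
    intro k
    conv_lhs => rw [← sum_re_quatUnit (u * quatUnit k)]
    simp only [map_sum, map_smul, LinearMap.sum_apply, LinearMap.smul_apply, smul_eq_mul,
      Finset.mul_sum, mul_assoc]
    rw [Finset.sum_comm]
    refine Finset.sum_congr rfl fun c _ => Finset.sum_congr rfl fun d _ => ?_
    ring
  have horth : ∀ c d, ∑ k, (star (quatUnit c) * u * quatUnit k).re *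
      (star (quatUnit d) * u * quatUnit k).re = if c = d then 1 else 0 := by
    intro c d
    rw [← re_star_mul]
    have h1 : star (star (quatUnit c) * u) * (star (quatUnit d) * u) =
        star u * (quatUnit c * star (quatUnit d) * u) := by simp [mul_assoc]
    have h2 : u * star u = 1 := by
      rw [Quaternion.self_mul_star, Quaternion.normSq_eq_norm_mul_self, hu]; simp
    have h3 : ∀ p q : ℍ, (p * q).re = (q * p).re := by
      intro p q; simp; ring
    rw [h1, h3, mul_assoc, h2, mul_one]
    fin_cases c <;> fin_cases d <;>
      simp [Quaternion.re_mul, quatUnit_re, quatUnit_imI, quatUnit_imJ, quatUnit_imK]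
  simp only [hex]
  rw [Finset.sum_comm]
  refine Finset.sum_congr rfl fun c _ => ?_
  rw [Finset.sum_comm]
  simp only [← Finset.sum_mul, horth]
  simp

/-- Right multiplication by each of `1, i, j, k` leaves the mean unchanged, while the four rotated
integrands add up to the constant trace. -/
lemma average_sphere_bilin (B : ℍ →ₗ[ℝ] ℍ →ₗ[ℝ] ℝ) :
    ⨍ u : Metric.sphere (0 : ℍ) 1, B u u ∂(volume : Measure ℍ).toSphere =
      (∑ k, B (quatUnit k) (quatUnit k)) / 4 := by
  have hB : Continuous fun u : ℍ => B u u := by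
    have : Continuous fun p : ℍ × ℍ => B p.1 p.2 := by
      have h := (LinearMap.toContinuousBilinearMap B).continuous₂
      exact h
    exact this.comp (continuous_id.prodMk continuous_id)
  have h1 : ∀ k, ⨍ u : Metric.sphere (0 : ℍ) 1, B (u * quatUnit k) (u * quatUnit k)
      ∂(volume : Measure ℍ).toSphere =
      ⨍ u : Metric.sphere (0 : ℍ) 1, B u u ∂(volume : Measure ℍ).toSphere := fun k =>
    average_sphere_comp (rightMulIsometry _ (norm_quatUnit k)) (fun u => B u u)
  have h2 : ∑ k, ⨍ u : Metric.sphere (0 : ℍ) 1, B (u * quatUnit k) (u * quatUnit k)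
      ∂(volume : Measure ℍ).toSphere = ∑ k, B (quatUnit k) (quatUnit k) := by
    simp only [average]
    rw [← integral_finsetSum]
    · have h3 : ∀ u : Metric.sphere (0 : ℍ) 1, ∑ k, B (u * quatUnit k) (u * quatUnit k) =
          ∑ k, B (quatUnit k) (quatUnit k) := fun u => sum_bilin_mul_quatUnit B u (by simp)
      simp only [h3]
      exact average_const _ _
    · intro k _
      exact integrable_average_of_continuous (hB.comp (by fun_prop))
  simp only [h1] at h2
  simp at h2
  rw [← h2]
  ring

lemma toQuat_rightMul (k : Fin 4) (x : Fin n × Fin 4 → ℝ) (i : Fin n) :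
    toQuat n (rightMul n k *ᵥ x) i = toQuat n x i * quatUnit k := by
  rw [← sum_re_quatUnit (toQuat n x i * quatUnit k)]
  simp only [toQuat, LinearMap.coe_mk, AddHom.coe_mk]
  refine Finset.sum_congr rfl fun c _ => ?_
  congr 1
  simp only [mulVec, dotProduct, rightMul, of_apply, Fintype.sum_prod_type, ite_mul, zero_mul,
    Finset.sum_ite_irrel, Finset.sum_const_zero, Finset.sum_ite_eq, Finset.mem_univ, if_true,
    Finset.sum_mul, Finset.mul_sum, re_sum]
  refine Finset.sum_congr rfl fun a _ => ?_
  simp [mul_assoc]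
  ring

lemma toQuat_eq_sum (y : Fin n × Fin 4 → ℝ) : toQuat n y = ∑ p, y p • coordVec n p := by
  ext1 i
  rw [Finset.sum_apply, Fintype.sum_prod_type, Finset.sum_eq_single i]
  · simp [toQuat, coordVec]
  · intro j _ hj
    simp [coordVec, hj.symm]
  · simp

/-- The Hessian of a smooth plurisubharmonic function lies in the cone `pshCone n`. -/
theorem IsQuatPshOn.hess_mem_pshCone {W : Set (Fin n → ℍ)} {w : (Fin n → ℍ) → ℝ}
    (hw : ContDiff ℝ 2 w) (hpsh : IsQuatPshOn w W) {x₀ : Fin n → ℍ} (hx₀ : x₀ ∈ W) :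
    hess (coordVec n) w x₀ ∈ pshCone n := by
  intro x
  set v := toQuat n x with hv_def
  set A := fderiv ℝ (fderiv ℝ w) x₀ with hA
  let L : ℍ →ₗ[ℝ] (Fin n → ℍ) :=
    { toFun := fun q i => v i * q
      map_add' := fun p q => by ext1 i; exact mul_add _ _ _
      map_smul' := fun c q => by ext1 i; exact mul_smul_comm _ _ _ }
  let B : ℍ →ₗ[ℝ] ℍ →ₗ[ℝ] ℝ :=
    LinearMap.mk₂ ℝ (fun p q => A (L p) (L q)) (by simp) (by simp) (by simp) (by simp)
  have hB : ∀ p q, B p q = A (L p) (L q) := fun p q => rfl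
  have hsum : ∑ k, ∑ p, ∑ q, hess (coordVec n) w x₀ p q * (rightMul n k *ᵥ x) p *
      (rightMul n k *ᵥ x) q = ∑ k, B (quatUnit k) (quatUnit k) := by
    refine Finset.sum_congr rfl fun k _ => ?_
    have hL : L (quatUnit k) = ∑ p, (rightMul n k *ᵥ x) p • coordVec n p := by
      rw [← toQuat_eq_sum]
      ext1 i
      exact (toQuat_rightMul k x i).symm
    rw [hB, hL]
    simp only [map_sum, map_smul, _root_.sum_apply, _root_.smul_apply, smul_eq_mul, Finset.mul_sum]
    rw [Finset.sum_comm]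
    refine Finset.sum_congr rfl fun p _ => Finset.sum_congr rfl fun q _ => ?_
    rw [hess, dirDeriv_dirDeriv_eq hw.contDiffAt,
      (hw.contDiffAt.isSymmSndFDerivAt (by simp)).eq]
    ring
  rw [hsum]
  set T := ∑ k, B (quatUnit k) (quatUnit k) with hT
  by_cases hv : v = 0
  · have : ∀ k, B (quatUnit k) (quatUnit k) = 0 := by
      intro k
      have : L (quatUnit k) = 0 := by ext1 i; simp [L, hv]
      rw [hB, this, map_zero]
    simp [hT, this]
  have hLn : ∀ q, ‖L q‖ ≤ ‖v‖ * ‖q‖ := fun q =>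
    (pi_norm_le_iff_of_nonneg (by positivity)).2 fun i => by
      change ‖v i * q‖ ≤ _
      rw [norm_mul]
      exact mul_le_mul_of_nonneg_right (norm_le_pi_norm v i) (norm_nonneg _)
  have hv' : 0 < ‖v‖ := norm_pos_iff.2 hv
  have hLc : Continuous L := L.continuous_of_finiteDimensional
  have hline : ∀ q, lineMap x₀ v q = x₀ + L q := fun q => rfl
  -- In the mean of the Taylor expansion the linear term is odd and vanishes, and the quadratic term
  -- gives `r ^ 2 / 2 * (T / 4)`; dividing by `r ^ 2` leaves `T / 8` and the error.
  have hmain : ∀ ε > 0, 0 ≤ T / 8 + ε * ‖v‖ ^ 2 := by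
    intro ε hε
    obtain ⟨δ, hδ, htay⟩ := abs_taylor_two_le hw x₀ hε
    have hsub := (hpsh.2 x₀ v hv).2 0 (by simpa using hx₀)
    obtain ⟨r, hr, hr0, hrδ⟩ := (hsub.and (Ioo_mem_nhdsGT (div_pos hδ hv'))).exists
    have h1 : w x₀ ≤ ⨍ u : Metric.sphere (0 : ℍ) 1, w (x₀ + r • L u)
        ∂(volume : Measure ℍ).toSphere := by
      have := hr.2
      change w (lineMap x₀ v 0) ≤ ⨍ u : Metric.sphere (0 : ℍ) 1, w (lineMap x₀ v (0 + r • (u : ℍ)))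
        ∂(volume : Measure ℍ).toSphere at this
      simpa only [hline, map_zero, add_zero, zero_add, map_smul] using this
    have hLu : ∀ u : Metric.sphere (0 : ℍ) 1, ‖r • L u‖ ≤ r * ‖v‖ := by
      intro u
      have := hLn u
      rw [show ‖(u : ℍ)‖ = 1 by simp, mul_one] at this
      rw [norm_smul, Real.norm_of_nonneg hr0.le]
      exact mul_le_mul_of_nonneg_left this hr0.le
    have hup : ∀ u : Metric.sphere (0 : ℍ) 1, w (x₀ + r • L u) ≤
        (w x₀ + ε * (r * ‖v‖) ^ 2) + (r * fderiv ℝ w x₀ (L u) + r ^ 2 / 2 * B u u) := by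
      intro u
      have hlt : ‖r • L u‖ < δ := (hLu u).trans_lt (by rwa [lt_div_iff₀ hv'] at hrδ)
      have h2 := (abs_le.1 (htay _ hlt)).2
      simp only [map_smul, _root_.smul_apply, smul_eq_mul, ← hA] at h2
      have h3 : ε * ‖r • L u‖ ^ 2 ≤ ε * (r * ‖v‖) ^ 2 := by
        gcongr; exact hLu u
      rw [hB]
      nlinarith
    have hDc : Continuous fun u : Metric.sphere (0 : ℍ) 1 => fderiv ℝ w x₀ (L u) :=
      (fderiv ℝ w x₀).continuous.comp (hLc.comp continuous_subtype_val)
    have hBc : Continuous fun u : Metric.sphere (0 : ℍ) 1 => B u u := by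
      have h : Continuous fun u : Metric.sphere (0 : ℍ) 1 => L u :=
        hLc.comp continuous_subtype_val
      exact (A.continuous.comp h).clm_apply h
    have c1 : Continuous fun u : Metric.sphere (0 : ℍ) 1 => r * fderiv ℝ w x₀ (L u) :=
      continuous_const.mul hDc
    have c2 : Continuous fun u : Metric.sphere (0 : ℍ) 1 => r ^ 2 / 2 * B u u :=
      continuous_const.mul hBc
    have i1 := integrable_average_of_continuous c1
    have i2 := integrable_average_of_continuous c2
    have i3 : Integrable (fun u : Metric.sphere (0 : ℍ) 1 => r * fderiv ℝ w x₀ (L u) +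
      r ^ 2 / 2 * B u u) _ := i1.add i2
    have hD0 : ⨍ u : Metric.sphere (0 : ℍ) 1, fderiv ℝ w x₀ (L u)
        ∂(volume : Measure ℍ).toSphere = 0 := by
      have := average_sphere_neg (fun u : ℍ => fderiv ℝ w x₀ (L u))
      simp only [map_neg] at this
      rw [average, integral_neg] at this
      rw [average] at this ⊢
      linarith
    have h2 : ⨍ u : Metric.sphere (0 : ℍ) 1, w (x₀ + r • L u) ∂(volume : Measure ℍ).toSphere ≤
        (w x₀ + ε * (r * ‖v‖) ^ 2) + (r * 0 + r ^ 2 / 2 * (T / 4)) := by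
      rw [← hD0, ← average_sphere_bilin B, average, average, average]
      have hwc : Continuous fun u : Metric.sphere (0 : ℍ) 1 => w (x₀ + r • L u) :=
        hw.continuous.comp (continuous_const.add
          ((hLc.comp continuous_subtype_val).const_smul r))
      refine (integral_mono (integrable_average_of_continuous hwc)
        ((integrable_const _).add i3) hup).trans_eq ?_
      rw [integral_add' (integrable_const _) i3, integral_add i1 i2, integral_const_mul,
        integral_const_mul]
      congr 1
      exact average_const _ _
    have h3 : 0 ≤ r ^ 2 * (T / 8 + ε * ‖v‖ ^ 2) := by linarith
    exact nonneg_of_mul_nonneg_right h3 (pow_pos hr0 2)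
  by_contra! hneg
  -- For negative `T` this error offsets only half of `T / 8`.
  have := hmain (-T / (16 * ‖v‖ ^ 2)) (div_pos (by linarith) (by positivity))
  have h5 : -T / (16 * ‖v‖ ^ 2) * ‖v‖ ^ 2 = -T / 16 := by field_simp
  rw [h5] at this
  linarith

end PshHessian

/-! ### The Monge-Ampère pairing -/

section Pairing

open scoped ContDiff

variable {n : ℕ}

/-- The integral of `φ` against the Moore determinant of the quaternionic Hessian of `g`. -/
noncomputable def maPairing (φ g : (Fin n → ℍ) → ℝ) : ℝ :=
  ∫ x, φ x * mooreForm n (hess (coordVec n) g x)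

lemma setIntegral_mul_mooreDet_quatHessian {U : Set (Fin n → ℍ)} (hU : IsOpen U)
    {φ g : (Fin n → ℍ) → ℝ} (hg : ContDiffOn ℝ 2 g U) (hφU : tsupport φ ⊆ U) :
    ∫ x in U, φ x * mooreDet (quatHessian g x) = maPairing φ g := by
  have h0 : ∀ x, x ∉ U → φ x * mooreForm n (hess (coordVec n) g x) = 0 := fun x hx => by
    rw [image_eq_zero_of_notMem_tsupport fun h => hx (hφU h), zero_mul]
  rw [maPairing, ← setIntegral_eq_integral_of_forall_compl_eq_zero h0]
  refine setIntegral_congr_fun hU.measurableSet fun x hx => ?_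
  rw [mooreDet_quatHessian (hg.contDiffAt (hU.mem_nhds hx))]

lemma continuousOn_hess {E ι : Type*} [NormedAddCommGroup E] [NormedSpace ℝ E] (b : ι → E)
    {U : Set E} (hU : IsOpen U) {g : E → ℝ} (hg : ContDiffOn ℝ 2 g U) :
    ContinuousOn (hess b g) U := by
  have h1 : ContDiffOn ℝ 1 (fderiv ℝ g) U := hg.fderiv_of_isOpen hU le_rfl
  have h2 : ContDiffOn ℝ 0 (fderiv ℝ (fderiv ℝ g)) U := h1.fderiv_of_isOpen hU le_rfl
  refine continuousOn_pi.2 fun p => continuousOn_pi.2 fun q => ?_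
  refine ((h2.continuousOn.clm_apply continuousOn_const).clm_apply
    (continuousOn_const (c := b q)) : ContinuousOn (fun x => fderiv ℝ (fderiv ℝ g) x (b p) (b q)) U).congr
    fun x hx => ?_
  exact dirDeriv_dirDeriv_eq (hg.contDiffAt (hU.mem_nhds hx)) _ _

lemma continuous_mooreForm (n : ℕ) : Continuous (mooreForm n) := (contDiff_mooreForm n).continuous

lemma integrable_maPairing {U : Set (Fin n → ℍ)} (hU : IsOpen U) {φ g : (Fin n → ℍ) → ℝ}
    (hg : ContDiffOn ℝ 2 g U) (hφ : Continuous φ) (hc : HasCompactSupport φ)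
    (hφU : tsupport φ ⊆ U) :
    Integrable fun x => φ x * mooreForm n (hess (coordVec n) g x) := by
  have h : Continuous fun x => φ x * mooreForm n (hess (coordVec n) g x) :=
    (hφ.continuousOn.mul ((continuous_mooreForm n).comp_continuousOn
      (continuousOn_hess _ hU hg))).continuous_of_tsupport_subset hU
      ((closure_mono (Function.support_mul_subset_left _ _)).trans hφU)
  exact h.integrable_of_hasCompactSupport hc.mul_right

lemma maPairing_nonneg {U : Set (Fin n → ℍ)} {φ g : (Fin n → ℍ) → ℝ} (hg : ContDiff ℝ 2 g)
    (hpsh : IsQuatPshOn g U) (hφU : tsupport φ ⊆ U) (hφ : ∀ x, 0 ≤ φ x) : 0 ≤ maPairing φ g := by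
  refine integral_nonneg fun x => ?_
  by_cases hx : x ∈ U
  · exact mul_nonneg (hφ x) (mooreForm_nonneg (hpsh.hess_mem_pshCone hg hx))
  · simp [image_eq_zero_of_notMem_tsupport fun h => hx (hφU h)]

/-- A plurisubharmonic function of class `C²` has smooth plurisubharmonic approximations with nearly
the same Monge-Ampère pairing. -/
lemma exists_smooth_maPairing_approx {U W : Set (Fin n → ℍ)} (hU : IsOpen U)
    {φ f : (Fin n → ℍ) → ℝ} (hf : IsQuatPshOn f U) (hf2 : ContDiffOn ℝ 2 f U) (hφ : Continuous φ)
    (hc : HasCompactSupport φ) (hW : IsOpen W) (hφW : tsupport φ ⊆ W)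
    (hWc : IsCompact (closure W)) (hWU : closure W ⊆ U) {η : ℝ} (hη : 0 < η) :
    ∃ g : (Fin n → ℍ) → ℝ, ContDiff ℝ ∞ g ∧ IsQuatPshOn g W ∧ (∀ x ∈ W, |g x - f x| ≤ η) ∧
      |maPairing φ g - maPairing φ f| ≤ η := by
  have hφU : tsupport φ ⊆ U := hφW.trans (subset_closure.trans hWU)
  set I := ∫ x, |φ x| with hI
  have hI0 : 0 ≤ I := integral_nonneg fun x => abs_nonneg _
  have hκ : 0 < η / (I + 1) := by positivity
  have hK : IsCompact (hess (coordVec n) f '' tsupport φ) :=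
    hc.isCompact.image_of_continuousOn ((continuousOn_hess _ hU hf2).mono hφU)
  -- Only the Hessian of `f` has to lie in the compact set; that of `g` need only be close to it.
  obtain ⟨δ, hδ, hδK⟩ := Metric.mem_uniformity_dist.1 (hK.uniformContinuousAt_of_continuousAt
    (mooreForm n) (fun _ _ => (continuous_mooreForm n).continuousAt) (Metric.dist_mem_uniformity hκ))
  obtain ⟨g, hg, hgp, hgf, hgh⟩ := exists_smooth_psh_approx (coordVec n) hU hf hf2.continuousOn hW hWc
    hWU (lt_min hη (half_pos hδ))
  refine ⟨g, hg, hgp, fun x hx => (hgf x hx).trans (min_le_left _ _), ?_⟩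
  rw [maPairing, maPairing, ← integral_sub (integrable_maPairing isOpen_univ
    (contDiff_two hg).contDiffOn hφ hc (Set.subset_univ _)) (integrable_maPairing hU hf2 hφ hc hφU),
    ← Real.norm_eq_abs]
  have hb : ∀ x, ‖φ x * mooreForm n (hess (coordVec n) g x) -
      φ x * mooreForm n (hess (coordVec n) f x)‖ ≤ |φ x| * (η / (I + 1)) := by
    intro x
    by_cases hx : x ∈ tsupport φ
    · have hd : dist (hess (coordVec n) f x) (hess (coordVec n) g x) < δ := by
        refine lt_of_le_of_lt ?_ (half_lt_self hδ)
        refine (dist_pi_le_iff (half_pos hδ).le).2 fun p => (dist_pi_le_iff (half_pos hδ).le).2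
          fun q => ?_
        rw [dist_comm, Real.dist_eq]
        exact (hgh hf2 x (hφW hx) p q).trans (min_le_right _ _)
      have := hδK hd ⟨x, hx, rfl⟩
      rw [← mul_sub, norm_mul, Real.norm_eq_abs]
      refine mul_le_mul_of_nonneg_left ?_ (abs_nonneg _)
      rw [← dist_eq_norm, dist_comm]
      exact le_of_lt this
    · simp [image_eq_zero_of_notMem_tsupport hx]
  have hint : Integrable fun x => |φ x| := (hφ.integrable_of_hasCompactSupport hc).abs
  refine (norm_integral_le_of_norm_le (hint.mul_const _) (Eventually.of_forall hb)).trans ?_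
  rw [integral_mul_const, ← hI, mul_div_assoc', div_le_iff₀ (by positivity)]
  nlinarith

/-- The quantitative continuity of the Monge-Ampère pairing in the uniform norm. -/
theorem exists_delta_maPairing {W : Set (Fin n → ℍ)} {φ : (Fin n → ℍ) → ℝ} (hφ : Continuous φ)
    (hc : HasCompactSupport φ) (hW : IsOpen W) (hφW : tsupport φ ⊆ W) (hWc : IsCompact (closure W))
    (M : ℝ) {ε : ℝ} (hε : 0 < ε) :
    ∃ δ > 0, ∀ U V g h, IsOpen U → IsOpen V → closure W ⊆ U → closure W ⊆ V →
      ContDiffOn ℝ 2 g U → ContDiffOn ℝ 2 h V → IsQuatPshOn g U → IsQuatPshOn h V →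
      (∀ x ∈ W, |g x| ≤ M) → (∀ x ∈ W, |h x| ≤ M) → (∀ x ∈ W, |g x - h x| ≤ δ) →
      |maPairing φ g - maPairing φ h| ≤ ε := by
  -- The smooth replacements of `g` and `h` may exceed the bound `M` by `1`, and each uses up a
  -- third of `δ` and of `ε`.
  obtain ⟨δ, hδ, H⟩ := (isNullLagrangian_mooreForm n).exists_delta (μ := volume) outer_mem_pshCone
    (coordVec n) hφ hc hW hφW (M + 1) (show 0 < ε / 3 by positivity)
  refine ⟨δ / 3, by positivity, ?_⟩
  intro U V g h hU hV hWU hWV hg2 hh2 hg hh hgM hhM hgh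
  have hη : 0 < min 1 (min (δ / 3) (ε / 3)) := by positivity
  obtain ⟨g', hg's, hg'p, hg'1, hg'2⟩ :=
    exists_smooth_maPairing_approx hU hg hg2 hφ hc hW hφW hWc hWU hη
  obtain ⟨h', hh's, hh'p, hh'1, hh'2⟩ :=
    exists_smooth_maPairing_approx hV hh hh2 hφ hc hW hφW hWc hWV hη
  have e1 : min 1 (min (δ / 3) (ε / 3)) ≤ 1 := min_le_left _ _
  have e2 : min 1 (min (δ / 3) (ε / 3)) ≤ δ / 3 := (min_le_right _ _).trans (min_le_left _ _)
  have e3 : min 1 (min (δ / 3) (ε / 3)) ≤ ε / 3 := (min_le_right _ _).trans (min_le_right _ _)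
  have hadm : ∀ {u w : (Fin n → ℍ) → ℝ}, ContDiff ℝ ∞ u → IsQuatPshOn u W →
      (∀ x ∈ W, |u x - w x| ≤ min 1 (min (δ / 3) (ε / 3))) → (∀ x ∈ W, |w x| ≤ M) →
      IsAdmissible (coordVec n) (pshCone n) W (M + 1) u := by
    intro u w hu hup huw hw
    refine ⟨hu, fun x hx => hup.hess_mem_pshCone (contDiff_two hu) hx, fun x hx => ?_⟩
    have a1 := abs_sub_abs_le_abs_sub (u x) (w x)
    linarith [huw x hx, hw x hx]
  have key := H g' h' (hadm hg's hg'p hg'1 hgM) (hadm hh's hh'p hh'1 hhM) fun x hx => by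
    have a1 := abs_le.1 (hg'1 x hx)
    have a2 := abs_le.1 (hh'1 x hx)
    have a3 := abs_le.1 (hgh x hx)
    rw [abs_le]
    constructor <;> linarith
  change |maPairing φ g' - maPairing φ h'| ≤ ε / 3 at key
  have b1 := abs_le.1 key
  have b2 := abs_le.1 hg'2
  have b3 := abs_le.1 hh'2
  rw [abs_le]
  constructor <;> linarith

/-- Two sequences of plurisubharmonic functions of class `C²` with the same uniform limit have
Monge-Ampère pairings that approach each other. -/
theorem maPairing_cauchy {W U V : Set (Fin n → ℍ)} {φ f : (Fin n → ℍ) → ℝ} (hφ : Continuous φ)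
    (hc : HasCompactSupport φ) (hW : IsOpen W) (hφW : tsupport φ ⊆ W) (hWc : IsCompact (closure W))
    (hf : ContinuousOn f (closure W)) (hU : IsOpen U) (hV : IsOpen V) (hWU : closure W ⊆ U)
    (hWV : closure W ⊆ V) {g h : ℕ → (Fin n → ℍ) → ℝ} (hg2 : ∀ k, ContDiffOn ℝ 2 (g k) U)
    (hh2 : ∀ k, ContDiffOn ℝ 2 (h k) V) (hg : ∀ k, IsQuatPshOn (g k) U)
    (hh : ∀ k, IsQuatPshOn (h k) V) (hgf : TendstoUniformlyOn g f atTop W)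
    (hhf : TendstoUniformlyOn h f atTop W) {ε : ℝ} (hε : 0 < ε) :
    ∃ N, ∀ k ≥ N, ∀ m ≥ N, |maPairing φ (g k) - maPairing φ (h m)| ≤ ε := by
  obtain ⟨M, hM⟩ := hWc.exists_bound_of_continuousOn hf
  obtain ⟨δ, hδ, H⟩ := exists_delta_maPairing hφ hc hW hφW hWc (M + 1) hε
  have hκ : 0 < min 1 (δ / 2) := by positivity
  obtain ⟨N, hN⟩ := eventually_atTop.1 ((Metric.tendstoUniformlyOn_iff.1 hgf _ hκ).and
    (Metric.tendstoUniformlyOn_iff.1 hhf _ hκ))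
  have e1 : min 1 (δ / 2) ≤ 1 := min_le_left _ _
  have e2 : min 1 (δ / 2) ≤ δ / 2 := min_le_right _ _
  have hbd : ∀ {u : (Fin n → ℍ) → ℝ}, (∀ x ∈ W, dist (f x) (u x) < min 1 (δ / 2)) →
      ∀ x ∈ W, |u x| ≤ M + 1 := by
    intro u hu x hx
    have a1 := hu x hx
    have a2 := hM x (subset_closure hx)
    rw [dist_comm, Real.dist_eq] at a1
    rw [Real.norm_eq_abs] at a2
    have a3 := abs_sub_abs_le_abs_sub (u x) (f x)
    linarith
  refine ⟨N, fun k hk m hm => H U V _ _ hU hV hWU hWV (hg2 k) (hh2 m) (hg k) (hh m)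
    (hbd (hN k hk).1) (hbd (hN m hm).2) fun x hx => ?_⟩
  have a1 := (hN k hk).1 x hx
  have a2 := (hN m hm).2 x hx
  rw [Real.dist_eq] at a1 a2
  have b1 := abs_lt.1 a1
  have b2 := abs_lt.1 a2
  rw [abs_le]
  constructor <;> linarith

/-- A continuous plurisubharmonic function is near a compact set the uniform limit of smooth
plurisubharmonic functions. -/
lemma exists_smooth_psh_seq {Ω K : Set (Fin n → ℍ)} (hΩ : IsOpen Ω) {f : (Fin n → ℍ) → ℝ}
    (hf : IsQuatPshOn f Ω) (hc : ContinuousOn f Ω) (hK : IsCompact K) (hKΩ : K ⊆ Ω) :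
    ∃ (W : Set (Fin n → ℍ)) (g : ℕ → (Fin n → ℍ) → ℝ), IsOpen W ∧ K ⊆ W ∧ W ⊆ Ω ∧
      (∀ k, ContDiff ℝ ∞ (g k)) ∧ (∀ k, IsQuatPshOn (g k) W) ∧ TendstoUniformlyOn g f atTop W := by
  obtain ⟨W, hW, hKW, hWΩ, hWc⟩ := exists_open_between_and_isCompact_closure hK hΩ hKΩ
  choose g hg hgp hgf _ using fun k : ℕ => exists_smooth_psh_approx (coordVec n) hΩ hf hc hW hWc hWΩ
    (Nat.one_div_pos_of_nat (α := ℝ) (n := k))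
  refine ⟨W, g, hW, hKW, subset_closure.trans hWΩ, hg, hgp, Metric.tendstoUniformlyOn_iff.2
    fun ε hε => ?_⟩
  filter_upwards [tendsto_one_div_add_atTop_nhds_zero_nat.eventually (gt_mem_nhds hε)]
    with k hk x hx
  rw [dist_comm, Real.dist_eq]
  exact (hgf k x hx).trans_lt hk

/-- The limit of the Monge-Ampère pairings of approximating sequences. -/
theorem exists_maPairing_limit {Ω : Set (Fin n → ℍ)} (hΩ : IsOpen Ω) {φ f : (Fin n → ℍ) → ℝ}
    (hf : IsQuatPshOn f Ω) (hfc : ContinuousOn f Ω) (hφ : Continuous φ) (hc : HasCompactSupport φ)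
    (hφΩ : tsupport φ ⊆ Ω) :
    ∃ L : ℝ, ∀ U ⊆ Ω, IsOpen U → ∀ g : ℕ → (Fin n → ℍ) → ℝ,
      (∀ k, ContDiffOn ℝ 2 (g k) U) → (∀ k, IsQuatPshOn (g k) U) →
      (∀ K ⊆ U, IsCompact K → TendstoUniformlyOn g f atTop K) → tsupport φ ⊆ U →
        Tendsto (fun k => maPairing φ (g k)) atTop (𝓝 L) := by
  -- One reference sequence defines the limit; any other is compared with it near the support of
  -- `φ`, where both converge uniformly.
  obtain ⟨W, g, hW, hφW, hWΩ, hg, hgp, hgf⟩ := exists_smooth_psh_seq hΩ hf hfc hc.isCompact hφΩ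
  have hg2 : ∀ k, ContDiffOn ℝ 2 (g k) W := fun k => (contDiff_two (hg k)).contDiffOn
  obtain ⟨V, hV, hφV, hVW, hVc⟩ := exists_open_between_and_isCompact_closure hc.isCompact hW hφW
  have hgV := hgf.mono (subset_closure.trans hVW)
  have hcauchy : CauchySeq fun k => maPairing φ (g k) := by
    refine Metric.cauchySeq_iff.2 fun ε hε => ?_
    obtain ⟨N, hN⟩ := maPairing_cauchy hφ hc hV hφV hVc (hfc.mono (hVW.trans hWΩ)) hW hW hVW hVW
      hg2 hg2 hgp hgp hgV hgV (half_pos hε)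
    exact ⟨N, fun k hk m hm => (hN k hk m hm).trans_lt (half_lt_self hε)⟩
  obtain ⟨L, hL⟩ := cauchySeq_tendsto_of_complete hcauchy
  refine ⟨L, fun U hUΩ hU h hh2 hhp hhf hφU => ?_⟩
  obtain ⟨V', hV', hφV', hVW', hVc'⟩ := exists_open_between_and_isCompact_closure hc.isCompact
    (hU.inter hW) (Set.subset_inter hφU hφW)
  have hdiff : Tendsto (fun k => maPairing φ (h k) - maPairing φ (g k)) atTop (𝓝 0) := by
    refine Metric.tendsto_atTop.2 fun ε hε => ?_
    obtain ⟨N, hN⟩ := maPairing_cauchy hφ hc hV' hφV' hVc'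
      (hfc.mono (hVW'.trans (Set.inter_subset_left.trans hUΩ))) hU hW
      (hVW'.trans Set.inter_subset_left) (hVW'.trans Set.inter_subset_right) hh2 hg2 hhp hgp
      ((hhf _ (hVW'.trans Set.inter_subset_left) hVc').mono subset_closure)
      (hgf.mono (subset_closure.trans (hVW'.trans Set.inter_subset_right))) (half_pos hε)
    refine ⟨N, fun k hk => ?_⟩
    rw [Real.dist_eq, sub_zero]
    exact (hN k hk k hk).trans_lt (half_lt_self hε)
  simpa using hdiff.add hL

end Pairing

/-! ### Existence and uniqueness of the Monge-Ampère measure -/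

section MongeAmpere

open scoped ContDiff CompactlySupported

variable {n : ℕ} {Ω : Set (Fin n → ℍ)} {f : (Fin n → ℍ) → ℝ}

lemma IsMongeAmpereMeasure.tendsto_maPairing {μ : Measure (Fin n → ℍ)}
    (hμ : IsMongeAmpereMeasure Ω f μ) {U : Set (Fin n → ℍ)} (hUΩ : U ⊆ Ω) (hU : IsOpen U)
    {g : ℕ → (Fin n → ℍ) → ℝ} (hg : ∀ k, ContDiffOn ℝ 2 (g k) U) (hgp : ∀ k, IsQuatPshOn (g k) U)
    (hgf : TendstoUniformlyOn g f atTop U) {φ : (Fin n → ℍ) → ℝ} (hφ : Continuous φ)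
    (hc : HasCompactSupport φ) (hφU : tsupport φ ⊆ U) :
    Tendsto (fun k => maPairing φ (g k)) atTop (𝓝 (∫ x, φ x ∂μ)) := by
  have h := hμ.tendsto U hUΩ hU g hg hgp (fun K hK _ => hgf.mono hK) φ hφ hc hφU
  simpa only [setIntegral_mul_mooreDet_quatHessian hU (hg _) hφU] using h

/-- Extension by zero of a compactly supported function on an open subset. -/
noncomputable def zeroExtend (ψ : C_c(Ω, ℝ)) : (Fin n → ℍ) → ℝ := Function.extend Subtype.val ψ 0

lemma zeroExtend_coe (ψ : C_c(Ω, ℝ)) (x : Ω) : zeroExtend ψ x = ψ x :=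
  Subtype.val_injective.extend_apply _ _ _

lemma zeroExtend_of_notMem (ψ : C_c(Ω, ℝ)) {x : Fin n → ℍ} (hx : x ∉ Ω) : zeroExtend ψ x = 0 :=
  Function.extend_apply' _ _ _ (by rintro ⟨y, rfl⟩; exact hx y.2)

lemma continuous_zeroExtend (hΩ : IsOpen Ω) (ψ : C_c(Ω, ℝ)) : Continuous (zeroExtend ψ) :=
  HasCompactSupport.continuous_extend_zero hΩ ψ.continuous ψ.hasCompactSupport

lemma hasCompactSupport_zeroExtend (ψ : C_c(Ω, ℝ)) : HasCompactSupport (zeroExtend ψ) :=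
  ψ.hasCompactSupport.extend_zero continuous_subtype_val

lemma tsupport_zeroExtend_subset (ψ : C_c(Ω, ℝ)) : tsupport (zeroExtend ψ) ⊆ Ω :=
  (ψ.hasCompactSupport.tsupport_extend_zero_subset continuous_subtype_val).trans
    (Subtype.coe_image_subset _ _)

lemma zeroExtend_add (ψ₁ ψ₂ : C_c(Ω, ℝ)) (x : Fin n → ℍ) :
    zeroExtend (ψ₁ + ψ₂) x = zeroExtend ψ₁ x + zeroExtend ψ₂ x := by
  by_cases hx : x ∈ Ω
  · lift x to Ω using hx
    simp [zeroExtend_coe]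
  · simp [zeroExtend_of_notMem _ hx]

lemma zeroExtend_smul (c : ℝ) (ψ : C_c(Ω, ℝ)) (x : Fin n → ℍ) :
    zeroExtend (c • ψ) x = c * zeroExtend ψ x := by
  by_cases hx : x ∈ Ω
  · lift x to Ω using hx
    simp [zeroExtend_coe]
  · simp [zeroExtend_of_notMem _ hx]

/-- The restriction to an open subset of a function with compact support in it. -/
noncomputable def restrictCc (φ : (Fin n → ℍ) → ℝ) (hφ : Continuous φ) (hc : HasCompactSupport φ)
    (hφΩ : tsupport φ ⊆ Ω) : C_c(Ω, ℝ) where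
  toFun x := φ x
  continuous_toFun := hφ.comp continuous_subtype_val
  hasCompactSupport' := by
    refine HasCompactSupport.intro (K := Subtype.val ⁻¹' tsupport φ) ?_ fun x hx =>
      image_eq_zero_of_notMem_tsupport hx
    rw [Subtype.isCompact_iff, Subtype.image_preimage_coe, Set.inter_eq_right.2 hφΩ]
    exact hc

lemma zeroExtend_restrictCc {φ : (Fin n → ℍ) → ℝ} (hφ : Continuous φ) (hc : HasCompactSupport φ)
    (hφΩ : tsupport φ ⊆ Ω) : zeroExtend (restrictCc φ hφ hc hφΩ) = φ := by
  ext x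
  by_cases hx : x ∈ Ω
  · lift x to Ω using hx
    rw [zeroExtend_coe]
    rfl
  · rw [zeroExtend_of_notMem _ hx, image_eq_zero_of_notMem_tsupport fun h => hx (hφΩ h)]

/-- The limits of the pairings form a positive linear functional on compactly supported functions:
linearity and sign are read off from a smooth sequence near the supports involved. The Riesz theorem
on the locally compact space `Ω` represents it. -/
theorem exists_isMongeAmpereMeasure (hΩ : IsOpen Ω) (hf : IsQuatPshOn f Ω)
    (hfc : ContinuousOn f Ω) : ∃ μ, IsMongeAmpereMeasure Ω f μ := by
  choose L hL using fun ψ : C_c(Ω, ℝ) => exists_maPairing_limit hΩ hf hfc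
    (continuous_zeroExtend hΩ ψ) (hasCompactSupport_zeroExtend ψ) (tsupport_zeroExtend_subset ψ)
  have hL' : ∀ (ψ : C_c(Ω, ℝ)) {W : Set (Fin n → ℍ)} {g : ℕ → (Fin n → ℍ) → ℝ}, IsOpen W → W ⊆ Ω →
      (∀ k, ContDiff ℝ ∞ (g k)) → (∀ k, IsQuatPshOn (g k) W) → TendstoUniformlyOn g f atTop W →
      tsupport (zeroExtend ψ) ⊆ W →
      Tendsto (fun k => maPairing (zeroExtend ψ) (g k)) atTop (𝓝 (L ψ)) :=
    fun ψ W g hW hWΩ hg hgp hgf hψ => hL ψ W hWΩ hW g (fun k => (contDiff_two (hg k)).contDiffOn)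
      hgp (fun K hK _ => hgf.mono hK) hψ
  have hint : ∀ (ψ : C_c(Ω, ℝ)) {g : (Fin n → ℍ) → ℝ}, ContDiff ℝ ∞ g →
      Integrable fun x => zeroExtend ψ x * mooreForm n (hess (coordVec n) g x) := fun ψ g hg =>
    integrable_maPairing isOpen_univ (contDiff_two hg).contDiffOn (continuous_zeroExtend hΩ ψ)
      (hasCompactSupport_zeroExtend ψ) (Set.subset_univ _)
  have hadd : ∀ ψ₁ ψ₂, L (ψ₁ + ψ₂) = L ψ₁ + L ψ₂ := by
    intro ψ₁ ψ₂
    obtain ⟨W, g, hW, hKW, hWΩ, hg, hgp, hgf⟩ := exists_smooth_psh_seq hΩ hf hfc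
      ((hasCompactSupport_zeroExtend ψ₁).isCompact.union (hasCompactSupport_zeroExtend ψ₂).isCompact)
      (Set.union_subset (tsupport_zeroExtend_subset ψ₁) (tsupport_zeroExtend_subset ψ₂))
    have hs : tsupport (zeroExtend (ψ₁ + ψ₂)) ⊆ W := by
      refine Set.Subset.trans ?_ hKW
      have : zeroExtend (ψ₁ + ψ₂) = zeroExtend ψ₁ + zeroExtend ψ₂ := funext (zeroExtend_add ψ₁ ψ₂)
      rw [this]
      exact tsupport_add _ _
    refine tendsto_nhds_unique (hL' _ hW hWΩ hg hgp hgf hs) ?_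
    refine ((hL' ψ₁ hW hWΩ hg hgp hgf (Set.subset_union_left.trans hKW)).add
      (hL' ψ₂ hW hWΩ hg hgp hgf (Set.subset_union_right.trans hKW))).congr fun k => ?_
    rw [maPairing, maPairing, maPairing, ← integral_add (hint ψ₁ (hg k)) (hint ψ₂ (hg k))]
    refine integral_congr_ae (Eventually.of_forall fun x => ?_)
    simp only [zeroExtend_add, add_mul]
  have hsmul : ∀ (c : ℝ) ψ, L (c • ψ) = c • L ψ := by
    intro c ψ
    obtain ⟨W, g, hW, hKW, hWΩ, hg, hgp, hgf⟩ := exists_smooth_psh_seq hΩ hf hfc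
      (hasCompactSupport_zeroExtend ψ).isCompact (tsupport_zeroExtend_subset ψ)
    have hs : tsupport (zeroExtend (c • ψ)) ⊆ W := by
      have : Function.support (zeroExtend (c • ψ)) ⊆ Function.support (zeroExtend ψ) :=
        fun x hx h => hx (by rw [zeroExtend_smul, h, mul_zero])
      exact (closure_mono this).trans hKW
    refine tendsto_nhds_unique (hL' _ hW hWΩ hg hgp hgf hs) ?_
    refine ((hL' ψ hW hWΩ hg hgp hgf hKW).const_smul c).congr fun k => ?_
    rw [maPairing, maPairing, smul_eq_mul, ← integral_const_mul]
    refine integral_congr_ae (Eventually.of_forall fun x => ?_)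
    simp only [zeroExtend_smul, mul_assoc]
  have hpos : ∀ ψ : C_c(Ω, ℝ), 0 ≤ ψ → 0 ≤ L ψ := by
    intro ψ hψ
    obtain ⟨W, g, hW, hKW, hWΩ, hg, hgp, hgf⟩ := exists_smooth_psh_seq hΩ hf hfc
      (hasCompactSupport_zeroExtend ψ).isCompact (tsupport_zeroExtend_subset ψ)
    refine ge_of_tendsto' (hL' ψ hW hWΩ hg hgp hgf hKW) fun k =>
      maPairing_nonneg (contDiff_two (hg k)) (hgp k) hKW fun x => ?_
    by_cases hx : x ∈ Ω
    · lift x to Ω using hx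
      rw [zeroExtend_coe]
      exact hψ x
    · rw [zeroExtend_of_notMem _ hx]
  have : LocallyCompactSpace Ω := hΩ.locallyCompactSpace
  let Λ : C_c(Ω, ℝ) →ₚ[ℝ] ℝ := PositiveLinearMap.mk₀ ⟨⟨L, hadd⟩, hsmul⟩ hpos
  have hΛ : ∀ ψ, Λ ψ = L ψ := fun _ => rfl
  have hemb : MeasurableEmbedding (Subtype.val : Ω → Fin n → ℍ) :=
    .subtype_coe hΩ.measurableSet
  -- The Riesz measure lives on the subtype `Ω`; pushed forward to `ℍⁿ`, it vanishes outside `Ω`.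
  refine ⟨(RealRMK.rieszMeasure Λ).map Subtype.val, ?_, ?_, ?_⟩
  · rw [hemb.map_apply]
    simp
  · intro K hKΩ hK
    rw [hemb.map_apply]
    refine IsCompact.measure_lt_top ?_
    rwa [Subtype.isCompact_iff, Subtype.image_preimage_coe, Set.inter_eq_right.2 hKΩ]
  · intro U hUΩ hU g hg hgp hgf φ hφ hc hφU
    simp only [setIntegral_mul_mooreDet_quatHessian hU (hg _) hφU]
    have h1 : ∫ x, φ x ∂(RealRMK.rieszMeasure Λ).map Subtype.val =
        L (restrictCc φ hφ hc (hφU.trans hUΩ)) := by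
      rw [hemb.integral_map, ← hΛ, ← RealRMK.integral_rieszMeasure]
      rfl
    have h2 := hL (restrictCc φ hφ hc (hφU.trans hUΩ)) U hUΩ hU g hg hgp hgf
    rw [zeroExtend_restrictCc] at h2
    rw [h1]
    exact h2 hφU

lemma IsMongeAmpereMeasure.isLocallyFinite_comap {μ : Measure (Fin n → ℍ)}
    (hμ : IsMongeAmpereMeasure Ω f μ) (hΩ : IsOpen Ω) :
    IsFiniteMeasureOnCompacts (μ.comap (Subtype.val : Ω → Fin n → ℍ)) := by
  refine ⟨fun K hK => ?_⟩
  rw [(MeasurableEmbedding.subtype_coe hΩ.measurableSet).comap_apply]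
  exact hμ.lt_top_of_isCompact _ (Subtype.coe_image_subset _ _) (hK.image continuous_subtype_val)

/-- Both measures give a test function the limit of the same smooth pairings. The comparison takes
place on the subtype `Ω`, since finiteness is only known on compact subsets of `Ω` and may fail near
its boundary. -/
theorem IsMongeAmpereMeasure.unique (hΩ : IsOpen Ω) (hf : IsQuatPshOn f Ω)
    (hfc : ContinuousOn f Ω) {μ ν : Measure (Fin n → ℍ)} (hμ : IsMongeAmpereMeasure Ω f μ)
    (hν : IsMongeAmpereMeasure Ω f ν) : μ = ν := by
  have : LocallyCompactSpace Ω := hΩ.locallyCompactSpace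
  have := hμ.isLocallyFinite_comap hΩ
  have := hν.isLocallyFinite_comap hΩ
  have hmap : ∀ {ρ : Measure (Fin n → ℍ)}, ρ Ωᶜ = 0 →
      (ρ.comap (Subtype.val : Ω → Fin n → ℍ)).map Subtype.val = ρ := fun {ρ} h => by
    rw [map_comap_subtype_coe hΩ.measurableSet]
    exact Measure.restrict_eq_self_of_ae_mem (mem_ae_iff.2 h)
  have hemb : MeasurableEmbedding (Subtype.val : Ω → Fin n → ℍ) := .subtype_coe hΩ.measurableSet
  have hint : ∀ {ρ : Measure (Fin n → ℍ)}, ρ Ωᶜ = 0 → ∀ ψ : C_c(Ω, ℝ),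
      ∫ x, ψ x ∂ρ.comap Subtype.val = ∫ x, zeroExtend ψ x ∂ρ := fun {ρ} h ψ => by
    conv_rhs => rw [← hmap h]
    rw [hemb.integral_map]
    simp only [zeroExtend_coe]
  have key : μ.comap (Subtype.val : Ω → Fin n → ℍ) = ν.comap Subtype.val := by
    refine Measure.ext_of_integral_eq_on_compactlySupported fun ψ => ?_
    rw [hint hμ.compl_eq_zero, hint hν.compl_eq_zero]
    obtain ⟨W, g, hW, hKW, hWΩ, hg, hgp, hgf⟩ := exists_smooth_psh_seq hΩ hf hfc
      (hasCompactSupport_zeroExtend ψ).isCompact (tsupport_zeroExtend_subset ψ)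
    have hg2 : ∀ k, ContDiffOn ℝ 2 (g k) W := fun k => (contDiff_two (hg k)).contDiffOn
    exact tendsto_nhds_unique
      (hμ.tendsto_maPairing hWΩ hW hg2 hgp hgf (continuous_zeroExtend hΩ ψ)
        (hasCompactSupport_zeroExtend ψ) hKW)
      (hν.tendsto_maPairing hWΩ hW hg2 hgp hgf (continuous_zeroExtend hΩ ψ)
        (hasCompactSupport_zeroExtend ψ) hKW)
  rw [← hmap hμ.compl_eq_zero, key, hmap hν.compl_eq_zero]

/-- Monge-Ampère measures converge weakly when the functions converge locally uniformly. -/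
theorem IsMongeAmpereMeasure.tendsto_integral (hΩ : IsOpen Ω) {F : ℕ → (Fin n → ℍ) → ℝ}
    (hcont : ∀ N, ContinuousOn (F N) Ω) (hpsh : ∀ N, IsQuatPshOn (F N) Ω)
    (hlim : ∀ K ⊆ Ω, IsCompact K → TendstoUniformlyOn F f atTop K)
    {μ : ℕ → Measure (Fin n → ℍ)} {ν : Measure (Fin n → ℍ)}
    (hμ : ∀ N, IsMongeAmpereMeasure Ω (F N) (μ N)) (hν : IsMongeAmpereMeasure Ω f ν)
    {φ : (Fin n → ℍ) → ℝ} (hφ : Continuous φ) (hc : HasCompactSupport φ) (hφΩ : tsupport φ ⊆ Ω) :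
    Tendsto (fun N => ∫ x, φ x ∂(μ N)) atTop (𝓝 (∫ x, φ x ∂ν)) := by
  obtain ⟨W, hW, hφW, hWΩ, hWc⟩ := exists_open_between_and_isCompact_closure hc.isCompact hΩ hφΩ
  -- The chosen `h N` follow `F N` both uniformly on `W` and in the pairing with `φ`. They thus
  -- converge to `f` uniformly on `W`, and the defining property of `ν` applies to them directly.
  have happ : ∀ N : ℕ, ∃ h : (Fin n → ℍ) → ℝ, ContDiff ℝ ∞ h ∧ IsQuatPshOn h W ∧
      (∀ x ∈ W, |h x - F N x| < 1 / ((N : ℝ) + 1)) ∧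
      |maPairing φ h - ∫ x, φ x ∂(μ N)| < 1 / ((N : ℝ) + 1) := by
    intro N
    have hN : (0 : ℝ) < 1 / ((N : ℝ) + 1) := Nat.one_div_pos_of_nat
    obtain ⟨V, g, hV, hWV, hVΩ, hg, hgp, hgf⟩ :=
      exists_smooth_psh_seq hΩ (hpsh N) (hcont N) hWc hWΩ
    have hWV' : W ⊆ V := subset_closure.trans hWV
    have h1 := (hμ N).tendsto_maPairing hVΩ hV (fun k => (contDiff_two (hg k)).contDiffOn) hgp hgf
      hφ hc (hφW.trans hWV')
    obtain ⟨k, hk1, hk2⟩ := ((Metric.tendsto_nhds.1 h1 _ hN).and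
      (Metric.tendstoUniformlyOn_iff.1 hgf _ hN)).exists
    refine ⟨g k, hg k, (hgp k).mono hWV', fun x hx => ?_, hk1⟩
    have := hk2 x (hWV' hx)
    rwa [dist_comm, Real.dist_eq] at this
  choose h hh hhp hhF hhμ using happ
  have h0 := tendsto_one_div_add_atTop_nhds_zero_nat (𝕜 := ℝ)
  have hFW : TendstoUniformlyOn F f atTop W := (hlim _ hWΩ hWc).mono subset_closure
  have hhf : TendstoUniformlyOn h f atTop W := by
    refine Metric.tendstoUniformlyOn_iff.2 fun ε hε => ?_
    filter_upwards [h0.eventually (gt_mem_nhds (half_pos hε)),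
      Metric.tendstoUniformlyOn_iff.1 hFW _ (half_pos hε)] with N h1 h2 x hx
    have h3 := hhF N x hx
    rw [← Real.dist_eq, dist_comm] at h3
    linarith [h2 x hx, dist_triangle (f x) (F N x) (h N x)]
  have h1 := hν.tendsto_maPairing (subset_closure.trans hWΩ) hW
    (fun k => (contDiff_two (hh k)).contDiffOn) hhp hhf hφ hc hφW
  have h2 : Tendsto (fun N => maPairing φ (h N) - ∫ x, φ x ∂(μ N)) atTop (𝓝 0) :=
    squeeze_zero_norm (fun N => (hhμ N).le) h0
  simpa using h1.sub h2

end MongeAmpere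

end QuatPsh

/-- For a sequence `F N` of continuous quaternionic plurisubharmonic functions that converges to `f`
uniformly on compact subsets of `Ω`, the limit is continuous and plurisubharmonic, all the
Monge-Ampère measures exist and are unique, and those of `F N` converge weakly to that of `f`. -/
theorem theorem2p1p11 (n : ℕ) (Ω : Set (Fin n → ℍ)) (hΩ : IsOpen Ω)
    (F : ℕ → (Fin n → ℍ) → ℝ) (f : (Fin n → ℍ) → ℝ)
    (hcont : ∀ N, ContinuousOn (F N) Ω)
    (hpsh : ∀ N, QuatPsh.IsQuatPshOn (F N) Ω)
    (hlim : ∀ K ⊆ Ω, IsCompact K → TendstoUniformlyOn F f atTop K) :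
    ContinuousOn f Ω ∧ QuatPsh.IsQuatPshOn f Ω ∧
    (∀ N, ∃! μ : Measure (Fin n → ℍ), QuatPsh.IsMongeAmpereMeasure Ω (F N) μ) ∧
    (∃! ν : Measure (Fin n → ℍ), QuatPsh.IsMongeAmpereMeasure Ω f ν) ∧
    ∀ (μ : ℕ → Measure (Fin n → ℍ)) (ν : Measure (Fin n → ℍ)),
      (∀ N, QuatPsh.IsMongeAmpereMeasure Ω (F N) (μ N)) →
      QuatPsh.IsMongeAmpereMeasure Ω f ν →
      ∀ φ : (Fin n → ℍ) → ℝ, Continuous φ → HasCompactSupport φ → tsupport φ ⊆ Ω →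
        Tendsto (fun N => ∫ x, φ x ∂(μ N)) atTop (𝓝 (∫ x, φ x ∂ν)) := by
  obtain ⟨hfc, hf⟩ := QuatPsh.isQuatPshOn_of_tendsto hΩ hcont hpsh hlim
  refine ⟨hfc, hf, fun N => ?_, ?_, fun μ ν hμ hν φ hφ hc hφΩ =>
    QuatPsh.IsMongeAmpereMeasure.tendsto_integral hΩ hcont hpsh hlim hμ hν hφ hc hφΩ⟩
  · obtain ⟨μ, hμ⟩ := QuatPsh.exists_isMongeAmpereMeasure hΩ (hpsh N) (hcont N)
    exact ⟨μ, hμ, fun _ hρ => hρ.unique hΩ (hpsh N) (hcont N) hμ⟩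
  · obtain ⟨ν, hν⟩ := QuatPsh.exists_isMongeAmpereMeasure hΩ hf hfc
    exact ⟨ν, hν, fun _ hρ => hρ.unique hΩ hf hfc hν⟩
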